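/- Notation. For $n\ge1$ let $\psi(n)=n\prod_{p\mid n}(1+1/p)$, let $q=e^{2\pi i\tau}$, and let $j(\tau)=q^{-1}+744+\cdots$ be the modular $j$-invariant on the upper half plane $\mathcal H$. Let $\hat h_1(x)={}_2F_1(\tfrac1{12},\tfrac5{12};1;x)$ for $|x|<1$. Call $\Gamma_0(M)$ of genus zero if the curve $X_0(M)=\Gamma_0(M)\backslash\mathcal H^*$ is rational, i.e. its function field is $\mathbb C(t)$ for a single function $t$ (a Hauptmodul). For $M\ge2$ with $\Gamma_0(M)$ of genus zero, the canonical Hauptmodul $t_M$ is the unique Hauptmodul for $\Gamma_0(M)$ that has a simple zero at the cusp $i\infty$ and a simple pole at the cusp $0$, normalized by $t_M(-1/(M\tau))=q^{-1}+O(1)$ as $\tau\to i\infty$; it is holomorphic on $\mathcal H$. Writing $j(\tau)=P_M(t_M(\tau))/Q_M(t_M(\tau))$ with coprime $P_M,Q_M\in\mathbb C[x]$, define, near $x=0$, $$h_M(x)=\left[P_M(x)/P_M(0)\right]^{-1/12}\,\hat h_1\!\left(12^3\,Q_M(x)/P_M(x)\right).$$ All fractional powers denote the principal branch, equal to $1$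 at $x=0$. Theorem. (1) Let $M\ge2$ with $\Gamma_0(M)$ of genus zero. Then $j(\tau)$ and $j(M\tau)$ are rational functions of $t_M(\tau)$, and if, in lowest terms, $j(\tau)=P(t_M(\tau))/Q(t_M(\tau))$ and $j(M\tau)=P'(t_M(\tau))/Q'(t_M(\tau))$ with $P,Q,P',Q'\in\mathbb C[x]$, then for all $x$ in a neighborhood of $0$ $$h_M(x)=\left[\frac{P(x)}{P(0)}\right]^{-1/12}\hat h_1\!\left(\frac{12^3Q(x)}{P(x)}\right)=\left[\frac{P'(x)}{P'(0)}\right]^{-1/12}\hat h_1\!\left(\frac{12^3Q'(x)}{P'(x)}\right).$$ (2) Let $M\ge2$, $N\ge1$ with $\Gamma_0(M)$ and $\Gamma_0(NM)$ of genus zero. Then $t_M(\tau)$ and $t_M(N\tau)$ are rational functions of $t_{NM}(\tau)$, and if, in lowest terms, $t_M(\tau)=P(t_{NM}(\tau))/Q(t_{NM}(\tau))$ and $t_M(N\tau)=P'(t_{NM}(\tau))/Q'(t_{NM}(\tau))$ with $P,Q,P',Q'\in\mathbb C[x]$, then for all $x$ in a neighborhood of $0$ $$h_{NM}(x)=\left[\frac{Q(x)}{Q(0)}\right]^{-\psi(M)/12}h_M\!\left(\frac{P(x)}{Q(x)}\right)=\left[\frac{Q'(x)}{Q'(0)}\right]^{-\psi(M)/12}h_M\!\left(\frac{P'(x)}{Q'(x)}\right).$$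 -/

import Mathlib

open Filter Topology Polynomial UpperHalfPlane MatrixGroups

noncomputable section

namespace HeckeCurve

/-! ### Modular functions for `Γ₀(N)` and genus zero

Meromorphic functions on the upper half plane are represented by total functions `ℍ → ℂ` whose
values at the points of a discrete closed set (such as the poles) are irrelevant; hence identities
between them are required to hold on a codiscrete subset of `ℍ`. -/

/-- `f` is a modular function (automorphic of weight zero) for `Γ₀(N)`, i.e. a meromorphic function
on the compact curve `X₀(N) = Γ₀(N) \ ℍ*`: it is meromorphic on `ℍ`, invariant under `Γ₀(N)`, and
meromorphic at all cusps. The cusp `γ(i∞)` has a width dividing `N`, so meromorphy there is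
expressed through the parameter `exp (2πiτ/N)`. -/
structure IsModularFunction (N : ℕ) (f : ℍ → ℂ) : Prop where
  meromorphic : MeromorphicOn (f ∘ ofComplex) upperHalfPlaneSet
  invariant : ∀ γ ∈ CongruenceSubgroup.Gamma0 N, ∀ᶠ τ in codiscrete ℍ, f (γ • τ) = f τ
  cusps : ∀ γ : SL(2, ℤ), ∃ F : ℂ → ℂ, MeromorphicAt F 0 ∧ ∃ A : ℝ,
    ∀ᶠ τ in codiscrete ℍ, A < τ.im → f (γ • τ) = F (Function.Periodic.qParam N τ)

/-- `t` is a Hauptmodul for `Γ₀(N)`: a generator over `ℂ` of the function field of `X₀(N)`. -/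
structure IsHauptmodul (N : ℕ) (t : ℍ → ℂ) : Prop where
  isModularFunction : IsModularFunction N t
  generates : ∀ f : ℍ → ℂ, IsModularFunction N f →
    ∃ P Q : ℂ[X], Q ≠ 0 ∧ ∀ᶠ τ in codiscrete ℍ, f τ = P.eval (t τ) / Q.eval (t τ)

/-- `Γ₀(N)` is of genus zero: `X₀(N)` is a rational curve, i.e. its function field is `ℂ(t)` for a
single function `t`. -/
def GenusZero (N : ℕ) : Prop := ∃ t : ℍ → ℂ, IsHauptmodul N t

/-! ### The canonical Hauptmodul -/

/-- The map `τ ↦ n τ` of `ℍ` (for `n ≥ 1`). -/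
def scale (n : ℕ) (τ : ℍ) : ℍ := ofComplex (n * τ)

/-- The Fricke involution `τ ↦ -1 / (N τ)` of `ℍ` (for `N ≥ 1`). -/
def fricke (N : ℕ) (τ : ℍ) : ℍ := ofComplex (-1 / (N * τ))

/-- The conditions that single out the canonical Hauptmodul `t` for `Γ₀(N)`, `N ≥ 2`, with
`q = exp (2πiτ)`. Since its only pole on `X₀(N)` is at the cusp `0`, it is holomorphic on `ℍ`.
The Fricke involution carries the local parameter `q` at the cusp `i∞` to a local parameter at the
cusp `0`, so the last field says both that `t` has a simple pole there, and that the expansion of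
`t (-1 / (N τ))` begins `1 · q⁻¹ + O(1)`. -/
structure IsCanonicalHauptmodul (N : ℕ) (t : ℍ → ℂ) : Prop where
  isHauptmodul : IsHauptmodul N t
  holomorphic : DifferentiableOn ℂ (t ∘ ofComplex) upperHalfPlaneSet
  simple_zero_at_infty : ∃ F : ℂ → ℂ, AnalyticAt ℂ F 0 ∧ F 0 = 0 ∧ deriv F 0 ≠ 0 ∧
    ∀ᶠ τ in atImInfty, t τ = F (Function.Periodic.qParam 1 τ)
  simple_pole_at_zero : ∃ G : ℂ → ℂ, AnalyticAt ℂ G 0 ∧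
    ∀ᶠ τ in atImInfty, t (fricke N τ) =
      (Function.Periodic.qParam 1 τ)⁻¹ + G (Function.Periodic.qParam 1 τ)

/-- The canonical Hauptmodul `t_N` for `Γ₀(N)` (meaningful for `N ≥ 2` with `Γ₀(N)` of genus zero,
when it is the unique function with the property above). -/
def hauptmodul (N : ℕ) : ℍ → ℂ := Classical.epsilon (IsCanonicalHauptmodul N)

/-! ### The `j`-invariant and covering maps -/

/-- The `j`-invariant `j = E₄³ / Δ = q⁻¹ + 744 + ⋯`, where `Δ = η²⁴`. -/
def jInv (τ : ℍ) : ℂ := ModularForm.E₄ τ ^ 3 / ModularForm.discriminant τ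

/-- `f = P(t) / Q(t)` on `ℍ`, in lowest terms. For `f` and `t` holomorphic on `ℍ` and `P`, `Q`
coprime, the denominator `Q(t)` cannot vanish on `ℍ`. -/
structure IsLowestTerms (f t : ℍ → ℂ) (P Q : ℂ[X]) : Prop where
  coprime : IsCoprime P Q
  denom_ne_zero : ∀ τ : ℍ, Q.eval (t τ) ≠ 0
  eq_div : ∀ τ : ℍ, f τ = P.eval (t τ) / Q.eval (t τ)

/-! ### The functions `ĥ₁` and `h_N` -/

/-- `ĥ₁(x) = ₂F₁(1/12, 5/12; 1; x)`, a function of `x = Ĵ = 12³ / j`, for `|x| < 1`. -/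
def hHat (x : ℂ) : ℂ := ₂F₁ (1 / 12 : ℂ) (5 / 12 : ℂ) (1 : ℂ) x

/-- The pullback of `ĥ₁` along `j = P(x) / Q(x)`, with prefactor:
`[P(x) / P(0)]^(-1/12) ĥ₁(12³ Q(x) / P(x))` for `x` near `0`. The power is the principal one, which
near `x = 0` is the holomorphic branch that equals `1` at `x = 0`. -/
def pullbackHHat (P Q : ℂ[X]) (x : ℂ) : ℂ :=
  (P.eval x / P.eval 0) ^ (-(1 / 12) : ℂ) * hHat (12 ^ 3 * Q.eval x / P.eval x)

/-- Numerator and denominator of the covering map `j = P_N(t_N) / Q_N(t_N)`, in lowest terms (they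
are unique up to a common nonzero constant factor). -/
def coveringPair (N : ℕ) : ℂ[X] × ℂ[X] :=
  Classical.epsilon fun R : ℂ[X] × ℂ[X] => IsLowestTerms jInv (hauptmodul N) R.1 R.2

/-- The canonical function `h_N`, near `t_N = 0`. -/
def hFun (N : ℕ) : ℂ → ℂ := pullbackHHat (coveringPair N).1 (coveringPair N).2

/-- `ψ(n) = n ∏_{p ∣ n} (1 + 1/p)`, the product running over the primes dividing `n`. -/
def psi (n : ℕ) : ℚ := n * ∏ p ∈ n.primeFactors, (1 + 1 / (p : ℚ))

end HeckeCurve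

end

/-! Everything reduces to one uniqueness statement: a modular form of weight 12 for `Γ₀(M)` that
equals 1 at `i∞` and vanishes only at the cusp `0` is unique. The quotient of two such forms is an
invariant function with neither zeros nor poles outside the cusp `0`. According to the sign of its
order there, it or its inverse is bounded at every cusp, hence constant, and the normalization makes
the constant 1. Forms are written `v * Δ` with `v` of weight zero (`IsFormWithZeroAtZero`), so that
only invariant functions and their growth have to be handled; orders at all cusps are measured in
`q`, and are therefore fractional at cusps of width greater than 1.

The link with hypergeometric functions is `ĥ₁(12³/j)¹² = E₄³` near `i∞` (`hHat_jHat_pow`): by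
Ramanujan's equations and the hypergeometric equation, `ĥ₁(12³/j) E₄^(-1/4)` is affine in `τ`, and
its limit 1 at `i∞` makes it constant.

If `j(eτ) = P(t)/Q(t)` with `e ∣ M`, the twelfth power of the pullback at `t(τ)` is `P(0) E₄(eτ)³ /
P(t) = P(0) Δ(eτ) / Q(t)`. At a cusp other than `0` the function `t` is finite, and `Q(t)` vanishes
exactly to the order of the pole of `j(eτ)`, which is the order of vanishing of `Δ(eτ)`. So this is
the distinguished form for every `e`; the cases `e = 1` and `e = M` give part (1).

For part (2), let `V` be the form of level `M` and `s(eτ) = P(t)/Q(t)`, where `s` and `t` are the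
Hauptmoduln of levels `M` and `L = NM` and `e` is 1 or `N`. The zeros of `V(eτ)` lie over the cusp
`0` of `X₀(M)`, where `s(eτ)` has its poles. Taking the norm to level one shows that `V` has `ψ(M) =
[SL₂(ℤ) : Γ₀(M)]` zeros, while `s` has one pole, so dividing `V(eτ)` by the power `ψ(M)` of
`Q(t)/Q(0)` cancels them except at the cusp `0` of `X₀(L)`. Again uniqueness identifies the result.

Twelfth roots are then taken near `x = 0`, where both sides are continuous with value 1. All this
presupposes that the canonical Hauptmodul exists; this is obtained from an arbitrary generator by
comparing its poles with those of `j(τ)` and `j(Nτ)`. -/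

noncomputable section
namespace HeckeCurve

/-! ### Growth at the cusp `i∞`, measured in powers of `q`. -/

section

open Asymptotics

/-- `f` grows like `|q|^a` as `τ → i∞`. -/
def HasOrder (f : ℍ → ℂ) (a : ℝ) : Prop :=
  f =Θ[atImInfty] fun τ => Real.exp (-2 * Real.pi * a * τ.im)

lemma tendsto_im_atImInfty : Tendsto UpperHalfPlane.im atImInfty atTop := tendsto_comap

namespace HasOrder

variable {f g : ℍ → ℂ} {a b : ℝ}

lemma mul (hf : HasOrder f a) (hg : HasOrder g b) : HasOrder (fun τ => f τ * g τ) (a + b) := by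
  refine (IsTheta.mul hf hg).trans_eventuallyEq (.of_forall fun τ => ?_)
  simp only [← Real.exp_add]; ring_nf

lemma inv (hf : HasOrder f a) : HasOrder (fun τ => (f τ)⁻¹) (-a) := by
  refine (IsTheta.inv hf).trans_eventuallyEq (.of_forall fun τ => ?_)
  simp only [← Real.exp_neg]; ring_nf

lemma div (hf : HasOrder f a) (hg : HasOrder g b) : HasOrder (fun τ => f τ / g τ) (a - b) := by
  simpa only [div_eq_mul_inv, sub_eq_add_neg] using hf.mul hg.inv

lemma pow (hf : HasOrder f a) (n : ℕ) : HasOrder (fun τ => f τ ^ n) (n * a) := by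
  refine (IsTheta.pow hf n).trans_eventuallyEq (.of_forall fun τ => ?_)
  simp only [← Real.exp_nat_mul]; ring_nf

lemma prod {ι : Type*} {s : Finset ι} {f : ι → ℍ → ℂ} {a : ι → ℝ}
    (h : ∀ i ∈ s, HasOrder (f i) (a i)) : HasOrder (fun τ => ∏ i ∈ s, f i τ) (∑ i ∈ s, a i) := by
  refine (IsTheta.finsetProd h).trans_eventuallyEq (.of_forall fun τ => ?_)
  simp only [← Real.exp_sum, Finset.mul_sum, Finset.sum_mul]

lemma congr (hf : HasOrder f a) (h : f =ᶠ[atImInfty] g) : HasOrder g a :=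
  h.symm.trans_isTheta hf

lemma of_tendsto {c : ℂ} (h : Tendsto f atImInfty (𝓝 c)) (hc : c ≠ 0) : HasOrder f 0 := by
  have h1 : f =Θ[atImInfty] fun _ => c := (isEquivalent_const_iff_tendsto hc).mpr h |>.isTheta
  refine h1.trans ?_
  simp only [mul_zero, zero_mul, Real.exp_zero]
  exact isTheta_const_const hc one_ne_zero

lemma const {c : ℂ} (hc : c ≠ 0) : HasOrder (fun _ => c) 0 := of_tendsto tendsto_const_nhds hc

lemma const_mul (hf : HasOrder f a) {c : ℂ} (hc : c ≠ 0) : HasOrder (fun τ => c * f τ) a := by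
  simpa using (const hc).mul hf

/-- If `a < b`, comparing the two growth rates bounds `exp (2π(b - a) Im τ)`. Uniqueness turns the
growth relation into a valuation, so that orders computed in two ways can be equated. -/
lemma unique (h1 : HasOrder f a) (h2 : HasOrder f b) : a = b := by
  by_contra hab
  wlog hlt : a < b generalizing a b
  · exact this h2 h1 (Ne.symm hab) (lt_of_le_of_ne (not_lt.mp hlt) (Ne.symm hab))
  have h3 := (h1.symm.trans h2).isBigO
  have h4 : (fun τ : ℍ => Real.exp (2 * Real.pi * (b - a) * τ.im)) =O[atImInfty]
      fun _ => (1 : ℝ) := by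
    refine ((h3.mul (isBigO_refl (fun τ : ℍ => Real.exp (2 * Real.pi * b * τ.im)) _)).congr ?_ ?_)
    · intro τ; rw [← Real.exp_add]; ring_nf
    · intro τ; rw [← Real.exp_add]; ring_nf; simp
  have h5 : Tendsto (fun τ : ℍ => Real.exp (2 * Real.pi * (b - a) * τ.im)) atImInfty atTop :=
    Real.tendsto_exp_atTop.comp (tendsto_im_atImInfty.const_mul_atTop
      (by have := Real.pi_pos; have : 0 < b - a := sub_pos.mpr hlt; positivity))
  exact not_isBoundedUnder_of_tendsto_atTop (tendsto_norm_atTop_atTop.comp h5)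
    ((isBigO_one_iff ℝ).mp h4)

lemma isBoundedAtImInfty (hf : HasOrder f a) (ha : 0 ≤ a) : IsBoundedAtImInfty f := by
  refine hf.isBigO.trans (IsBigO.of_bound 1 ?_)
  filter_upwards with τ
  have := τ.im_pos
  have := Real.pi_pos
  simp only [Real.norm_eq_abs, Real.abs_exp, Pi.one_apply, norm_one, mul_one, Real.exp_le_one_iff]
  have : 0 ≤ 2 * Real.pi * a * τ.im := by positivity
  linarith

lemma tendsto_zero (hf : HasOrder f a) (ha : 0 < a) : Tendsto f atImInfty (𝓝 0) := by
  refine hf.isBigO.trans_tendsto ?_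
  refine Real.tendsto_exp_atBot.comp (tendsto_im_atImInfty.const_mul_atTop_of_neg ?_)
  have := Real.pi_pos
  have : 0 < 2 * Real.pi * a := by positivity
  linarith

lemma eventually_ne (hf : HasOrder f a) : ∀ᶠ τ in atImInfty, f τ ≠ 0 := by
  filter_upwards [hf.isBigO_symm.eq_zero_imp] with τ h h0
  exact (Real.exp_pos _).ne' (h h0)

lemma tendsto_inv (hf : HasOrder f a) (ha : a < 0) : Tendsto (fun τ => (f τ)⁻¹) atImInfty (𝓝 0) :=
  hf.inv.tendsto_zero (by linarith)

lemma not_tendsto (hf : HasOrder f a) (ha : a < 0) (c : ℂ) : ¬ Tendsto f atImInfty (𝓝 c) := by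
  intro h
  have h1 := (h.mul (hf.tendsto_inv ha))
  have h2 : Tendsto (fun τ => f τ * (f τ)⁻¹) atImInfty (𝓝 1) :=
    tendsto_const_nhds.congr' (by
      filter_upwards [hf.eventually_ne] with τ h using (mul_inv_cancel₀ h).symm)
  simpa using tendsto_nhds_unique h1 h2

lemma comp (hf : HasOrder f a) {U : ℍ → ℍ} {k : ℝ} (hk : 0 < k) (hU : ∀ τ, (U τ).im = k * τ.im) :
    HasOrder (fun τ => f (U τ)) (k * a) := by
  have hT : Tendsto U atImInfty atImInfty := by
    refine tendsto_comap_iff.mpr ?_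
    simp only [Function.comp_def, hU]
    exact tendsto_im_atImInfty.const_mul_atTop hk
  refine (IsTheta.trans_eventuallyEq (show (f ∘ U) =Θ[atImInfty] _ from
    ⟨hf.isBigO.comp_tendsto hT, hf.isBigO_symm.comp_tendsto hT⟩) (.of_forall fun τ => ?_))
  simp only [Function.comp, hU]
  ring_nf

/-- Values of a meromorphic function of `q^{1/h}`. -/
lemma of_meromorphic {F : ℂ → ℂ} {n : ℤ} (hF : MeromorphicAt F 0)
    (hn : meromorphicOrderAt F 0 = n) {h : ℝ} (hh : 0 < h) :
    HasOrder (fun τ => F (Function.Periodic.qParam h τ)) (n / h) := by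
  obtain ⟨g, hg, hg0, hFg⟩ := (meromorphicOrderAt_eq_int_iff hF).mp hn
  have hq : Tendsto (fun τ : ℍ => Function.Periodic.qParam h τ) atImInfty (𝓝[≠] 0) :=
    (Function.Periodic.qParam_tendsto hh).comp tendsto_coe_atImInfty
  have h1 : HasOrder (fun τ : ℍ => g (Function.Periodic.qParam h τ)) 0 :=
    of_tendsto (hg.continuousAt.tendsto.comp (hq.mono_right nhdsWithin_le_nhds)) hg0
  have h2 : HasOrder (fun τ : ℍ => (Function.Periodic.qParam h τ) ^ n) (n / h) := by
    refine IsTheta.of_norm_eventuallyEq (.of_forall fun τ => ?_)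
    simp only [norm_zpow, Function.Periodic.norm_qParam, coe_im]
    rw [← Real.rpow_intCast, ← Real.exp_mul]
    congr 1; field_simp
  have h3 := h2.mul h1
  rw [add_zero] at h3
  refine h3.congr ?_
  filter_upwards [hq.eventually hFg] with τ hτ
  simp [hτ]

/-- Polynomials in a function with a pole at the cusp. -/
lemma eval_of_neg (hf : HasOrder f a) (ha : a < 0) {P : ℂ[X]} (hP : P ≠ 0) :
    HasOrder (fun τ => P.eval (f τ)) (P.natDegree * a) := by
  have h1 : Tendsto (fun τ => P.reverse.eval (f τ)⁻¹) atImInfty (𝓝 P.leadingCoeff) := by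
    have := P.reverse.continuous.continuousAt.tendsto.comp (hf.tendsto_inv ha)
    rwa [← coeff_zero_eq_eval_zero, coeff_zero_reverse] at this
  have h2 := (of_tendsto h1 (leadingCoeff_ne_zero.mpr hP)).mul (hf.pow P.natDegree)
  rw [zero_add] at h2
  refine h2.congr ?_
  filter_upwards [hf.eventually_ne] with τ hτ
  let := invertibleOfNonzero hτ
  have := eval₂_reverse_mul_pow (RingHom.id ℂ) (f τ) P
  rwa [invOf_eq_inv] at this

/-- Polynomials in a function with a finite limit that is not a root. -/
lemma eval_of_tendsto {c : ℂ} (hf : Tendsto f atImInfty (𝓝 c)) {P : ℂ[X]} (hP : P.eval c ≠ 0) :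
    HasOrder (fun τ => P.eval (f τ)) 0 :=
  of_tendsto (P.continuous.continuousAt.tendsto.comp hf) hP

/-- Polynomials in a function with a zero at the cusp. -/
lemma eval_of_pos (hf : HasOrder f a) (ha : 0 < a) {P : ℂ[X]} (hP : P ≠ 0) :
    HasOrder (fun τ => P.eval (f τ)) (P.rootMultiplicity 0 * a) := by
  obtain ⟨Q, hPQ, hQ⟩ := exists_eq_pow_rootMultiplicity_mul_and_not_dvd P hP 0
  have h1 : Q.eval 0 ≠ 0 := fun h => hQ (dvd_iff_isRoot.mpr h)
  have h2 := (hf.pow (P.rootMultiplicity 0)).mul (eval_of_tendsto (hf.tendsto_zero ha) h1)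
  rw [add_zero] at h2
  refine h2.congr (.of_forall fun τ => ?_)
  have := congrArg (eval (f τ)) hPQ
  simp only [this]
  simp only [map_zero, sub_zero, eval_mul, eval_pow, eval_X]

/-- The order of a rational function of a function with a pole. -/
lemma eq_of_eval_div_of_neg (hf : HasOrder f a) (ha : a < 0) {P Q : ℂ[X]} (hP : P ≠ 0) (hQ : Q ≠ 0)
    (hg : HasOrder g b) (h : ∀ᶠ τ in atImInfty, g τ = P.eval (f τ) / Q.eval (f τ)) :
    b = ((P.natDegree : ℝ) - Q.natDegree) * a := by
  rw [sub_mul]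
  refine hg.unique (((hf.eval_of_neg ha hP).div (hf.eval_of_neg ha hQ)).congr ?_)
  filter_upwards [h] with τ hτ using hτ.symm

end HasOrder

end

section

open Asymptotics ModularForm Manifold

/-! ### Affine maps of the upper half plane -/

/-- The map `τ ↦ (a τ + b) / d` of `ℍ`, for `a, d > 0`. -/
def affine (a : ℕ) (b : ℤ) (d : ℕ) (τ : ℍ) : ℍ := ofComplex ((a * τ + b) / d)

lemma coe_affine {a d : ℕ} (ha : 0 < a) (hd : 0 < d) (b : ℤ) (τ : ℍ) :
    (affine a b d τ : ℂ) = (a * τ + b) / d := by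
  have h : 0 < ((a * τ + b) / d : ℂ).im := by
    have : ((a * τ + b) / d : ℂ) = ((a / d : ℝ) : ℂ) * τ + ((b / d : ℝ) : ℂ) := by
      push_cast; ring
    rw [this, Complex.add_im, Complex.ofReal_im, Complex.im_ofReal_mul, add_zero]
    have := τ.im_pos
    exact mul_pos (by positivity) this
  rw [affine, ofComplex_apply_of_im_pos h]

lemma affine_im {a d : ℕ} (ha : 0 < a) (hd : 0 < d) (b : ℤ) (τ : ℍ) :
    (affine a b d τ).im = (a / d : ℝ) * τ.im := by
  rw [← coe_im, coe_affine ha hd]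
  have : ((a * τ + b) / d : ℂ) = ((a / d : ℝ) : ℂ) * τ + ((b / d : ℝ) : ℂ) := by
    push_cast; ring
  rw [this, Complex.add_im, Complex.ofReal_im, Complex.im_ofReal_mul, add_zero, coe_im]

lemma scale_eq_affine (e : ℕ) (τ : ℍ) : scale e τ = affine e 0 1 τ := by
  simp [scale, affine]

lemma coe_scale {e : ℕ} (he : 0 < e) (τ : ℍ) : (scale e τ : ℂ) = e * τ := by
  simp [scale_eq_affine, coe_affine he one_pos]

lemma scale_im {e : ℕ} (he : 0 < e) (τ : ℍ) : (scale e τ).im = e * τ.im := by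
  simp [scale_eq_affine, affine_im he one_pos]

lemma tendsto_affine {a d : ℕ} (ha : 0 < a) (hd : 0 < d) (b : ℤ) :
    Tendsto (affine a b d) atImInfty atImInfty := by
  refine tendsto_comap_iff.mpr ?_
  simp only [Function.comp_def, affine_im ha hd]
  exact tendsto_im_atImInfty.const_mul_atTop (by positivity)

lemma tendsto_scale {e : ℕ} (he : 0 < e) : Tendsto (scale e) atImInfty atImInfty :=
  (tendsto_affine he one_pos 0).congr fun τ => (scale_eq_affine e τ).symm

@[simp] lemma scale_one (τ : ℍ) : scale 1 τ = τ := by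
  ext; simp [coe_scale one_pos]

lemma mdifferentiable_comp_affine {f : ℍ → ℂ} (hf : MDiff f) {a d : ℕ} (ha : 0 < a) (hd : 0 < d)
    (b : ℤ) : MDiff (fun τ => f (affine a b d τ)) := by
  rw [UpperHalfPlane.mdifferentiable_iff] at hf ⊢
  have h1 : DifferentiableOn ℂ (fun z : ℂ => (a * z + b) / d) {z | 0 < z.im} := by fun_prop
  have h2 : Set.MapsTo (fun z : ℂ => (a * z + b) / d) {z | 0 < z.im} {z | 0 < z.im} := by
    intro z hz
    have := (affine a b d ⟨z, hz⟩).im_pos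
    rwa [← coe_im, coe_affine ha hd] at this
  refine (hf.comp h1 h2).congr fun z hz => ?_
  simp only [Function.comp, affine, ofComplex_apply_of_im_pos hz]

lemma mdifferentiable_comp_scale {f : ℍ → ℂ} (hf : MDiff f) {e : ℕ} (he : 0 < e) :
    MDiff (fun τ => f (scale e τ)) := by
  simpa only [scale_eq_affine] using mdifferentiable_comp_affine hf he one_pos 0

/-! ### The automorphy factor -/

/-- The automorphy factor `c τ + d`. -/
def autFactor (γ : SL(2, ℤ)) (τ : ℍ) : ℂ := γ 1 0 * τ + γ 1 1

lemma autFactor_eq_denom (γ : SL(2, ℤ)) (τ : ℍ) : autFactor γ τ = denom γ τ :=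
  (ModularGroup.denom_apply γ τ).symm

lemma autFactor_ne_zero (γ : SL(2, ℤ)) (τ : ℍ) : autFactor γ τ ≠ 0 := by
  rw [autFactor_eq_denom]; exact denom_ne_zero _ _

lemma coe_smul_eq (γ : SL(2, ℤ)) (τ : ℍ) :
    ((γ • τ : ℍ) : ℂ) = (γ 0 0 * τ + γ 0 1) / autFactor γ τ := by
  rw [UpperHalfPlane.coe_specialLinearGroup_apply]
  simp [autFactor]

lemma autFactor_S (τ : ℍ) : autFactor ModularGroup.S τ = τ := by
  simp [autFactor, ModularGroup.S]

lemma autFactor_T_zpow (n : ℤ) (τ : ℍ) : autFactor (ModularGroup.T ^ n) τ = 1 := by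
  simp [autFactor, ModularGroup.coe_T_zpow]

lemma det_eq (γ : SL(2, ℤ)) : γ 0 0 * γ 1 1 - γ 0 1 * γ 1 0 = 1 := by
  have := γ.det_coe
  rwa [Matrix.det_fin_two] at this

lemma coe_S_smul (τ : ℍ) : ((ModularGroup.S • τ : ℍ) : ℂ) = -1 / τ := by
  rw [coe_smul_eq, autFactor_S]; simp [ModularGroup.S]

lemma T_zpow_smul_eq_affine (n : ℤ) (τ : ℍ) : ModularGroup.T ^ n • τ = affine 1 n 1 τ := by
  ext
  rw [coe_smul_eq, autFactor_T_zpow, coe_affine one_pos one_pos]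
  simp [ModularGroup.coe_T_zpow]

/-- Moving `τ ↦ e τ` past an element of the modular group. -/
lemma exists_scale_smul {e : ℕ} (he : 0 < e) (γ : SL(2, ℤ)) :
    ∃ (γ' : SL(2, ℤ)) (b : ℤ) (d : ℕ), 0 < d ∧ Int.gcd (γ 1 0) e * d = e ∧
      (∀ τ, scale e (γ • τ) = γ' • affine (Int.gcd (γ 1 0) e) b d τ) ∧
      ∀ τ, autFactor γ τ = d * autFactor γ' (affine (Int.gcd (γ 1 0) e) b d τ) := by
  set a : ℕ := Int.gcd (γ 1 0) e with ha_def
  have ha : 0 < a := Int.gcd_pos_of_ne_zero_right _ (by exact_mod_cast he.ne')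
  obtain ⟨d, hd⟩ : a ∣ e := by exact_mod_cast Int.gcd_dvd_right (γ 1 0) (e : ℤ)
  have hdpos : 0 < d := Nat.pos_of_ne_zero (by rintro rfl; omega)
  obtain ⟨r, hr⟩ : (a : ℤ) ∣ γ 1 0 := Int.gcd_dvd_left _ _
  have hdet := det_eq γ
  have hcop1 : IsCoprime (d : ℤ) r := by
    rw [Int.isCoprime_iff_gcd_eq_one]
    have h := ha_def
    rw [hr, show (e : ℤ) = a * d by exact_mod_cast hd, Int.gcd_mul_left, Int.natAbs_natCast] at h
    rw [Int.gcd_comm]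
    exact Nat.eq_of_mul_eq_mul_left ha (by omega)
  have hcop2 : IsCoprime (γ 0 0) r := ⟨γ 1 1, -γ 0 1 * a, by rw [hr] at hdet; linarith⟩
  obtain ⟨γ', h00, h10⟩ := (hcop1.mul_left hcop2).exists_SL2_col 0
  have hdet' := det_eq γ'
  set b : ℤ := γ' 1 1 * (e * γ 0 1) - γ' 0 1 * γ 1 1 with hb
  have heq : (e : ℤ) = a * d := by exact_mod_cast hd
  have e1 : γ' 0 0 * a = e * γ 0 0 := by rw [h00, heq]; ring
  have e2 : γ' 1 0 * a = γ 1 0 := by rw [h10, hr]; ring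
  have hdd : (d : ℤ) = -(γ' 1 0) * (e * γ 0 1) + γ' 0 0 * γ 1 1 := by
    rw [h10, h00, heq]
    linear_combination (-(d : ℤ)) * hdet + (-(d : ℤ)) * γ 0 1 * hr
  have e3 : γ' 0 0 * b + γ' 0 1 * d = e * γ 0 1 := by
    rw [hb, hdd]; linear_combination (e * γ 0 1) * hdet'
  have e4 : γ' 1 0 * b + γ' 1 1 * d = γ 1 1 := by
    rw [hb, hdd]; linear_combination (γ 1 1) * hdet'
  have c1 : (γ' 0 0 : ℂ) * a = e * γ 0 0 := by exact_mod_cast e1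
  have c2 : (γ' 1 0 : ℂ) * a = γ 1 0 := by exact_mod_cast e2
  have c3 : (γ' 0 0 : ℂ) * b + γ' 0 1 * d = e * γ 0 1 := by exact_mod_cast e3
  have c4 : (γ' 1 0 : ℂ) * b + γ' 1 1 * d = γ 1 1 := by exact_mod_cast e4
  have hd0 : (d : ℂ) ≠ 0 := by exact_mod_cast hdpos.ne'
  have key : ∀ τ, autFactor γ τ = d * autFactor γ' (affine a b d τ) := by
    intro τ
    rw [autFactor, autFactor, coe_affine ha hdpos]
    field_simp
    linear_combination -(τ : ℂ) * c2 - c4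
  refine ⟨γ', b, d, hdpos, hd.symm, fun τ => ?_, key⟩
  ext
  have h1 := autFactor_ne_zero γ' (affine a b d τ)
  have h2 := autFactor_ne_zero γ τ
  rw [coe_scale he, coe_smul_eq, coe_smul_eq, coe_affine ha hdpos, mul_div_assoc',
    div_eq_div_iff h2 h1, key τ]
  field_simp
  linear_combination -(τ : ℂ) * c1 - c3

/-- `τ ↦ e τ` intertwines `Γ₀(L)` and `Γ₀(M)` if `e M ∣ L`. -/
lemma exists_scale_smul_of_mem_Gamma0 {e M L : ℕ} (he : 0 < e) (hL : e * M ∣ L) {γ : SL(2, ℤ)}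
    (hγ : γ ∈ CongruenceSubgroup.Gamma0 L) :
    ∃ γ' ∈ CongruenceSubgroup.Gamma0 M, (∀ τ, scale e (γ • τ) = γ' • scale e τ) ∧
      ∀ τ, autFactor γ τ = autFactor γ' (scale e τ) := by
  rw [CongruenceSubgroup.Gamma0_mem, ZMod.intCast_zmod_eq_zero_iff_dvd] at hγ
  obtain ⟨k, hk⟩ := (Int.natCast_dvd_natCast.mpr hL).trans hγ
  push_cast at hk
  have hdet := det_eq γ
  -- The conjugate of `γ` by `diag(e, 1)`; its lower left entry is `γ₁₀ / e`.
  let γ' : SL(2, ℤ) := ⟨!![γ 0 0, e * γ 0 1; M * k, γ 1 1], by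
    rw [Matrix.det_fin_two_of]; rw [hk] at hdet; linarith⟩
  have h00 : γ' 0 0 = γ 0 0 := rfl
  have h01 : γ' 0 1 = e * γ 0 1 := rfl
  have h10 : γ' 1 0 = M * k := rfl
  have h11 : γ' 1 1 = γ 1 1 := rfl
  have key : ∀ τ, autFactor γ τ = autFactor γ' (scale e τ) := by
    intro τ
    rw [autFactor, autFactor, coe_scale he, h10, h11, hk]
    push_cast; ring
  refine ⟨γ', ?_, fun τ => ?_, key⟩
  · rw [CongruenceSubgroup.Gamma0_mem, h10]; simp
  · ext
    rw [coe_scale he, coe_smul_eq, coe_smul_eq, ← key, coe_scale he, h00, h01]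
    push_cast; ring

/-- The elements `γ` of the modular group such that `γ(i∞)` is equivalent to the cusp `0`. -/
lemma exists_eq_mul_S_mul_T {M : ℕ} {γ : SL(2, ℤ)} (h : IsCoprime (γ 1 0) (M : ℤ)) :
    ∃ g ∈ CongruenceSubgroup.Gamma0 M, ∃ n : ℤ,
      γ = g * ModularGroup.S * ModularGroup.T ^ n := by
  obtain ⟨u, v, huv⟩ := h
  -- As `u` inverts `γ₁₀` modulo `M`, this power of `T` makes the lower right entry divisible by
  -- `M`; `S⁻¹` then moves that entry, up to sign, to the lower left.
  refine ⟨γ * (ModularGroup.T ^ (u * γ 1 1))⁻¹ * ModularGroup.S⁻¹, ?_, u * γ 1 1, by group⟩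
  rw [CongruenceSubgroup.Gamma0_mem, ZMod.intCast_zmod_eq_zero_iff_dvd]
  have : (γ * (ModularGroup.T ^ (u * γ 1 1))⁻¹ * ModularGroup.S⁻¹) 1 0 =
      -(γ 1 1 - u * γ 1 1 * γ 1 0) := by
    have hS : (ModularGroup.S⁻¹ : SL(2, ℤ)).1 = !![0, 1; -1, 0] := by
      rw [Matrix.SpecialLinearGroup.SL2_inv_expl]; simp [ModularGroup.S]; rfl
    rw [← zpow_neg, Matrix.SpecialLinearGroup.coe_mul, Matrix.SpecialLinearGroup.coe_mul, hS,
      ModularGroup.coe_T_zpow]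
    simp [Matrix.mul_apply, Fin.sum_univ_two]
    ring
  rw [this]
  exact ⟨-(γ 1 1 * v), by linear_combination (γ 1 1) * huv⟩

/-! ### Modular functions without zeros and poles -/

lemma HasOrder.comp_affine {f : ℍ → ℂ} {x : ℝ} (hf : HasOrder f x) {a d : ℕ} (ha : 0 < a)
    (hd : 0 < d) (b : ℤ) : HasOrder (fun τ => f (affine a b d τ)) (a / d * x) :=
  hf.comp (by positivity) (affine_im ha hd b)

lemma HasOrder.comp_scale {f : ℍ → ℂ} {x : ℝ} (hf : HasOrder f x) {e : ℕ} (he : 0 < e) :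
    HasOrder (fun τ => f (scale e τ)) (e * x) :=
  hf.comp (by positivity) (scale_im he)

lemma HasOrder.comp_T_zpow {f : ℍ → ℂ} {x : ℝ} (hf : HasOrder f x) (n : ℤ) :
    HasOrder (fun τ => f (ModularGroup.T ^ n • τ)) x := by
  have := hf.comp_affine one_pos one_pos n
  simpa only [← T_zpow_smul_eq_affine, Nat.cast_one, div_one, one_mul] using this

/-- Boundedness of all translates makes `f` a modular form of weight zero for an arithmetic group.
-/
lemma eq_const_of_isBoundedAtImInfty {M : ℕ} [NeZero M] {f : ℍ → ℂ} (hf : MDiff f)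
    (hinv : ∀ γ ∈ CongruenceSubgroup.Gamma0 M, ∀ τ, f (γ • τ) = f τ)
    (hbdd : ∀ γ : SL(2, ℤ), IsBoundedAtImInfty fun τ => f (γ • τ)) : ∃ c, ∀ τ, f τ = c := by
  have hslash : ∀ γ : SL(2, ℤ), f ∣[(0 : ℤ)] γ = fun τ => f (γ • τ) := by
    intro γ; ext τ; simp [SL_slash_apply]
  let F : ModularForm ((CongruenceSubgroup.Gamma0 M : Subgroup SL(2, ℤ)) : Subgroup (GL (Fin 2) ℝ))
      0 :=
    { toFun := f
      slash_action_eq' := by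
        rintro _ ⟨γ, hγ, rfl⟩
        change f ∣[(0 : ℤ)] γ = f
        rw [hslash]
        exact funext (hinv γ hγ)
      holo' := hf
      bdd_at_cusps' := by
        intro c hc
        rw [Subgroup.IsArithmetic.isCusp_iff_isCusp_SL2Z] at hc
        rw [OnePoint.isBoundedAt_iff_forall_SL2Z hc]
        intro γ _
        rw [hslash]
        exact hbdd γ }
  obtain ⟨c, hc⟩ := ModularForm.eq_const_of_weight_zero F
  exact ⟨c, fun τ => congrFun hc τ⟩

/-- A modular function for `Γ₀(M)` that has no zeros and poles except possibly at the cusp `0` is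
constant. -/
lemma eq_const_of_hasOrder {M : ℕ} [NeZero M] {f : ℍ → ℂ} (hf : MDiff f) (hf0 : ∀ τ, f τ ≠ 0)
    (hinv : ∀ γ ∈ CongruenceSubgroup.Gamma0 M, ∀ τ, f (γ • τ) = f τ)
    (hord : ∀ γ : SL(2, ℤ), ¬ IsCoprime (γ 1 0) (M : ℤ) → HasOrder (fun τ => f (γ • τ)) 0)
    {r : ℝ} (hr : HasOrder (fun τ => f (ModularGroup.S • τ)) r) : ∃ c, ∀ τ, f τ = c := by
  have hcop : ∀ γ : SL(2, ℤ), IsCoprime (γ 1 0) (M : ℤ) → HasOrder (fun τ => f (γ • τ)) r := by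
    intro γ hγ
    obtain ⟨g, hg, n, rfl⟩ := exists_eq_mul_S_mul_T hγ
    simp only [mul_smul, hinv g hg]
    exact hr.comp_T_zpow n
  rcases le_total 0 r with h | h
  · refine eq_const_of_isBoundedAtImInfty hf hinv fun γ => ?_
    by_cases hγ : IsCoprime (γ 1 0) (M : ℤ)
    · exact (hcop γ hγ).isBoundedAtImInfty h
    · exact (hord γ hγ).isBoundedAtImInfty le_rfl
  · obtain ⟨c, hc⟩ := eq_const_of_isBoundedAtImInfty (M := M) (f := fun τ => (f τ)⁻¹)
      (hf.inv hf0) (fun γ hγ τ => by rw [hinv γ hγ]) fun γ => by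
        by_cases hγ : IsCoprime (γ 1 0) (M : ℤ)
        · exact (hcop γ hγ).inv.isBoundedAtImInfty (by linarith)
        · exact (hord γ hγ).inv.isBoundedAtImInfty (by simp)
    exact ⟨c⁻¹, fun τ => by rw [← hc τ, inv_inv]⟩

/-! ### Level one functions -/

lemma smul_levelOne {k : ℤ} (f : ModularForm 𝒮ℒ k) (γ : SL(2, ℤ)) (τ : ℍ) :
    f (γ • τ) = autFactor γ τ ^ k * f τ := by
  have : (f : ℍ → ℂ) ∣[k] γ = f := SlashInvariantForm.slash_action_eqn f _ ⟨γ, rfl⟩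
  have h := congrFun this τ
  rw [SL_slash_apply, ← autFactor_eq_denom] at h
  rw [← h, mul_left_comm, ← zpow_add₀ (autFactor_ne_zero γ τ)]
  simp

lemma E₄_smul (γ : SL(2, ℤ)) (τ : ℍ) : E₄ (γ • τ) = autFactor γ τ ^ 4 * E₄ τ :=
  smul_levelOne E₄ γ τ

lemma discriminant_smul (γ : SL(2, ℤ)) (τ : ℍ) :
    discriminant (γ • τ) = autFactor γ τ ^ 12 * discriminant τ := by
  have h := congrFun (SlashInvariantForm.slash_action_generators_SL2Z discriminant_S_invariant
    discriminant_T_invariant γ) τ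
  rw [SL_slash_apply, ← autFactor_eq_denom] at h
  rw [← h, mul_left_comm, zpow_neg, zpow_ofNat, mul_inv_cancel₀
    (pow_ne_zero _ (autFactor_ne_zero γ τ)), mul_one]

lemma jInv_smul (γ : SL(2, ℤ)) (τ : ℍ) : jInv (γ • τ) = jInv τ := by
  rw [jInv, jInv, E₄_smul, discriminant_smul]
  have := autFactor_ne_zero γ τ
  have := discriminant_ne_zero τ
  field_simp

lemma mdifferentiable_E₄ : MDiff (fun τ => E₄ τ) := ModularFormClass.holo E₄

lemma mdifferentiable_discriminant : MDiff discriminant := CuspForm.discriminant.holo'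

lemma mdifferentiable_jInv : MDiff jInv :=
  (mdifferentiable_E₄.pow 3).div mdifferentiable_discriminant discriminant_ne_zero

lemma tendsto_levelOne {k : ℤ} (f : ModularForm 𝒮ℒ k) :
    Tendsto f atImInfty (𝓝 ((qExpansion 1 f).coeff 0)) := by
  have han := ModularFormClass.analyticAt_cuspFunction_zero f one_pos one_mem_strictPeriods_SL
  rw [qExpansion_coeff]
  have := han.continuousAt.tendsto.comp (qParam_tendsto_atImInfty one_pos)
  simp only [Nat.factorial_zero, Nat.cast_one, inv_one, one_mul, iteratedDeriv_zero]
  refine this.congr fun τ => ?_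
  exact SlashInvariantFormClass.eq_cuspFunction f τ one_mem_strictPeriods_SL one_ne_zero

lemma tendsto_E₄ : Tendsto E₄ atImInfty (𝓝 1) := by
  have := tendsto_levelOne E₄
  rwa [EisensteinSeries.E_qExpansion_coeff_zero _ ⟨2, rfl⟩] at this

lemma hasOrder_E₄ : HasOrder E₄ 0 := .of_tendsto tendsto_E₄ one_ne_zero

lemma hasOrder_qParam : HasOrder (fun τ => Function.Periodic.qParam 1 τ) 1 := by
  have := HasOrder.of_meromorphic (F := id) (n := 1) (h := 1) analyticAt_id.meromorphicAt
    (by simp) one_pos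
  simpa using this

lemma tendsto_discriminant_div :
    Tendsto (fun τ => discriminant τ / Function.Periodic.qParam 1 τ) atImInfty (𝓝 1) := by
  refine tendsto_atImInfty_tprod_one_sub_eta_q_pow.congr fun τ => ?_
  rw [discriminant_eq_q_prod, mul_div_cancel_left₀ _ (Function.Periodic.qParam_ne_zero _)]

lemma hasOrder_discriminant : HasOrder discriminant 1 := by
  have h1 : HasOrder _ 0 := .of_tendsto tendsto_discriminant_div one_ne_zero
  have := h1.mul hasOrder_qParam
  rw [zero_add] at this
  exact this.congr (.of_forall fun τ => div_mul_cancel₀ _ (Function.Periodic.qParam_ne_zero _))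

lemma hasOrder_jInv : HasOrder jInv (-1) := by
  have := (hasOrder_E₄.pow 3).div hasOrder_discriminant
  rw [mul_zero, zero_sub] at this
  exact this

/-- `j (e γ τ)` at the cusps. -/
lemma hasOrder_jInv_scale_smul {e : ℕ} (he : 0 < e) (γ : SL(2, ℤ)) :
    HasOrder (fun τ => jInv (scale e (γ • τ))) (-(Int.gcd (γ 1 0) e : ℝ) ^ 2 / e) := by
  obtain ⟨γ', b, d, hd, hde, h, -⟩ := exists_scale_smul he γ
  have ha : 0 < Int.gcd (γ 1 0) e := Int.gcd_pos_of_ne_zero_right _ (by exact_mod_cast he.ne')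
  simp only [h, jInv_smul]
  -- The pole of `j((aτ + b)/d)` has order `a/d`, which is `a²/e` because `e = ad`.
  have h1 := hasOrder_jInv.comp_affine ha hd b
  convert h1 using 1
  have : (e : ℝ) = Int.gcd (γ 1 0) e * d := by exact_mod_cast hde.symm
  have ha' : ((Int.gcd (γ 1 0) e : ℕ) : ℝ) ≠ 0 := by exact_mod_cast ha.ne'
  have hd' : (d : ℝ) ≠ 0 := by exact_mod_cast hd.ne'
  generalize ((Int.gcd (γ 1 0) e : ℕ) : ℝ) = a at *
  rw [this]
  field_simp

end

section

open Asymptotics ModularForm Manifold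

/-! ### The hypergeometric differential equation -/

lemma hHat_hasFPowerSeriesOnBall :
    HasFPowerSeriesOnBall hHat
      (ordinaryHypergeometricSeries ℂ (1 / 12 : ℂ) (5 / 12 : ℂ) (1 : ℂ)) 0 1 := by
  have hr : (ordinaryHypergeometricSeries ℂ (1 / 12 : ℂ) (5 / 12 : ℂ) (1 : ℂ)).radius = 1 := by
    apply ordinaryHypergeometricSeries_radius_eq_one
    have key : ∀ (n : ℕ) (y : ℝ), 0 < y → (n : ℂ) ≠ -(y : ℂ) := fun n y hy h => by
      have h' : (n : ℝ) = -y := by exact_mod_cast h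
      have : (0 : ℝ) ≤ n := by positivity
      linarith
    intro n
    refine ⟨?_, ?_, ?_⟩
    · have := key n (1 / 12) (by norm_num); push_cast at this; exact this
    · have := key n (5 / 12) (by norm_num); push_cast at this; exact this
    · have := key n 1 (by norm_num); push_cast at this; exact this
  have := (ordinaryHypergeometricSeries ℂ (1 / 12 : ℂ) (5 / 12 : ℂ) (1 : ℂ)).hasFPowerSeriesOnBall
    (by rw [hr]; exact one_pos)
  rwa [hr] at this

lemma hHat_zero : hHat 0 = 1 := ordinaryHypergeometric_zero _ _ _

lemma hHat_differentiableOn : DifferentiableOn ℂ hHat (Metric.ball 0 1) := by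
  have := hHat_hasFPowerSeriesOnBall.differentiableOn
  rwa [← ENNReal.ofReal_one, Metric.eball_ofReal] at this

/-- The coefficients of `hHat`. -/
def hHatCoeff (n : ℕ) : ℂ := ordinaryHypergeometricCoefficient (1 / 12 : ℂ) (5 / 12 : ℂ) (1 : ℂ) n

lemma hHat_hasSum {x : ℂ} (hx : ‖x‖ < 1) : HasSum (fun n => hHatCoeff n * x ^ n) (hHat x) := by
  have h := hHat_hasFPowerSeriesOnBall.hasSum (y := x)
    (by rw [← ENNReal.ofReal_one, Metric.eball_ofReal]; simpa using hx)
  rw [zero_add] at h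
  refine h.congr_fun ?_
  intro n
  rw [ordinaryHypergeometricSeries_apply_eq]
  rfl

lemma hHatCoeff_succ (n : ℕ) :
    ((n : ℂ) + 1) ^ 2 * hHatCoeff (n + 1) = (1 / 12 + n) * (5 / 12 + n) * hHatCoeff n := by
  have h1 : (Nat.factorial n : ℂ) ≠ 0 := by exact_mod_cast Nat.factorial_ne_zero n
  have h2 : (n : ℂ) + 1 ≠ 0 := by exact_mod_cast Nat.succ_ne_zero n
  have h3 : (1 : ℂ) + n ≠ 0 := by rwa [add_comm]
  simp only [hHatCoeff, ordinaryHypergeometricCoefficient, ascPochhammer_succ_eval,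
    Nat.factorial_succ, ascPochhammer_eval_one]
  push_cast
  field_simp
  ring

/-- Termwise application of `x d/dx`. -/
lemma hasSum_mul_deriv {f : ℂ → ℂ} {c : ℕ → ℂ}
    (hc : ∀ x : ℂ, ‖x‖ < 1 → HasSum (fun n => c n * x ^ n) (f x)) {x : ℂ} (hx : ‖x‖ < 1) :
    HasSum (fun n => (n * c n) * x ^ n) (x * deriv f x) := by
  have hu : ∀ y ∈ Metric.ball (0 : ℂ) 1, f y = ∑' n, c n * y ^ n := fun y hy =>
    ((hc y (by simpa using hy)).tsum_eq).symm
  obtain ⟨r, hr1, hr2⟩ := exists_between hx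
  have hr0 : 0 < r := (norm_nonneg x).trans_lt hr1
  have hsum : Summable fun n => ‖c n‖ * r ^ n := by
    have := (hc (r : ℂ) (by simpa [abs_of_pos hr0] using hr2)).summable.norm
    simpa [abs_of_pos hr0] using this
  have hs := Complex.hasSum_deriv_of_summable_norm (F := fun n (y : ℂ) => c n * y ^ n)
    (U := Metric.ball 0 r) hsum (by fun_prop) Metric.isOpen_ball ?_
    (z := x) (by simpa using hr1)
  · have hd : deriv f x = deriv (fun y => ∑' n, c n * y ^ n) x := by
      apply Filter.EventuallyEq.deriv_eq
      filter_upwards [Metric.isOpen_ball.mem_nhds (show x ∈ Metric.ball (0 : ℂ) 1 by simpa using hx)]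
        with y hy using hu y hy
    rw [hd]
    refine (hs.mul_left x).congr_fun ?_
    intro n
    simp only [deriv_const_mul_field', deriv_pow_field]
    rcases n with _ | n
    · simp
    · simp; ring
  · intro n y hy
    rw [norm_mul, norm_pow]
    gcongr
    exact (by simpa using hy : ‖y‖ < r).le

/-- `x d/dx` applied to `hHat`. -/
def hHatTheta (x : ℂ) : ℂ := x * deriv hHat x

lemma hHatTheta_differentiableOn : DifferentiableOn ℂ hHatTheta (Metric.ball 0 1) :=
  differentiableOn_id.mul (hHat_differentiableOn.deriv Metric.isOpen_ball)

/-- With `θ = x d/dx`, the coefficient recurrence is `θ² = x (θ + 1/12)(θ + 5/12)` applied to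
`hHat`; here `1/2` and `5/144` are the sum and the product of the parameters. -/
lemma hHatTheta_ode {x : ℂ} (hx : ‖x‖ < 1) :
    (1 - x) * (x * deriv hHatTheta x) = x * (1 / 2 * hHatTheta x + 5 / 144 * hHat x) := by
  have h0 := hHat_hasSum hx
  have h1 : ∀ x : ℂ, ‖x‖ < 1 → HasSum (fun n => (n * hHatCoeff n) * x ^ n) (hHatTheta x) :=
    fun x hx => hasSum_mul_deriv (fun _ => hHat_hasSum) hx
  have h2 := hasSum_mul_deriv h1 hx
  -- The term `n = 0` of the series of `θ² hHat` vanishes; dropping it aligns the powers of `x` with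
  -- those of the right side.
  have h3 := (hasSum_nat_add_iff' 1).mpr h2
  have h4 := (((h2.add ((h1 x hx).mul_left (1 / 2))).add (h0.mul_left (5 / 144))).mul_left x)
  have h5 : HasSum (fun n => (((n + 1 : ℕ) : ℂ) * (((n + 1 : ℕ) : ℂ) * hHatCoeff (n + 1))) *
      x ^ (n + 1)) (x * (x * deriv hHatTheta x + 1 / 2 * hHatTheta x + 5 / 144 * hHat x)) := by
    refine h4.congr_fun ?_
    intro n
    have := hHatCoeff_succ n
    push_cast
    rw [pow_succ]
    linear_combination (x ^ n * x) * this
  have h6 := h3.unique h5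
  simp only [Finset.range_one, Finset.sum_singleton, Nat.cast_zero, zero_mul, sub_zero] at h6
  linear_combination h6

end

section

open Asymptotics ModularForm Manifold Derivative EisensteinSeries

/-! ### Ramanujan's differential equations -/

/-- The function `c / (c τ + d)`. -/
def autRatio (γ : SL(2, ℤ)) (τ : ℍ) : ℂ := γ 1 0 / autFactor γ τ

lemma hasDerivAt_comp_ofComplex {F : ℍ → ℂ} (hF : MDiff F) (τ : ℍ) :
    HasDerivAt (F ∘ ofComplex) (2 * Real.pi * Complex.I * normalizedDerivOfComplex F τ) τ := by
  have := (UpperHalfPlane.mdifferentiableAt_iff.mp (hF τ)).hasDerivAt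
  rwa [normalizedDerivOfComplex, mul_inv_cancel_left₀ Complex.two_pi_I_ne_zero]

lemma periodic_comp_ofComplex_of_T {F : ℍ → ℂ} (hT : ∀ τ, F (ModularGroup.T • τ) = F τ) :
    Function.Periodic (F ∘ ofComplex) (1 : ℝ) := by
  intro w
  by_cases! hw : 0 < w.im
  · have : 0 < (w + (1 : ℝ)).im := by simpa using hw
    simp only [Function.comp_apply, ofComplex_apply_of_im_pos this, ofComplex_apply_of_im_pos hw]
    rw [← hT ⟨w, hw⟩]
    congr 1
    ext
    rw [modular_T_smul]
    simp [add_comm]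
  · have : (w + (1 : ℝ)).im ≤ 0 := by simpa using hw
    simp only [Function.comp_apply, ofComplex_apply_of_im_nonpos this,
      ofComplex_apply_of_im_nonpos hw]

/-- `q d/dq` in terms of the `q`-expansion. -/
lemma normalizedDeriv_eq {F : ℍ → ℂ} (hF : MDiff F) (hT : ∀ τ, F (ModularGroup.T • τ) = F τ)
    (hb : IsBoundedAtImInfty F) (τ : ℍ) :
    normalizedDerivOfComplex F τ = Function.Periodic.qParam 1 τ *
      deriv (cuspFunction 1 F) (Function.Periodic.qParam 1 τ) := by
  have hper := periodic_comp_ofComplex_of_T hT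
  have h1 : HasDerivAt (cuspFunction 1 F) _ (Function.Periodic.qParam 1 τ) :=
    (differentiableAt_cuspFunction one_pos hper hF hb
      (Function.Periodic.norm_qParam_lt_one one_pos τ.im_pos)).hasDerivAt
  have h2 : HasDerivAt (Function.Periodic.qParam 1)
      (Function.Periodic.qParam 1 τ * (2 * Real.pi * Complex.I)) τ := by
    have := (((hasDerivAt_id (τ : ℂ)).const_mul (2 * Real.pi * Complex.I)).div_const
      ((1 : ℝ) : ℂ)).cexp
    have h5 : Function.Periodic.qParam 1 =
        fun z => Complex.exp (2 * Real.pi * Complex.I * id z / ((1 : ℝ) : ℂ)) := rfl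
    rw [h5]
    simpa using this
  have h3 := (h1.comp (τ : ℂ) h2)
  have h4 : cuspFunction 1 F ∘ Function.Periodic.qParam 1 = F ∘ ofComplex := by
    funext z
    exact Function.Periodic.eq_cuspFunction one_ne_zero hper z
  rw [h4] at h3
  rw [normalizedDerivOfComplex, h3.deriv]
  field_simp [Complex.two_pi_I_ne_zero]

lemma tendsto_deriv_cuspFunction {F : ℍ → ℂ} (hF : MDiff F)
    (hT : ∀ τ, F (ModularGroup.T • τ) = F τ) (hb : IsBoundedAtImInfty F) :
    Tendsto (fun τ : ℍ => deriv (cuspFunction 1 F) (Function.Periodic.qParam 1 τ)) atImInfty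
      (𝓝 (deriv (cuspFunction 1 F) 0)) :=
  (analyticAt_cuspFunction_zero one_pos (periodic_comp_ofComplex_of_T hT) hF
    hb).deriv.continuousAt.tendsto.comp (qParam_tendsto_atImInfty one_pos)

lemma tendsto_normalizedDeriv {F : ℍ → ℂ} (hF : MDiff F)
    (hT : ∀ τ, F (ModularGroup.T • τ) = F τ) (hb : IsBoundedAtImInfty F) :
    Tendsto (normalizedDerivOfComplex F) atImInfty (𝓝 0) := by
  have := (qParam_tendsto_atImInfty one_pos).mul (tendsto_deriv_cuspFunction hF hT hb)
  rw [zero_mul] at this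
  exact this.congr fun τ => (normalizedDeriv_eq hF hT hb τ).symm

lemma levelOne_T {k : ℤ} (F : ModularForm 𝒮ℒ k) (τ : ℍ) : F (ModularGroup.T • τ) = F τ := by
  have h := autFactor_T_zpow 1 τ
  rw [zpow_one] at h
  rw [smul_levelOne, h, one_zpow, one_mul]

lemma isBoundedAtImInfty_of_tendsto {F : ℍ → ℂ} {c : ℂ} (h : Tendsto F atImInfty (𝓝 c)) :
    IsBoundedAtImInfty F := h.isBigO_one ℝ

lemma tendsto_normalizedDeriv_levelOne {k : ℤ} (F : ModularForm 𝒮ℒ k) :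
    Tendsto (normalizedDerivOfComplex F) atImInfty (𝓝 0) :=
  tendsto_normalizedDeriv F.holo' (levelOne_T F) (isBoundedAtImInfty_of_tendsto (tendsto_levelOne F))

/-- The logarithmic derivative of the discriminant. -/
lemma normalizedDeriv_discriminant (τ : ℍ) :
    normalizedDerivOfComplex discriminant τ = E2 τ * discriminant τ := by
  have hη := (differentiableAt_eta_of_mem_upperHalfPlaneSet τ.2)
  have h1 : HasDerivAt (fun z => eta z ^ 24) (24 * eta τ ^ 23 * deriv eta τ) τ := by
    simpa using! hη.hasDerivAt.pow 24
  have h2 : (discriminant ∘ ofComplex) =ᶠ[𝓝 (τ : ℂ)] fun z => eta z ^ 24 := by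
    filter_upwards [isOpen_upperHalfPlaneSet.mem_nhds τ.im_pos] with z hz
    simp [discriminant, ofComplex_apply_of_im_pos hz]
  have h3 := logDeriv_eta_eq_E2 τ
  have h4 : eta τ ≠ 0 := eta_ne_zero τ.2
  rw [logDeriv_apply, div_eq_iff h4] at h3
  rw [normalizedDerivOfComplex, h2.deriv_eq, h1.deriv, h3, discriminant]
  have := Complex.I_ne_zero
  have : (Real.pi : ℂ) ≠ 0 := by exact_mod_cast Real.pi_ne_zero
  field_simp
  ring

/-- `E2` is the logarithmic derivative `q Δ'(q)/Δ` of the discriminant, and `Δ = q + ⋯`. Being only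
quasimodular, it is not covered by `tendsto_levelOne`. -/
lemma tendsto_E2 : Tendsto E2 atImInfty (𝓝 1) := by
  have hT : ∀ τ, discriminant (ModularGroup.T • τ) = discriminant τ := fun τ => by
    have h := autFactor_T_zpow 1 τ
    rw [zpow_one] at h
    rw [discriminant_smul, h, one_pow, one_mul]
  have hb : IsBoundedAtImInfty discriminant := hasOrder_discriminant.isBoundedAtImInfty zero_le_one
  have h1 := tendsto_deriv_cuspFunction mdifferentiable_discriminant hT hb
  have h2 : deriv (cuspFunction 1 discriminant) 0 = 1 := by
    have := discriminant_qExpansion_coeff_one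
    rw [qExpansion_coeff] at this
    simpa using this
  rw [h2] at h1
  have h3 := h1.div tendsto_discriminant_div one_ne_zero
  rw [div_one] at h3
  refine h3.congr fun τ => ?_
  have h4 := normalizedDeriv_eq mdifferentiable_discriminant hT hb τ
  rw [normalizedDeriv_discriminant] at h4
  have := discriminant_ne_zero τ
  have := Function.Periodic.qParam_ne_zero (h := 1) (τ : ℂ)
  simp only [Pi.div_apply]
  field_simp
  linear_combination -h4

lemma E2_slash (γ : SL(2, ℤ)) : E2 ∣[(2 : ℤ)] γ =
    fun z => E2 z - 6 * Complex.I / Real.pi * autRatio γ z := by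
  rw [E2_slash_action]
  ext z
  have : (Real.pi : ℂ) ≠ 0 := by exact_mod_cast Real.pi_ne_zero
  simp only [Pi.sub_apply, Pi.smul_apply, D2, riemannZeta_two, smul_eq_mul, ← autFactor_eq_denom,
    autRatio]
  have := autFactor_ne_zero γ z
  field_simp

lemma E2_T (τ : ℍ) : E2 (ModularGroup.T • τ) = E2 τ := by
  have h := congrFun (E2_slash ModularGroup.T) τ
  have h1 := autFactor_T_zpow 1 τ
  rw [zpow_one] at h1
  rw [SL_slash_apply, ← autFactor_eq_denom, h1] at h
  have h2 : autRatio ModularGroup.T τ = 0 := by simp [autRatio, ModularGroup.T]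
  rw [h2] at h
  simpa using h

lemma tendsto_normalizedDeriv_E2 : Tendsto (normalizedDerivOfComplex E2) atImInfty (𝓝 0) :=
  tendsto_normalizedDeriv E2_mdifferentiable E2_T (isBoundedAtImInfty_of_tendsto tendsto_E2)

lemma hasDerivAt_autRatio (γ : SL(2, ℤ)) (τ : ℍ) :
    HasDerivAt (autRatio γ ∘ ofComplex) (-(autRatio γ τ) ^ 2) τ := by
  have hne := autFactor_ne_zero γ τ
  rw [autFactor] at hne
  have h2 : HasDerivAt (fun z : ℂ => (γ 1 0 * z + γ 1 1 : ℂ)) (γ 1 0 : ℂ) τ := by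
    simpa using ((hasDerivAt_id (τ : ℂ)).const_mul (γ 1 0 : ℂ)).add_const (γ 1 1 : ℂ)
  refine (((h2.fun_inv hne).const_mul (γ 1 0 : ℂ)).congr_deriv ?_).congr_of_eventuallyEq ?_
  · simp only [autRatio, autFactor]; field_simp
  filter_upwards [isOpen_upperHalfPlaneSet.mem_nhds τ.im_pos] with z hz
  simp [autRatio, autFactor, ofComplex_apply_of_im_pos hz, div_eq_mul_inv]

/-- Differentiating the transformation law of `E2` and squaring it produce the same non-modular
terms up to the factor 12: one linear and one quadratic in `ρ = c/(cτ + d)`, with `ρ' = -ρ²`. They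
cancel in this combination. -/
lemma serre_E2_slash (γ : SL(2, ℤ)) :
    (fun z => normalizedDerivOfComplex E2 z - E2 z ^ 2 / 12) ∣[(4 : ℤ)] γ =
      fun z => normalizedDerivOfComplex E2 z - E2 z ^ 2 / 12 := by
  ext z
  have hpi : (Real.pi : ℂ) ≠ 0 := by exact_mod_cast Real.pi_ne_zero
  have h1 := congrFun (normalizedDerivOfComplex_SL_slash E2_mdifferentiable (k := 2) (γ := γ)) z
  have h2 := congrFun (E2_slash γ) z
  have h3 : normalizedDerivOfComplex (E2 ∣[(2 : ℤ)] γ) z = normalizedDerivOfComplex E2 z -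
      6 * Complex.I / Real.pi * ((2 * Real.pi * Complex.I)⁻¹ * (-(autRatio γ z) ^ 2)) := by
    rw [E2_slash, normalizedDerivOfComplex]
    have h5 := (hasDerivAt_comp_ofComplex E2_mdifferentiable z).sub
      ((hasDerivAt_autRatio γ z).const_mul (6 * Complex.I / Real.pi))
    have h7 : ((fun z => E2 z - 6 * Complex.I / Real.pi * autRatio γ z) ∘ ofComplex) =
      (E2 ∘ ofComplex - fun w => 6 * Complex.I / Real.pi * (autRatio γ ∘ ofComplex) w) := rfl
    rw [h7, h5.deriv, mul_sub, inv_mul_cancel_left₀ Complex.two_pi_I_ne_zero]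
    ring
  have h8 := autFactor_ne_zero γ z
  have h9 : autFactor γ z ^ (-4 : ℤ) = (autFactor γ z ^ (-2 : ℤ)) ^ 2 := by
    rw [← zpow_natCast, ← zpow_mul]; norm_num
  rw [h3, Pi.sub_apply, SL_slash_apply, ← autFactor_eq_denom, h2] at h1
  rw [SL_slash_apply, ← autFactor_eq_denom] at h2 ⊢
  rw [show -(2 + 2 : ℤ) = -4 by norm_num, h9] at h1
  rw [h9]
  have h10 : ((γ 1 0 : ℤ) : ℂ) / autFactor γ z = autRatio γ z := rfl
  generalize autFactor γ z ^ (-2 : ℤ) = s at *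
  rw [h10] at h1
  generalize autRatio γ z = X at *
  have h11 : (2 * Real.pi * Complex.I : ℂ)⁻¹ = -Complex.I / (2 * Real.pi) := by
    have := Complex.I_ne_zero
    field_simp
    rw [Complex.I_sq]; norm_num
  rw [h11] at h1
  have h12 : (Real.pi : ℂ) * (Real.pi : ℂ)⁻¹ = 1 := mul_inv_cancel₀ hpi
  simp only [div_eq_mul_inv, mul_inv] at *
  linear_combination -h1 -
    (E2 (γ • z) * s + (E2 z - 6 * Complex.I * (Real.pi : ℂ)⁻¹ * X)) * h2 / 12

/-- A level one form of weight `k` is determined by its value at the cusp if `dim M_k = 1`. -/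
lemma eq_mul_of_tendsto {k : ℤ} (hk : Module.rank ℂ (ModularForm 𝒮ℒ k) = 1)
    (G : ModularForm 𝒮ℒ k) (hG : Tendsto G atImInfty (𝓝 1)) {F : ℍ → ℂ} (hF : MDiff F)
    (hinv : ∀ γ : SL(2, ℤ), F ∣[k] γ = F) {c : ℂ} (hc : Tendsto F atImInfty (𝓝 c)) (τ : ℍ) :
    F τ = c * G τ := by
  let F' : ModularForm 𝒮ℒ k :=
    { toFun := F
      slash_action_eq' := by rintro _ ⟨γ, rfl⟩; exact hinv γ
      holo' := hF
      bdd_at_cusps' := by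
        intro c' hc'
        rw [OnePoint.isBoundedAt_iff_forall_SL2Z hc']
        intro γ _
        rw [hinv]
        exact isBoundedAtImInfty_of_tendsto hc }
  have hG0 : G ≠ 0 := by
    rintro rfl
    exact one_ne_zero (tendsto_nhds_unique hG tendsto_const_nhds)
  obtain ⟨a, ha⟩ := (finrank_eq_one_iff_of_nonzero' G hG0).mp
    (Module.rank_eq_one_iff_finrank_eq_one.mp hk) F'
  have ha' : ∀ τ, a * G τ = F τ := fun τ => congrFun (congrArg DFunLike.coe ha) τ
  have hac : a = c := by
    have := (hG.const_mul a).congr ha'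
    rw [mul_one] at this
    exact tendsto_nhds_unique this hc
  rw [← ha', hac]

lemma tendsto_E₆ : Tendsto E₆ atImInfty (𝓝 1) := by
  have := tendsto_levelOne E₆
  rwa [EisensteinSeries.E_qExpansion_coeff_zero _ ⟨3, rfl⟩] at this

/-- The derivative corrected by `E2 ^ 2 / 12` lies in the one-dimensional space of weight 4, so its
value `-1/12` at `i∞` determines it. The two formulas for `E₄` and `E₆` follow in the same way from
Serre derivatives, in weights 6 and 8. -/
lemma normalizedDeriv_E2 (τ : ℍ) :
    normalizedDerivOfComplex E2 τ = (E2 τ ^ 2 - E₄ τ) / 12 := by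
  have h := eq_mul_of_tendsto levelOne_weight_four_rank_one E₄ tendsto_E₄
    (F := fun z => normalizedDerivOfComplex E2 z - E2 z ^ 2 / 12) (c := -(1 / 12)) ?_
    serre_E2_slash ?_ τ
  · linear_combination h
  · simp only [div_eq_mul_inv]
    exact (normalizedDerivOfComplex_mdifferentiable E2_mdifferentiable).sub
      ((E2_mdifferentiable.pow 2).mul mdifferentiable_const)
  · have := tendsto_normalizedDeriv_E2.sub ((tendsto_E2.pow 2).div_const 12)
    simpa using this

lemma slash_levelOne {k : ℤ} (F : ModularForm 𝒮ℒ k) (γ : SL(2, ℤ)) : (F : ℍ → ℂ) ∣[k] γ = F :=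
  SlashInvariantForm.slash_action_eqn F _ ⟨γ, rfl⟩

lemma tendsto_serreDerivative {k : ℤ} (F : ModularForm 𝒮ℒ k) (hF : Tendsto F atImInfty (𝓝 1)) :
    Tendsto (serreDerivative k F) atImInfty (𝓝 (-(k / 12))) := by
  have := (tendsto_normalizedDeriv_levelOne F).sub ((tendsto_E2.const_mul (k * 12⁻¹ : ℂ)).mul hF)
  simpa [div_eq_mul_inv] using! this

lemma normalizedDeriv_E₄ (τ : ℍ) :
    normalizedDerivOfComplex E₄ τ = (E2 τ * E₄ τ - E₆ τ) / 3 := by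
  have h := eq_mul_of_tendsto levelOne_weight_six_rank_one E₆ tendsto_E₆
    (serreDerivative_mdifferentiable (4 : ℤ) E₄.holo')
    (fun γ => serreDerivative_slash_invariant E₄.holo' (slash_levelOne E₄ γ))
    (tendsto_serreDerivative E₄ tendsto_E₄) τ
  rw [serreDerivative_apply] at h
  push_cast at h
  linear_combination h

lemma normalizedDeriv_E₆ (τ : ℍ) :
    normalizedDerivOfComplex E₆ τ = (E2 τ * E₆ τ - E₄ τ ^ 2) / 2 := by
  have hrank : Module.rank ℂ (ModularForm 𝒮ℒ (6 + 2)) = 1 := by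
    have := dimension_level_one 8 ⟨4, rfl⟩
    simpa [Nat.ModEq] using! this
  -- The space of weight 8 is one-dimensional, and `E₄²` is its element with value 1 at `i∞`.
  let G : ModularForm 𝒮ℒ (6 + 2) := ModularForm.mcast (by norm_num) (E₄.pow 2)
  have hG : ∀ τ, G τ = E₄ τ ^ 2 := fun τ => congrFun (ModularForm.coe_pow E₄ 2) τ
  have h := eq_mul_of_tendsto hrank G
    (by have := tendsto_E₄.pow 2; rw [one_pow] at this; exact this.congr fun τ => (hG τ).symm)
    (serreDerivative_mdifferentiable (6 : ℤ) E₆.holo')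
    (fun γ => serreDerivative_slash_invariant E₆.holo' (slash_levelOne E₆ γ))
    (tendsto_serreDerivative E₆ tendsto_E₆) τ
  rw [serreDerivative_apply, hG] at h
  push_cast at h
  linear_combination h

/-! ### The Eisenstein series `E₄` as a hypergeometric function -/

/-- The function `12³ / j`. -/
def jHat (τ : ℍ) : ℂ := 12 ^ 3 / jInv τ

lemma tendsto_jHat : Tendsto jHat atImInfty (𝓝 0) := by
  have := (hasOrder_jInv.tendsto_inv (by norm_num)).const_mul (12 ^ 3)
  rw [mul_zero] at this
  exact this

end

section

open Asymptotics ModularForm Manifold Derivative EisensteinSeries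

lemma jHat_eq {τ : ℍ} (h : E₄ τ ≠ 0) : jHat τ = 1 - E₆ τ ^ 2 / E₄ τ ^ 3 := by
  have h1 := discriminant_eq_E₄_cube_sub_E₆_sq τ
  have h2 := discriminant_ne_zero τ
  rw [jHat, jInv]
  field_simp
  linear_combination 1728 * h1

lemma isOpen_im_gt (A : ℝ) : IsOpen {z : ℂ | A < z.im} :=
  isOpen_lt continuous_const Complex.continuous_im

lemma isPreconnected_im_gt (A : ℝ) : IsPreconnected {z : ℂ | A < z.im} :=
  (convex_halfSpace_im_gt A).isPreconnected

lemma tendsto_coe_add_one :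
    Tendsto (fun z : ℂ => z + 1) (comap Complex.im atTop) (comap Complex.im atTop) := by
  refine tendsto_comap_iff.mpr ?_
  simpa [Function.comp_def] using tendsto_comap

instance : (comap Complex.im atTop).NeBot :=
  comap_neBot_iff_frequently.mpr (Eventually.frequently (.of_forall fun y => ⟨⟨0, y⟩, rfl⟩))

/-- A function with vanishing second derivative on a half plane that has a limit at `i∞` is
constant. -/
lemma eq_of_deriv_deriv_eq_zero {k P : ℂ → ℂ} {A : ℝ} {l : ℂ}
    (hk : ∀ z : ℂ, A < z.im → HasDerivAt k (P z) z)
    (hP : ∀ z : ℂ, A < z.im → HasDerivAt P 0 z)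
    (hl : Tendsto k (comap Complex.im atTop) (𝓝 l)) {z : ℂ} (hz : A < z.im) : k z = l := by
  have hPc : ∀ w : ℂ, A < w.im → P w = P z := fun w hw =>
    (isOpen_im_gt A).is_const_of_deriv_eq_zero (isPreconnected_im_gt A)
      (fun u hu => (hP u hu).differentiableAt.differentiableWithinAt)
      (fun u hu => (hP u hu).deriv) hw hz
  have hlin : ∀ w : ℂ, A < w.im → k w - P z * w = k z - P z * z := fun w hw =>
    (isOpen_im_gt A).is_const_of_deriv_eq_zero (f := fun w => k w - P z * w)
      (isPreconnected_im_gt A)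
      (fun u hu => ((hk u hu).sub ((hasDerivAt_id u).const_mul
        (P z))).differentiableAt.differentiableWithinAt)
      (fun u hu => by
        have := ((hk u hu).sub ((hasDerivAt_id u).const_mul (P z))).deriv
        rw [hPc u hu, mul_one, sub_self] at this
        exact this) hw hz
  have hev : ∀ᶠ w : ℂ in comap Complex.im atTop, A < w.im :=
    tendsto_comap.eventually (eventually_gt_atTop A)
  -- The slope is the increment of `k` under `w ↦ w + 1`, which tends to `l - l`.
  have h0 : P z = 0 := by
    have h1 : Tendsto (fun w => k (w + 1) - k w) (comap Complex.im atTop) (𝓝 (l - l)) :=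
      (hl.comp tendsto_coe_add_one).sub hl
    rw [sub_self] at h1
    refine tendsto_nhds_unique (tendsto_const_nhds.congr' ?_) h1
    filter_upwards [hev] with w hw
    have h2 := hlin w hw
    have h3 := hlin (w + 1) (by simpa using hw)
    linear_combination h2 - h3
  refine tendsto_nhds_unique (tendsto_const_nhds.congr' ?_) hl
  filter_upwards [hev] with w hw
  have := hlin w hw
  rw [h0] at this
  linear_combination -this

/-- The hypergeometric equation, pulled back to `τ`, has the solutions `E₄^(1/4)` and `τ E₄^(1/4)`.
Accordingly `k = hHat(12³/j) E₄^(-1/4)` is shown to have vanishing second derivative, and its limit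
1 excludes the linear term. The twelfth power makes the statement independent of the branch of the
fourth root. -/
lemma hHat_jHat_pow : ∀ᶠ τ in atImInfty, hHat (jHat τ) ^ 12 = E₄ τ ^ 3 := by
  have hslit : ∀ᶠ τ in atImInfty, E₄ τ ∈ Complex.slitPlane :=
    tendsto_E₄.eventually (Complex.isOpen_slitPlane.mem_nhds (by simp))
  have hsmall : ∀ᶠ τ in atImInfty, ‖jHat τ‖ < 1 :=
    (tendsto_zero_iff_norm_tendsto_zero.mp tendsto_jHat).eventually_lt_const one_pos
  obtain ⟨A₀, hA₀⟩ := (atImInfty_mem _).mp (hslit.and hsmall)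
  set A := max A₀ 0
  have hU : ∀ z : ℂ, A < z.im → ∃ τ : ℍ, (τ : ℂ) = z ∧ E₄ τ ∈ Complex.slitPlane ∧ ‖jHat τ‖ < 1 :=
    fun z hz => ⟨⟨z, (le_max_right _ _).trans_lt hz⟩, rfl,
      hA₀ _ ((le_max_left _ _).trans hz.le)⟩
  let e₂ : ℂ → ℂ := E2 ∘ ofComplex
  let e₄ : ℂ → ℂ := E₄ ∘ ofComplex
  let e₆ : ℂ → ℂ := E₆ ∘ ofComplex
  let x : ℂ → ℂ := fun z => 1 - e₆ z ^ 2 / e₄ z ^ 3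
  let w : ℂ → ℂ := fun z => e₄ z ^ (-(1 / 4) : ℂ)
  let c : ℂ := 2 * Real.pi * Complex.I
  let k : ℂ → ℂ := fun z => hHat (x z) * w z
  -- The derivative of `k`, from `x' = c x e₆/e₄` and Ramanujan's formula for `e₄'`.
  let P : ℂ → ℂ := fun z =>
    c * ((hHatTheta (x z) * (e₆ z / e₄ z) - hHat (x z) * ((e₂ z - e₆ z / e₄ z) / 12)) * w z)
  have h4 : ∀ z, A < z.im → e₄ z ∈ Complex.slitPlane := by
    intro z hz; obtain ⟨τ, rfl, h, -⟩ := hU z hz; simpa [e₄] using h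
  have h40 : ∀ z, A < z.im → e₄ z ≠ 0 := fun z hz => Complex.slitPlane_ne_zero (h4 z hz)
  have hx1 : ∀ z, A < z.im → ‖x z‖ < 1 := by
    intro z hz
    obtain ⟨τ, rfl, h, h'⟩ := hU z hz
    rw [jHat_eq (Complex.slitPlane_ne_zero h)] at h'
    simpa [x, e₄, e₆] using h'
  have de₂ : ∀ z, A < z.im → HasDerivAt e₂ (c * ((e₂ z ^ 2 - e₄ z) / 12)) z := by
    intro z hz; obtain ⟨τ, rfl, -⟩ := hU z hz
    have := hasDerivAt_comp_ofComplex E2_mdifferentiable τ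
    rw [normalizedDeriv_E2] at this
    simpa [e₂, e₄] using this
  have de₄ : ∀ z, A < z.im → HasDerivAt e₄ (c * ((e₂ z * e₄ z - e₆ z) / 3)) z := by
    intro z hz; obtain ⟨τ, rfl, -⟩ := hU z hz
    have := hasDerivAt_comp_ofComplex E₄.holo' τ
    erw [normalizedDeriv_E₄] at this
    simpa [e₂, e₄, e₆] using this
  have de₆ : ∀ z, A < z.im → HasDerivAt e₆ (c * ((e₂ z * e₆ z - e₄ z ^ 2) / 2)) z := by
    intro z hz; obtain ⟨τ, rfl, -⟩ := hU z hz
    have := hasDerivAt_comp_ofComplex E₆.holo' τ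
    erw [normalizedDeriv_E₆] at this
    simpa [e₂, e₄, e₆] using this
  have dx : ∀ z, A < z.im → HasDerivAt x (c * (x z * (e₆ z / e₄ z))) z := by
    intro z hz
    have h0 := h40 z hz
    refine ((((de₆ z hz).fun_pow 2).fun_div ((de₄ z hz).fun_pow 3) (pow_ne_zero 3 h0)).const_sub
      1).congr_deriv ?_
    simp only [x]
    field_simp
    ring
  have hball : ∀ z, A < z.im → x z ∈ Metric.ball (0 : ℂ) 1 := fun z hz => by simpa using hx1 z hz
  have dH : ∀ z, A < z.im →
      HasDerivAt (fun z => hHat (x z)) (c * (hHatTheta (x z) * (e₆ z / e₄ z))) z := by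
    intro z hz
    have h1 := (hHat_differentiableOn.differentiableAt
      (Metric.isOpen_ball.mem_nhds (hball z hz))).hasDerivAt
    refine (h1.comp z (dx z hz)).congr_deriv ?_
    simp only [hHatTheta]; ring
  have dT : ∀ z, A < z.im → HasDerivAt (fun z => hHatTheta (x z))
      (c * (x z * deriv hHatTheta (x z) * (e₆ z / e₄ z))) z := by
    intro z hz
    have h1 := (hHatTheta_differentiableOn.differentiableAt
      (Metric.isOpen_ball.mem_nhds (hball z hz))).hasDerivAt
    refine (h1.comp z (dx z hz)).congr_deriv ?_
    ring
  have dw : ∀ z, A < z.im → HasDerivAt w (-(c * ((e₂ z - e₆ z / e₄ z) / 12 * w z))) z := by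
    intro z hz
    have h0 := h40 z hz
    refine ((de₄ z hz).cpow_const (h4 z hz)).congr_deriv ?_
    rw [Complex.cpow_sub _ _ h0, Complex.cpow_one]
    simp only [w]
    field_simp
    ring
  have dk : ∀ z, A < z.im → HasDerivAt k (P z) z := by
    intro z hz
    refine ((dH z hz).fun_mul (dw z hz)).congr_deriv ?_
    simp only [P]; ring
  have dP : ∀ z, A < z.im → HasDerivAt P 0 z := by
    intro z hz
    have h0 := h40 z hz
    have hr := (de₆ z hz).fun_div (de₄ z hz) h0
    -- After Ramanujan's equations are inserted, the second derivative of `k` is a multiple of this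
    -- relation.
    have hode := hHatTheta_ode (hx1 z hz)
    refine (((((dT z hz).fun_mul hr).fun_sub ((dH z hz).fun_mul
      (((de₂ z hz).fun_sub hr).div_const 12))).fun_mul (dw z hz)).const_mul c).congr_deriv ?_
    generalize hHat (x z) = f at *
    generalize hHatTheta (x z) = g at *
    generalize x z * deriv hHatTheta (x z) = K at *
    simp only [x] at hode
    generalize w z = W
    generalize e₂ z = a at *
    generalize e₄ z = b at *
    generalize e₆ z = d at *
    field_simp at hode ⊢
    linear_combination (3 * c ^ 2 * W) * hode
  have hlim : Tendsto k (comap Complex.im atTop) (𝓝 1) := by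
    have hx0 : Tendsto (fun τ : ℍ => hHat (jHat τ) * E₄ τ ^ (-(1 / 4) : ℂ)) atImInfty (𝓝 1) := by
      have h1 : Tendsto (fun τ : ℍ => hHat (jHat τ)) atImInfty (𝓝 1) := by
        have := (hHat_differentiableOn.differentiableAt
          (Metric.ball_mem_nhds _ one_pos)).continuousAt.tendsto.comp tendsto_jHat
        rwa [hHat_zero] at this
      have h2 := tendsto_E₄.cpow (tendsto_const_nhds (x := (-(1 / 4) : ℂ))) (by simp)
      simpa using h1.mul h2
    refine (hx0.comp tendsto_comap_im_ofComplex).congr' ?_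
    filter_upwards [tendsto_comap.eventually (eventually_gt_atTop A)] with z hz
    obtain ⟨τ, rfl, h, h'⟩ := hU z hz
    simp [k, x, w, e₄, e₆, jHat_eq (Complex.slitPlane_ne_zero h)]
  filter_upwards [tendsto_im_atImInfty.eventually (eventually_gt_atTop A)] with τ hτ
  have h1 : k τ = 1 := eq_of_deriv_deriv_eq_zero dk dP hlim hτ
  have h0 := h40 τ hτ
  simp only [k, w, x, e₄, e₆, Function.comp_apply, ofComplex_apply] at h1 h0
  rw [← jHat_eq h0] at h1
  have h2 := congrArg (· ^ 12) h1
  simp only [mul_pow, one_pow] at h2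
  rw [← Complex.cpow_nat_mul, show ((12 : ℕ) : ℂ) * (-(1 / 4)) = -((3 : ℕ) : ℂ) by norm_num,
    Complex.cpow_neg, Complex.cpow_natCast] at h2
  field_simp at h2
  exact h2

end

section

open CongruenceSubgroup

/-! ### The index of `Γ₀(N)` -/

lemma inv_mul_mem_Gamma0_iff {N : ℕ} (g h : SL(2, ℤ)) :
    g⁻¹ * h ∈ Gamma0 N ↔ (N : ℤ) ∣ g 0 0 * h 1 0 - g 1 0 * h 0 0 := by
  rw [Gamma0_mem, ZMod.intCast_zmod_eq_zero_iff_dvd]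
  have : (g⁻¹ * h) 1 0 = g 0 0 * h 1 0 - g 1 0 * h 0 0 := by
    have hI : (g⁻¹ : SL(2, ℤ)).1 = !![g 1 1, -g 0 1; -g 1 0, g 0 0] := by
      rw [Matrix.SpecialLinearGroup.SL2_inv_expl]; rfl
    rw [Matrix.SpecialLinearGroup.coe_mul, hI]
    simp [Matrix.mul_apply, Fin.sum_univ_two]
    ring
  rw [this]

/-- The image of `i∞` under an element of `Γ₀(N)`, as a point of `ℙ¹(𝔽_p)` in the coordinate
`c / (N a)`. -/
def cosetLabel (N p : ℕ) [Fact p.Prime] (g : Gamma0 N) : Option (ZMod p) :=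
  if ((g : SL(2, ℤ)) 0 0 : ZMod p) = 0 then none
  else some ((((g : SL(2, ℤ)) 1 0 / (N : ℤ) : ℤ) : ZMod p) / ((g : SL(2, ℤ)) 0 0 : ZMod p))

/-- By the determinant, `a` and `c/N` do not both vanish modulo `p`, so `(a : c/N)` is a point of
`ℙ¹(𝔽_p)`. Two such points agree exactly if the cross product of the first columns, which is the
lower left entry of `g⁻¹h`, is divisible by `Np`. -/
lemma cosetLabel_eq_iff {N p : ℕ} [Fact p.Prime] (hN : N ≠ 0) (g h : Gamma0 N) :
    cosetLabel N p g = cosetLabel N p h ↔ (g : SL(2, ℤ))⁻¹ * h ∈ Gamma0 (N * p) := by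
  have key : ∀ g : Gamma0 N, ∃ c : ℤ, (g : SL(2, ℤ)) 1 0 = N * c ∧
      (g : SL(2, ℤ)) 1 0 / (N : ℤ) = c ∧
      (((g : SL(2, ℤ)) 0 0 : ZMod p) = 0 → (c : ZMod p) ≠ 0) := by
    intro g
    have hg := g.2
    rw [Gamma0_mem, ZMod.intCast_zmod_eq_zero_iff_dvd] at hg
    obtain ⟨c, hc⟩ := hg
    refine ⟨c, hc, by rw [hc]; exact Int.mul_ediv_cancel_left c (by exact_mod_cast hN), ?_⟩
    intro h1 h2
    have hdet := congrArg (Int.cast : ℤ → ZMod p) (det_eq (g : SL(2, ℤ)))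
    rw [hc] at hdet
    push_cast at hdet
    rw [h1, h2] at hdet
    simp at hdet
  obtain ⟨c, hc, hc', hc0⟩ := key g
  obtain ⟨c₂, hc₂, hc₂', hc₂0⟩ := key h
  rw [inv_mul_mem_Gamma0_iff, hc, hc₂, cosetLabel, cosetLabel, hc', hc₂']
  have h1 : (g : SL(2, ℤ)) 0 0 * (N * c₂) - N * c * (h : SL(2, ℤ)) 0 0 =
      N * ((g : SL(2, ℤ)) 0 0 * c₂ - c * (h : SL(2, ℤ)) 0 0) := by ring
  rw [h1]
  push_cast
  rw [mul_dvd_mul_iff_left (by exact_mod_cast hN : (N : ℤ) ≠ 0),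
    ← ZMod.intCast_zmod_eq_zero_iff_dvd]
  push_cast
  generalize ((g : SL(2, ℤ)) 0 0 : ZMod p) = a at *
  generalize ((h : SL(2, ℤ)) 0 0 : ZMod p) = b at *
  generalize (c : ZMod p) = x at *
  generalize (c₂ : ZMod p) = y at *
  clear * - hc0 hc₂0
  by_cases ha : a = 0 <;> by_cases hb : b = 0
  · simp [ha, hb]
  · simp [ha, hb, hc0 ha]
  · simp [ha, hb, hc₂0 hb]
  · rw [if_neg ha, if_neg hb, Option.some_inj, div_eq_div_iff ha hb, sub_eq_zero]
    constructor <;> intro h <;> linear_combination -h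

/-- The index counts the labels that occur. Every finite label comes from a first column `(1, Nk)`.
The label `none` requires `p ∣ a`: the column `(p, N)` realizes it if `p ∤ N`, while `p ∣ N` makes
`a` a unit modulo `p`. -/
lemma relIndex_Gamma0 {N p : ℕ} [hp : Fact p.Prime] (hN : N ≠ 0) :
    (Gamma0 (N * p)).relIndex (Gamma0 N) = if p ∣ N then p else p + 1 := by
  have h1 : QuotientGroup.leftRel ((Gamma0 (N * p)).subgroupOf (Gamma0 N)) =
      Setoid.ker (cosetLabel N p) := by
    ext g h
    rw [QuotientGroup.leftRel_apply, Subgroup.mem_subgroupOf, Setoid.ker_def,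
      cosetLabel_eq_iff hN]
    rfl
  have h2 : (Gamma0 (N * p)).relIndex (Gamma0 N) = Nat.card (Set.range (cosetLabel N p)) := by
    rw [Subgroup.relIndex, Subgroup.index]
    exact Nat.card_congr ((Quotient.congrRight (fun g h => by rw [h1])).trans
      (Setoid.quotientKerEquivRange (cosetLabel N p)))
  have hsome : ∀ k : ZMod p, some k ∈ Set.range (cosetLabel N p) := by
    intro k
    obtain ⟨k, rfl⟩ := ZMod.intCast_surjective k
    let γ : SL(2, ℤ) := ⟨!![1, 0; N * k, 1], by simp [Matrix.det_fin_two_of]⟩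
    have h00 : γ 0 0 = 1 := rfl
    have h10 : γ 1 0 = N * k := rfl
    refine ⟨⟨γ, by rw [Gamma0_mem, h10]; simp⟩, ?_⟩
    simp [cosetLabel, hN, h00, h10]
  rw [h2]
  split_ifs with hpN
  · have : Set.range (cosetLabel N p) = Set.range (some : ZMod p → Option (ZMod p)) := by
      refine Set.Subset.antisymm ?_ (by rintro _ ⟨k, rfl⟩; exact hsome k)
      rintro _ ⟨g, rfl⟩
      rw [cosetLabel, if_neg]
      · exact ⟨_, rfl⟩
      · intro h0
        have hg := g.2
        rw [Gamma0_mem, ZMod.intCast_zmod_eq_zero_iff_dvd] at hg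
        have hg' : (((g : SL(2, ℤ)) 1 0 : ℤ) : ZMod p) = 0 := by
          rw [ZMod.intCast_zmod_eq_zero_iff_dvd]
          exact (Int.natCast_dvd_natCast.mpr hpN).trans hg
        have hdet := congrArg (Int.cast : ℤ → ZMod p) (det_eq (g : SL(2, ℤ)))
        push_cast at hdet
        rw [h0, hg'] at hdet
        simp at hdet
    rw [this, Nat.card_range_of_injective (Option.some_injective _), Nat.card_zmod]
  · have : Set.range (cosetLabel N p) = Set.univ := by
      refine Set.eq_univ_of_forall fun o => ?_
      rcases o with _ | k
      · have hcop : IsCoprime (p : ℤ) (N : ℤ) :=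
          Nat.isCoprime_iff_coprime.mpr ((Nat.Prime.coprime_iff_not_dvd hp.out).mpr hpN)
        obtain ⟨γ, h00, h10⟩ := hcop.exists_SL2_col 0
        refine ⟨⟨γ, by rw [Gamma0_mem, h10]; simp⟩, ?_⟩
        simp [cosetLabel, h00]
      · exact hsome k
    rw [this, Nat.card_coe_set_eq, Set.ncard_univ, Finite.card_option, Nat.card_zmod]

lemma psi_mul_prime {N p : ℕ} (hp : p.Prime) (hN : N ≠ 0) :
    psi (N * p) = psi N * (if p ∣ N then p else p + 1 : ℕ) := by
  have hp0 : (p : ℚ) ≠ 0 := by exact_mod_cast hp.ne_zero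
  rw [psi, psi, Nat.primeFactors_mul hN hp.ne_zero, hp.primeFactors]
  split_ifs with h
  · have : p ∈ N.primeFactors := Nat.mem_primeFactors.mpr ⟨hp, h, hN⟩
    rw [Finset.union_eq_left.mpr (by simpa using this)]
    push_cast; ring
  · have : p ∉ N.primeFactors := fun h' => h (Nat.dvd_of_mem_primeFactors h')
    rw [Finset.union_comm, ← Finset.insert_eq, Finset.prod_insert this]
    push_cast
    field_simp

lemma index_Gamma0 {N : ℕ} (hN : N ≠ 0) : ((Gamma0 N).index : ℚ) = psi N := by
  induction N using induction_on_primes with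
  | zero => exact absurd rfl hN
  | one =>
    have : Gamma0 1 = ⊤ := by
      ext g; simp [Gamma0_mem, eq_iff_true_of_subsingleton]
    simp [this, psi]
  | prime_mul p n hp IH =>
    have := Fact.mk hp
    have hn : n ≠ 0 := right_ne_zero_of_mul hN
    have hle : Gamma0 (n * p) ≤ Gamma0 n := by
      intro γ hγ
      rw [Gamma0_mem, ZMod.intCast_zmod_eq_zero_iff_dvd] at hγ ⊢
      exact (Int.natCast_dvd_natCast.mpr (dvd_mul_right n p)).trans hγ
    rw [mul_comm p n, psi_mul_prime hp hn, ← IH hn, ← Subgroup.relIndex_mul_index hle,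
      relIndex_Gamma0 hn, Nat.cast_mul, mul_comm]

end

section

open CongruenceSubgroup ModularForm Manifold

/-! ### Forms of weight twelve whose zeros are at the cusp `0` -/

/-- `v * Δ` is a modular form of weight `12` for `Γ₀(M)`, equal to `1` at `i∞`, whose only zero is
at the cusp `0`, of order `r` with respect to `q`. -/
structure IsFormWithZeroAtZero (M : ℕ) (r : ℝ) (v : ℍ → ℂ) : Prop where
  mdifferentiable : MDiff v
  ne_zero : ∀ τ, v τ ≠ 0
  invariant : ∀ γ ∈ Gamma0 M, ∀ τ, v (γ • τ) = v τ
  -- Order `-1` compensates the simple zero of `Δ`. The cusp `γ(i∞)` is equivalent to `0` exactly if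
  -- `γ 1 0` is prime to `M`.
  order : ∀ γ : SL(2, ℤ), ¬ IsCoprime (γ 1 0) (M : ℤ) → HasOrder (fun τ => v (γ • τ)) (-1)
  order_S : HasOrder (fun τ => v (ModularGroup.S • τ)) (r - 1)
  tendsto : Tendsto (fun τ => v τ * discriminant τ) atImInfty (𝓝 1)

lemma mdifferentiable_comp_smul {f : ℍ → ℂ} (hf : MDiff f) (γ : SL(2, ℤ)) :
    MDiff (fun τ => f (γ • τ)) :=
  hf.comp (mdifferentiable_smul (g := (γ : GL (Fin 2) ℝ)) (by simp))

/-- The translate of a `Γ₀(M)`-invariant function by a coset. -/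
def cosetTranslate {M : ℕ} {v : ℍ → ℂ} (hv : ∀ γ ∈ Gamma0 M, ∀ τ, v (γ • τ) = v τ)
    (q : SL(2, ℤ) ⧸ Gamma0 M) (τ : ℍ) : ℂ :=
  q.liftOn (fun g => v (g⁻¹ • τ)) fun a b hab => by
    rw [← hv _ (QuotientGroup.leftRel_apply.mp hab) (b⁻¹ • τ), smul_smul]
    simp

lemma cosetTranslate_smul {M : ℕ} {v : ℍ → ℂ} (hv : ∀ γ ∈ Gamma0 M, ∀ τ, v (γ • τ) = v τ)
    (q : SL(2, ℤ) ⧸ Gamma0 M) (γ : SL(2, ℤ)) (τ : ℍ) :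
    cosetTranslate hv q (γ • τ) = cosetTranslate hv (γ⁻¹ • q) τ := by
  induction q using QuotientGroup.induction_on with
  | H g =>
    rw [MulAction.Quotient.smul_mk]
    change v _ = v _
    rw [smul_eq_mul, mul_inv_rev, inv_inv, mul_smul]

/-- The cosets of the cusp `0`. -/
def zeroCosets (M : ℕ) : Set (SL(2, ℤ) ⧸ Gamma0 M) :=
  Set.range fun k : Fin M =>
    ((ModularGroup.T ^ ((k : ℕ) : ℤ) * ModularGroup.S : SL(2, ℤ)) : SL(2, ℤ) ⧸ Gamma0 M)

lemma T_zpow_mul_S_inv_mul_mem_iff {M : ℕ} (k : ℤ) (h : SL(2, ℤ)) :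
    (ModularGroup.T ^ k * ModularGroup.S)⁻¹ * h ∈ Gamma0 M ↔ (M : ℤ) ∣ k * h 1 0 - h 0 0 := by
  have h00 : (ModularGroup.T ^ k * ModularGroup.S : SL(2, ℤ)) 0 0 = k := by
    rw [Matrix.SpecialLinearGroup.coe_mul, ModularGroup.coe_T_zpow]
    simp [ModularGroup.S, Matrix.mul_apply, Fin.sum_univ_two]
  have h10 : (ModularGroup.T ^ k * ModularGroup.S : SL(2, ℤ)) 1 0 = 1 := by
    rw [Matrix.SpecialLinearGroup.coe_mul, ModularGroup.coe_T_zpow]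
    simp [ModularGroup.S, Matrix.mul_apply, Fin.sum_univ_two]
  rw [inv_mul_mem_Gamma0_iff, h00, h10, one_mul]

lemma ncard_zeroCosets (M : ℕ) : (zeroCosets M).ncard = M := by
  rw [zeroCosets, ← Set.image_univ, Set.ncard_image_of_injective, Set.ncard_univ, Nat.card_fin]
  intro k l hkl
  have h00 : (ModularGroup.T ^ ((l : ℕ) : ℤ) * ModularGroup.S : SL(2, ℤ)) 0 0 = l := by
    rw [Matrix.SpecialLinearGroup.coe_mul, ModularGroup.coe_T_zpow]
    simp [ModularGroup.S, Matrix.mul_apply, Fin.sum_univ_two]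
  have h10 : (ModularGroup.T ^ ((l : ℕ) : ℤ) * ModularGroup.S : SL(2, ℤ)) 1 0 = 1 := by
    rw [Matrix.SpecialLinearGroup.coe_mul, ModularGroup.coe_T_zpow]
    simp [ModularGroup.S, Matrix.mul_apply, Fin.sum_univ_two]
  have h := QuotientGroup.eq.mp hkl
  rw [T_zpow_mul_S_inv_mul_mem_iff, h00, h10, mul_one] at h
  have h1 := (Int.modEq_iff_dvd.mpr h).eq
  rw [Int.emod_eq_of_lt (by omega) (by exact_mod_cast l.2),
    Int.emod_eq_of_lt (by omega) (by exact_mod_cast k.2)] at h1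
  exact Fin.ext (by exact_mod_cast h1.symm)

/-- The coset of `T^k S` contains `g` if and only if `k g₁₀ ≡ g₀₀` modulo `M`. Since `g₀₀` and `g₁₀`
are coprime, this has a solution `k` exactly if `g₁₀` is a unit modulo `M`. -/
lemma mk_mem_zeroCosets_iff {M : ℕ} [NeZero M] (g : SL(2, ℤ)) :
    (g : SL(2, ℤ) ⧸ Gamma0 M) ∈ zeroCosets M ↔ IsCoprime (g 1 0) (M : ℤ) := by
  constructor
  · rintro ⟨k, hk⟩
    have h := QuotientGroup.eq.mp hk
    rw [T_zpow_mul_S_inv_mul_mem_iff] at h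
    obtain ⟨c, hc⟩ := h
    have hdet := det_eq g
    refine ⟨(k : ℕ) * g 1 1 - g 0 1, -c * g 1 1, ?_⟩
    linear_combination hdet + (g 1 1) * hc
  · rintro ⟨u, v, huv⟩
    have hM : (M : ℤ) ≠ 0 := by exact_mod_cast NeZero.ne M
    set n : ℤ := (u * g 0 0) % M with hn
    have hn0 : 0 ≤ n := Int.emod_nonneg _ hM
    have hn1 : n < M := Int.emod_lt_of_pos _ (by positivity)
    refine ⟨⟨n.toNat, by omega⟩, QuotientGroup.eq.mpr ?_⟩
    rw [T_zpow_mul_S_inv_mul_mem_iff, Int.toNat_of_nonneg hn0, hn,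
      show u * g 0 0 % M = u * g 0 0 - M * (u * g 0 0 / M) from Int.emod_def _ _]
    exact ⟨-(u * g 0 0 / M) * g 1 0 - v * g 0 0, by linear_combination (g 0 0) * huv⟩

namespace IsFormWithZeroAtZero

variable {M : ℕ} {r : ℝ} {v : ℍ → ℂ}

lemma order_of_isCoprime (hv : IsFormWithZeroAtZero M r v) {γ : SL(2, ℤ)}
    (hγ : IsCoprime (γ 1 0) (M : ℤ)) : HasOrder (fun τ => v (γ • τ)) (r - 1) := by
  obtain ⟨g, hg, n, rfl⟩ := exists_eq_mul_S_mul_T hγ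
  simp only [mul_smul, hv.invariant g hg]
  exact hv.order_S.comp_T_zpow n

/-- The norm to level one shows that the number of zeros is the index of `Γ₀(M)`. -/
lemma order_mul_eq [NeZero M] (hv : IsFormWithZeroAtZero M r v) : r * M = (psi M : ℝ) := by
  classical
  have := Fintype.ofFinite (SL(2, ℤ) ⧸ Gamma0 M)
  set w : ℍ → ℂ := fun τ => ∏ q, cosetTranslate hv.invariant q τ with hw
  have hinv : ∀ (γ : SL(2, ℤ)) τ, w (γ • τ) = w τ := by
    intro γ τ
    simp only [hw, cosetTranslate_smul]
    exact Equiv.prod_comp (MulAction.toPerm γ⁻¹) fun q => cosetTranslate hv.invariant q τ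
  have hord : HasOrder w (∑ q, (if q ∈ zeroCosets M then r - 1 else -1 : ℝ)) := by
    refine HasOrder.prod fun q _ => ?_
    induction q using QuotientGroup.induction_on with
    | H g =>
      have h10 : g⁻¹ 1 0 = - g 1 0 := by
        rw [Matrix.SpecialLinearGroup.SL2_inv_expl]; rfl
      simp only [mk_mem_zeroCosets_iff]
      split_ifs with h
      · exact hv.order_of_isCoprime (by rw [h10]; exact h.neg_left)
      · exact hv.order _ (by rw [h10, IsCoprime.neg_left_iff]; exact h)
  have hmd : MDiff w := by
    have h : ∀ q ∈ Finset.univ, MDiff (cosetTranslate hv.invariant q) := by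
      intro q _
      induction q using QuotientGroup.induction_on with
      | H g => exact mdifferentiable_comp_smul hv.mdifferentiable g⁻¹
    have h' := MDifferentiable.prod h
    rwa [Finset.prod_fn] at h'
  have hne : ∀ τ, w τ ≠ 0 := by
    intro τ
    refine Finset.prod_ne_zero_iff.mpr fun q _ => ?_
    induction q using QuotientGroup.induction_on with
    | H g => exact hv.ne_zero _
  -- At level one the only cusp is equivalent to `0`, so the norm is constant whatever its order;
  -- hence the order `M(r - 1) - (index - M)` is zero.
  obtain ⟨c, hc⟩ := eq_const_of_hasOrder (M := 1) hmd hne (fun γ _ => hinv γ)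
    (fun γ hγ => absurd (by rw [Nat.cast_one]; exact isCoprime_one_right) hγ)
    (by simpa only [hinv] using hord)
  have hc0 : c ≠ 0 := hc I ▸ hne I
  have h0 := hord.unique ((HasOrder.const hc0).congr (.of_forall fun τ => (hc τ).symm))
  have h1 : ∀ q : SL(2, ℤ) ⧸ Gamma0 M, (if q ∈ zeroCosets M then r - 1 else -1 : ℝ) =
      (if q ∈ zeroCosets M then r else 0) - 1 := by
    intro q; split_ifs <;> ring
  have h2 : (Finset.univ.filter (· ∈ zeroCosets M)).card = M := by
    rw [← Set.ncard_coe_finset]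
    refine Eq.trans ?_ (ncard_zeroCosets M)
    simp
  simp only [h1, Finset.sum_sub_distrib, ← Finset.sum_filter, Finset.sum_const, h2,
    Finset.card_univ, nsmul_eq_mul, mul_one] at h0
  have h3 := index_Gamma0 (NeZero.ne M)
  rw [Subgroup.index, Nat.card_eq_fintype_card] at h3
  rw [← h3]
  push_cast
  linarith

/-- In the quotient the orders `-1` cancel, so only the cusp `0` can carry a zero or pole and the
quotient is constant; the limits at `i∞` give the constant 1. -/
lemma eq [NeZero M] {r₂ : ℝ} {v₂ : ℍ → ℂ} (hv : IsFormWithZeroAtZero M r v)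
    (hv₂ : IsFormWithZeroAtZero M r₂ v₂) (τ : ℍ) : v τ = v₂ τ := by
  obtain ⟨c, hc⟩ := eq_const_of_hasOrder (M := M) (f := fun τ => v τ / v₂ τ)
    (hv.mdifferentiable.div hv₂.mdifferentiable hv₂.ne_zero)
    (fun τ => div_ne_zero (hv.ne_zero τ) (hv₂.ne_zero τ))
    (fun γ hγ τ => by rw [hv.invariant γ hγ, hv₂.invariant γ hγ])
    (fun γ hγ => by simpa using (hv.order γ hγ).div (hv₂.order γ hγ))
    (hv.order_S.div hv₂.order_S)
  have h1 := hv.tendsto.div hv₂.tendsto one_ne_zero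
  have h2 : Tendsto (fun _ : ℍ => c) atImInfty (𝓝 (1 / 1)) := by
    refine h1.congr fun τ => ?_
    rw [← hc τ]
    exact mul_div_mul_right _ _ (discriminant_ne_zero τ)
  have h3 : c = 1 := by simpa using tendsto_nhds_unique tendsto_const_nhds h2
  have := hc τ
  rwa [h3, div_eq_one_iff_eq (hv₂.ne_zero τ)] at this

end IsFormWithZeroAtZero

end

section

open CongruenceSubgroup ModularForm Manifold

/-! ### Identities on codiscrete sets -/

lemma eventually_codiscrete_iff {p : ℍ → Prop} :
    (∀ᶠ τ in codiscrete ℍ, p τ) ↔ ∀ τ₀, ∀ᶠ τ in 𝓝[≠] τ₀, p τ := by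
  simp [codiscrete, codiscreteWithin, Filter.eventually_iSup, Set.compl_eq_univ_sdiff]

lemma map_coe_nhdsNE (τ₀ : ℍ) : map ((↑) : ℍ → ℂ) (𝓝[≠] τ₀) = 𝓝[≠] (τ₀ : ℂ) := by
  rw [← isOpenEmbedding_coe.map_nhdsWithin_preimage_eq]
  congr 2
  ext τ
  simp

lemma eventually_ofComplex_iff {p : ℍ → Prop} {τ₀ : ℍ} :
    (∀ᶠ z in 𝓝[≠] (τ₀ : ℂ), p (ofComplex z)) ↔ ∀ᶠ τ in 𝓝[≠] τ₀, p τ := by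
  rw [← map_coe_nhdsNE, eventually_map]
  simp

lemma eventually_eq_zero_or_ne_zero {f : ℍ → ℂ}
    (hf : MeromorphicOn (f ∘ ofComplex) upperHalfPlaneSet) :
    (∀ᶠ τ in codiscrete ℍ, f τ = 0) ∨ ∀ᶠ τ in codiscrete ℍ, f τ ≠ 0 := by
  simp only [eventually_codiscrete_iff, ← eventually_ofComplex_iff]
  by_cases h : ∃ τ : ℍ, meromorphicOrderAt (f ∘ ofComplex) τ ≠ ⊤
  · right
    obtain ⟨τ, hτ⟩ := h
    intro τ₀
    have hU : IsPreconnected upperHalfPlaneSet := (convex_halfSpace_im_gt 0).isPreconnected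
    exact (meromorphicOrderAt_ne_top_iff_eventually_ne_zero (hf τ₀ τ₀.im_pos)).mp
      (hf.meromorphicOrderAt_ne_top_of_isPreconnected hU τ.im_pos τ₀.im_pos hτ)
  · push Not at h
    exact .inl fun τ₀ => meromorphicOrderAt_eq_top_iff.mp (h τ₀)

lemma eq_of_eventuallyEq_codiscrete {f g : ℍ → ℂ} (hf : Continuous f) (hg : Continuous g)
    (h : f =ᶠ[codiscrete ℍ] g) : f = g := by
  funext τ
  refine tendsto_nhds_unique_of_eventuallyEq (l := 𝓝[≠] τ) (hf.continuousAt.tendsto.mono_left nhdsWithin_le_nhds)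
    (hg.continuousAt.tendsto.mono_left nhdsWithin_le_nhds) (eventually_codiscrete_iff.mp h τ)

lemma eventually_codiscrete_smul {p : ℍ → Prop} (h : ∀ᶠ τ in codiscrete ℍ, p τ) (γ : SL(2, ℤ)) :
    ∀ᶠ τ in codiscrete ℍ, p (γ • τ) := by
  rw [eventually_codiscrete_iff] at h ⊢
  intro τ₀
  refine (tendsto_nhdsWithin_iff.mpr ⟨?_, ?_⟩ : Tendsto (γ • ·) (𝓝[≠] τ₀) (𝓝[≠] (γ • τ₀))).eventually
    (h (γ • τ₀))
  · exact (mdifferentiable_smul (g := (γ : GL (Fin 2) ℝ)) (by simp)).continuous.continuousAt.tendsto.mono_left nhdsWithin_le_nhds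
  · filter_upwards [self_mem_nhdsWithin] with τ hτ h'
    exact hτ (smul_left_cancel γ h')

lemma eventually_atImInfty_lt_im (A : ℝ) : ∀ᶠ τ in atImInfty, A < τ.im :=
  tendsto_im_atImInfty.eventually_gt_atTop A

lemma exists_of_codiscrete_of_atImInfty {p : ℍ → Prop}
    (h : ∀ᶠ τ in codiscrete ℍ, p τ) {q : ℍ → Prop} (hq : ∀ᶠ τ in atImInfty, q τ) :
    ∃ τ, p τ ∧ q τ := by
  obtain ⟨A, hA⟩ := (atImInfty_mem _).mp hq
  have hpos : 0 < (Complex.I * ((|A| + 1 : ℝ) : ℂ)).im := by simp; positivity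
  set τ₀ : ℍ := ⟨Complex.I * ((|A| + 1 : ℝ) : ℂ), hpos⟩
  have him : A < τ₀.im := by
    change A < (Complex.I * ((|A| + 1 : ℝ) : ℂ)).im
    simp
    linarith [le_abs_self A]
  have h1 := (eventually_codiscrete_iff.mp h τ₀).and
    (nhdsWithin_le_nhds (UpperHalfPlane.continuous_im.continuousAt.eventually
      (lt_mem_nhds him)))
  obtain ⟨τ, h2, h3⟩ := h1.exists
  exact ⟨τ, h2, hA τ h3.le⟩

/-- Along this filter, identities valid off a discrete set and asymptotics at the cusp hold
together, so limits can be compared. -/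
instance codiscrete_inf_atImInfty_neBot : (codiscrete ℍ ⊓ atImInfty).NeBot := by
  rw [inf_neBot_iff]
  intro s hs s' hs'
  exact exists_of_codiscrete_of_atImInfty hs hs'

lemma tendsto_qParam_atImInfty {h : ℝ} (hh : 0 < h) :
    Tendsto (fun τ : ℍ => Function.Periodic.qParam h τ) atImInfty (𝓝[≠] 0) :=
  (Function.Periodic.qParam_tendsto hh).comp tendsto_coe_atImInfty

/-- A cusp expansion of a continuous function that holds off a discrete set holds everywhere near
the cusp. -/
lemma eventually_eq_comp_qParam {f : ℍ → ℂ} (hf : Continuous f) {F : ℂ → ℂ} (hF : MeromorphicAt F 0)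
    {h : ℝ} (hh : 0 < h) {A : ℝ}
    (hfF : ∀ᶠ τ in codiscrete ℍ, A < τ.im → f τ = F (Function.Periodic.qParam h τ)) :
    ∀ᶠ τ in atImInfty, f τ = F (Function.Periodic.qParam h τ) := by
  filter_upwards [(tendsto_qParam_atImInfty hh).eventually hF.eventually_analyticAt,
    eventually_atImInfty_lt_im A] with τ h1 h2
  have h3 : ContinuousAt (fun τ : ℍ => F (Function.Periodic.qParam h τ)) τ :=
    ContinuousAt.comp (f := fun τ : ℍ => Function.Periodic.qParam h τ) h1.continuousAt
      ((Function.Periodic.continuous_qParam).comp continuous_coe).continuousAt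
  refine tendsto_nhds_unique_of_eventuallyEq (l := 𝓝[≠] τ) (hf.continuousAt.tendsto.mono_left nhdsWithin_le_nhds)
    (h3.tendsto.mono_left nhdsWithin_le_nhds) ?_
  filter_upwards [eventually_codiscrete_iff.mp hfF τ, nhdsWithin_le_nhds
    (UpperHalfPlane.continuous_im.continuousAt.eventually (lt_mem_nhds h2))] with σ h4 h5 using h4 h5

/-! ### Rational functions at infinity -/

lemma tendsto_eval_div_of_tendsto_inv {α : Type*} {l : Filter α} {s : α → ℂ} {P Q : ℂ[X]}
    (hs : Tendsto (fun a => (s a)⁻¹) l (𝓝 0)) (hs0 : ∀ᶠ a in l, s a ≠ 0) (hQ : Q ≠ 0)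
    (hPQ : P.natDegree ≤ Q.natDegree) :
    Tendsto (fun a => P.eval (s a) / Q.eval (s a)) l
      (𝓝 (P.coeff Q.natDegree / Q.leadingCoeff)) := by
  set n := Q.natDegree with hn
  have h1 : ∀ R : ℂ[X], Tendsto (fun a => (R.reflect n).eval (s a)⁻¹) l (𝓝 (R.coeff n)) := by
    intro R
    have := (R.reflect n).continuous.continuousAt.tendsto.comp hs
    rwa [← coeff_zero_eq_eval_zero, coeff_reflect, revAt_le (Nat.zero_le n), Nat.sub_zero] at this
  refine ((h1 P).div (h1 Q) (leadingCoeff_ne_zero.mpr hQ)).congr' ?_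
  filter_upwards [hs0] with a ha
  let := invertibleOfNonzero ha
  have h2 := eval₂_reflect_mul_pow (RingHom.id ℂ) (s a) n P hPQ
  have h3 := eval₂_reflect_mul_pow (RingHom.id ℂ) (s a) n Q le_rfl
  rw [invOf_eq_inv] at h2 h3
  simp only [eval, ← h2, ← h3]
  exact (mul_div_mul_right _ _ (pow_ne_zero _ ha)).symm

lemma tendsto_eval_div_inv_of_tendsto_inv {α : Type*} {l : Filter α} {s : α → ℂ} {P Q : ℂ[X]}
    (hs : Tendsto (fun a => (s a)⁻¹) l (𝓝 0)) (hs0 : ∀ᶠ a in l, s a ≠ 0)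
    (hPQ : Q.natDegree < P.natDegree) :
    Tendsto (fun a => (P.eval (s a) / Q.eval (s a))⁻¹) l (𝓝 0) := by
  have := tendsto_eval_div_of_tendsto_inv hs hs0 (ne_zero_of_natDegree_gt hPQ) hPQ.le
  rw [coeff_eq_zero_of_natDegree_lt hPQ, zero_div] at this
  simpa only [inv_div] using this

end

section

open CongruenceSubgroup ModularForm Manifold

/-! ### Modular functions that are holomorphic on `ℍ` -/

/-- A modular function for `Γ₀(N)` without poles on `ℍ`. -/
structure IsHolomorphicModularFunction (N : ℕ) (f : ℍ → ℂ) : Prop where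
  mdifferentiable : MDiff f
  invariant : ∀ γ ∈ Gamma0 N, ∀ τ, f (γ • τ) = f τ
  cusps : ∀ γ : SL(2, ℤ), ∃ F : ℂ → ℂ, MeromorphicAt F 0 ∧
    ∀ᶠ τ in atImInfty, f (γ • τ) = F (Function.Periodic.qParam N τ)

lemma differentiableOn_comp_ofComplex {f : ℍ → ℂ} (hf : MDiff f) :
    DifferentiableOn ℂ (f ∘ ofComplex) upperHalfPlaneSet :=
  UpperHalfPlane.mdifferentiable_iff.mp hf

lemma IsHolomorphicModularFunction.isModularFunction {N : ℕ} {f : ℍ → ℂ}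
    (hf : IsHolomorphicModularFunction N f) : IsModularFunction N f where
  meromorphic := ((differentiableOn_comp_ofComplex hf.mdifferentiable).analyticOnNhd
    isOpen_upperHalfPlaneSet).meromorphicOn
  invariant γ hγ := .of_forall (hf.invariant γ hγ)
  cusps γ := by
    obtain ⟨F, hF, h⟩ := hf.cusps γ
    obtain ⟨A, hA⟩ := (atImInfty_mem _).mp h
    exact ⟨F, hF, A, .of_forall fun τ hτ => hA τ hτ.le⟩

lemma IsHolomorphicModularFunction.of_isModularFunction {N : ℕ} (hN : 0 < N) {f : ℍ → ℂ}
    (hf : IsModularFunction N f) (hmd : MDiff f) : IsHolomorphicModularFunction N f where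
  mdifferentiable := hmd
  invariant γ hγ := congrFun (eq_of_eventuallyEq_codiscrete
    (mdifferentiable_comp_smul hmd γ).continuous hmd.continuous (hf.invariant γ hγ))
  cusps γ := by
    obtain ⟨F, hF, A, h⟩ := hf.cusps γ
    exact ⟨F, hF, eventually_eq_comp_qParam (mdifferentiable_comp_smul hmd γ).continuous hF
      (by exact_mod_cast hN) h⟩

lemma qParam_affine {a d M L m : ℕ} (ha : 0 < a) (hd : 0 < d) (hM : 0 < M) (hL : 0 < L)
    (h : d * M * m = a * L) (b : ℤ) (τ : ℍ) :
    Function.Periodic.qParam M (affine a b d τ) =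
      Complex.exp (2 * Real.pi * Complex.I * b / (d * M)) * Function.Periodic.qParam L τ ^ m := by
  rw [Function.Periodic.qParam, Function.Periodic.qParam, coe_affine ha hd, ← Complex.exp_nat_mul,
    ← Complex.exp_add]
  congr 1
  have h' : (d : ℂ) * M * m = a * L := by exact_mod_cast h
  have hd' : (d : ℂ) ≠ 0 := by exact_mod_cast hd.ne'
  have hM' : (M : ℂ) ≠ 0 := by exact_mod_cast hM.ne'
  have hL' : (L : ℂ) ≠ 0 := by exact_mod_cast hL.ne'
  push_cast
  field_simp
  linear_combination -(τ : ℂ) * h'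

/-- Oldforms. -/
lemma IsHolomorphicModularFunction.comp_scale {M L e : ℕ} {f : ℍ → ℂ}
    (hf : IsHolomorphicModularFunction M f) (he : 0 < e) (hL : 0 < L) (heL : e * M ∣ L) :
    IsHolomorphicModularFunction L (fun τ => f (scale e τ)) where
  mdifferentiable := mdifferentiable_comp_scale hf.mdifferentiable he
  invariant γ hγ τ := by
    obtain ⟨γ', hγ', h, -⟩ := exists_scale_smul_of_mem_Gamma0 he heL hγ
    rw [h, hf.invariant γ' hγ']
  cusps γ := by
    obtain ⟨γ', b, d, hd, hde, h, -⟩ := exists_scale_smul he γ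
    have ha : 0 < Int.gcd (γ 1 0) e := Int.gcd_pos_of_ne_zero_right _ (by exact_mod_cast he.ne')
    generalize Int.gcd (γ 1 0) e = a at *
    have hM : 0 < M := Nat.pos_of_ne_zero (by rintro rfl; simp at heL; omega)
    obtain ⟨k, hk⟩ := heL
    obtain ⟨F, hF, hfF⟩ := hf.cusps γ'
    -- The local parameter of level `M` at `(aτ + b)/d` is a root of unity times the power `aL/(dM)
    -- = a²k` of the one of level `L`.
    have hm : d * M * (a * a * k) = a * L := by rw [hk, ← hde]; ring
    have hm0 : a * a * k ≠ 0 := by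
      rintro h0
      rw [h0, mul_zero] at hm
      exact (Nat.mul_pos ha hL).ne hm
    refine ⟨fun q => F (Complex.exp (2 * Real.pi * Complex.I * b / (d * M)) * q ^ (a * a * k)),
      ?_, ?_⟩
    · refine MeromorphicAt.comp_analyticAt (f := F) (by simpa [hm0] using hF) (by fun_prop)
    · have hT := tendsto_affine ha hd b
      filter_upwards [hT.eventually hfF] with τ hτ
      rw [h, hτ, qParam_affine ha hd hM hL hm]

/-- The expansion of a periodic function that is regular at `i∞`. -/
lemma exists_eq_comp_qParam {f : ℍ → ℂ} (hf : MDiff f)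
    (hT : ∀ τ, f (ModularGroup.T • τ) = f τ) {c : ℂ} (hc : Tendsto f atImInfty (𝓝 c)) :
    ∃ F : ℂ → ℂ, AnalyticAt ℂ F 0 ∧ F 0 = c ∧ ∀ τ, f τ = F (Function.Periodic.qParam 1 τ) := by
  have hper := periodic_comp_ofComplex_of_T hT
  have han := analyticAt_cuspFunction_zero one_pos hper hf (isBoundedAtImInfty_of_tendsto hc)
  have heq : ∀ τ : ℍ, f τ = cuspFunction 1 f (Function.Periodic.qParam 1 τ) := by
    intro τ
    have := Function.Periodic.eq_cuspFunction one_ne_zero hper τ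
    rw [Function.comp_apply, ofComplex_apply] at this
    exact this.symm
  refine ⟨cuspFunction 1 f, han, ?_, heq⟩
  refine tendsto_nhds_unique ((han.continuousAt.tendsto.mono_left nhdsWithin_le_nhds).comp
    (tendsto_qParam_atImInfty one_pos)) (hc.congr heq)

lemma isHolomorphicModularFunction_jInv : IsHolomorphicModularFunction 1 jInv where
  mdifferentiable := mdifferentiable_jInv
  invariant γ _ := jInv_smul γ
  cusps γ := by
    have hT : ∀ τ, discriminant (ModularGroup.T • τ) = discriminant τ := by
      intro τ
      have := autFactor_T_zpow 1 τ
      rw [zpow_one] at this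
      rw [discriminant_smul, this, one_pow, one_mul]
    obtain ⟨F, hF, -, hFE⟩ := exists_eq_comp_qParam mdifferentiable_E₄ (levelOne_T E₄) tendsto_E₄
    obtain ⟨G, hG, -, hGD⟩ := exists_eq_comp_qParam mdifferentiable_discriminant hT
      (hasOrder_discriminant.tendsto_zero one_pos)
    refine ⟨fun q => F q ^ 3 / G q, (hF.meromorphicAt.fun_pow 3).fun_div hG.meromorphicAt,
      .of_forall fun τ => ?_⟩
    rw [jInv_smul, jInv, hFE, hGD, Nat.cast_one]

lemma isHolomorphicModularFunction_jInv_scale {e N : ℕ} (hN : 0 < N) (he : e ∣ N) :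
    IsHolomorphicModularFunction N (fun τ => jInv (scale e τ)) :=
  isHolomorphicModularFunction_jInv.comp_scale (Nat.pos_of_dvd_of_pos he hN) hN (by simpa using he)

lemma isHolomorphicModularFunction_jInv_level {N : ℕ} (hN : 0 < N) :
    IsHolomorphicModularFunction N jInv := by
  simpa using isHolomorphicModularFunction_jInv_scale hN (one_dvd N)

lemma jInv_ne_const (c : ℂ) : ∀ᶠ τ in codiscrete ℍ, jInv τ ≠ c := by
  have hm := (isHolomorphicModularFunction_jInv.isModularFunction.meromorphic).fun_sub
    (fun z _ => MeromorphicAt.const c z)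
  rcases eventually_eq_zero_or_ne_zero (f := fun τ => jInv τ - c) hm with h | h
  · have h1 := eq_of_eventuallyEq_codiscrete (g := fun _ => c) mdifferentiable_jInv.continuous
      continuous_const (h.mono fun τ hτ => sub_eq_zero.mp hτ)
    exact absurd (h1 ▸ tendsto_const_nhds) (hasOrder_jInv.not_tendsto (by norm_num) c)
  · exact h.mono fun τ hτ => sub_ne_zero.mp hτ

/-! ### Hauptmoduln -/

namespace IsHauptmodul

variable {N : ℕ} {t : ℍ → ℂ}

lemma eventually_ne (ht : IsHauptmodul N t) (hN : 0 < N) (c : ℂ) :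
    ∀ᶠ τ in codiscrete ℍ, t τ ≠ c := by
  have hm := ht.isModularFunction.meromorphic.fun_sub (fun z _ => MeromorphicAt.const c z)
  rcases eventually_eq_zero_or_ne_zero (f := fun τ => t τ - c) hm with h | h
  · obtain ⟨P, Q, -, hPQ⟩ := ht.generates jInv
      (isHolomorphicModularFunction_jInv_level hN).isModularFunction
    have : ∀ᶠ τ in codiscrete ℍ, jInv τ = P.eval c / Q.eval c := by
      filter_upwards [h, hPQ] with τ h1 h2
      rw [h2, sub_eq_zero.mp h1]
    obtain ⟨τ, h1, h2⟩ := (exists_of_codiscrete_of_atImInfty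
      (this.and (jInv_ne_const _)) (.of_forall fun _ => trivial))
    exact absurd h1.1 h1.2
  · exact h.mono fun τ hτ => sub_ne_zero.mp hτ

lemma eventually_eval_ne_zero (ht : IsHauptmodul N t) (hN : 0 < N) {Q : ℂ[X]} (hQ : Q ≠ 0) :
    ∀ᶠ τ in codiscrete ℍ, Q.eval (t τ) ≠ 0 := by
  have : ∀ᶠ τ in codiscrete ℍ, ∀ c ∈ Q.roots.toFinset, t τ ≠ c :=
    (Filter.eventually_all_finset _).mpr fun c _ => ht.eventually_ne hN c
  filter_upwards [this] with τ hτ h0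
  exact hτ (t τ) (by simp [hQ, h0]) rfl

lemma congr (ht : IsHauptmodul N t) {s : ℍ → ℂ} (h : t =ᶠ[codiscrete ℍ] s) : IsHauptmodul N s where
  isModularFunction :=
    { meromorphic := by
        intro z hz
        refine (ht.isModularFunction.meromorphic z hz).congr ?_
        exact (eventually_ofComplex_iff (τ₀ := ⟨z, hz⟩)).mpr
          (eventually_codiscrete_iff.mp h ⟨z, hz⟩)
      invariant := fun γ hγ => by
        filter_upwards [h, eventually_codiscrete_smul h γ, ht.isModularFunction.invariant γ hγ]
          with τ h1 h2 h3
        rw [← h1, ← h2, h3]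
      cusps := fun γ => by
        obtain ⟨F, hF, A, h1⟩ := ht.isModularFunction.cusps γ
        refine ⟨F, hF, A, ?_⟩
        filter_upwards [h1, eventually_codiscrete_smul h γ] with τ h2 h3
        rwa [← h3] }
  generates f hf := by
    obtain ⟨P, Q, hQ, h1⟩ := ht.generates f hf
    refine ⟨P, Q, hQ, ?_⟩
    filter_upwards [h, h1] with τ h2 h3
    rwa [← h2]

lemma comp_mul_add (ht : IsHauptmodul N t) {a : ℂ} (ha : a ≠ 0) (b : ℂ) :
    IsHauptmodul N (fun τ => a * t τ + b) where
  isModularFunction :=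
    { meromorphic := by
        intro z hz
        have := ht.isModularFunction.meromorphic z hz
        exact ((MeromorphicAt.const a z).fun_mul this).fun_add (MeromorphicAt.const b z)
      invariant := fun γ hγ => by
        filter_upwards [ht.isModularFunction.invariant γ hγ] with τ h
        rw [h]
      cusps := fun γ => by
        obtain ⟨F, hF, A, h⟩ := ht.isModularFunction.cusps γ
        refine ⟨fun q => a * F q + b,
          ((MeromorphicAt.const a 0).fun_mul hF).fun_add (MeromorphicAt.const b 0), A, ?_⟩
        filter_upwards [h] with τ h1 h2
        rw [h1 h2] }
  generates f hf := by
    obtain ⟨P, Q, hQ, h1⟩ := ht.generates f hf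
    have h2 : (C a⁻¹ * (X - C b)).natDegree = 1 := by
      rw [natDegree_C_mul (inv_ne_zero ha), natDegree_X_sub_C]
    refine ⟨P.comp (C a⁻¹ * (X - C b)), Q.comp (C a⁻¹ * (X - C b)), ?_, ?_⟩
    · rw [Ne, comp_eq_zero_iff]
      rintro (h | ⟨-, h⟩)
      · exact hQ h
      · rw [h, natDegree_C] at h2; omega
    · filter_upwards [h1] with τ h3
      rw [h3]
      simp [eval_comp, ha]

lemma inv_sub (ht : IsHauptmodul N t) (hN : 0 < N) (c : ℂ) :
    IsHauptmodul N (fun τ => (t τ - c)⁻¹) where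
  isModularFunction :=
    { meromorphic := by
        intro z hz
        have := ht.isModularFunction.meromorphic z hz
        exact (this.fun_sub (MeromorphicAt.const c z)).fun_inv
      invariant := fun γ hγ => by
        filter_upwards [ht.isModularFunction.invariant γ hγ] with τ h
        rw [h]
      cusps := fun γ => by
        obtain ⟨F, hF, A, h⟩ := ht.isModularFunction.cusps γ
        refine ⟨fun q => (F q - c)⁻¹, (hF.fun_sub (MeromorphicAt.const c 0)).fun_inv, A, ?_⟩
        filter_upwards [h] with τ h1 h2
        rw [h1 h2] }
  generates f hf := by
    obtain ⟨P, Q, hQ, h1⟩ := ht.generates f hf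
    have hQ' : Q.comp (X + C c) ≠ 0 := by
      rw [Ne, comp_eq_zero_iff]
      rintro (h | ⟨-, h⟩)
      · exact hQ h
      · have := natDegree_X_add_C c
        rw [h, natDegree_C] at this; omega
    -- With `u = (t - c)⁻¹`, each `R(t)` is the reversal of `R(X + c)` at `u` times `u ^ (-deg R)`;
    -- the crossed powers of `X` clear these negative exponents.
    refine ⟨(P.comp (X + C c)).reverse * X ^ Q.natDegree,
      (Q.comp (X + C c)).reverse * X ^ P.natDegree,
      mul_ne_zero (by simpa using hQ') (pow_ne_zero _ X_ne_zero), ?_⟩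
    filter_upwards [h1, ht.eventually_ne hN c] with τ h2 h3
    have h4 := sub_ne_zero.mpr h3
    have key : ∀ R : ℂ[X], R.eval (t τ) =
        (R.comp (X + C c)).reverse.eval (t τ - c)⁻¹ * (t τ - c) ^ R.natDegree := by
      intro R
      let := invertibleOfNonzero h4
      have := eval₂_reverse_mul_pow (RingHom.id ℂ) (t τ - c) (R.comp (X + C c))
      rw [invOf_eq_inv, natDegree_comp, natDegree_X_add_C, mul_one] at this
      change _ = eval _ _ at this
      simp only [eval_comp, eval_add, eval_X, eval_C, sub_add_cancel] at this
      exact this.symm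
    rw [h2, key P, key Q]
    simp only [eval_mul, eval_pow, eval_X, inv_pow]
    generalize (P.comp (X + C c)).reverse.eval (t τ - c)⁻¹ = p
    generalize (Q.comp (X + C c)).reverse.eval (t τ - c)⁻¹ = q
    by_cases hq : q = 0
    · simp [hq]
    · field_simp

end IsHauptmodul

end

section

open CongruenceSubgroup ModularForm Manifold

/-! ### A Hauptmodul whose only pole is at the cusp `0` -/

/-- `t` has a pole at the cusp `0`. -/
def HasPoleAtZero (N : ℕ) (t : ℍ → ℂ) : Prop :=
  ∃ F : ℂ → ℂ, MeromorphicAt F 0 ∧ meromorphicOrderAt F 0 < 0 ∧ ∃ A : ℝ,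
    ∀ᶠ τ in codiscrete ℍ, A < τ.im → t (ModularGroup.S • τ) = F (Function.Periodic.qParam N τ)

/-- If a generator `t` takes a finite value `c` at the cusp `0`, then `(t - c)⁻¹` is a generator
with a pole there. -/
lemma exists_isHauptmodul_hasPoleAtZero {N : ℕ} (hN : 0 < N) (h : GenusZero N) :
    ∃ t, IsHauptmodul N t ∧ HasPoleAtZero N t := by
  obtain ⟨t, ht⟩ := h
  obtain ⟨F, hF, A, hA⟩ := ht.isModularFunction.cusps ModularGroup.S
  by_cases hneg : meromorphicOrderAt F 0 < 0
  · exact ⟨t, ht, F, hF, hneg, A, hA⟩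
  obtain ⟨c, hc⟩ := tendsto_nhds_of_meromorphicOrderAt_nonneg hF (not_lt.mp hneg)
  have hFc : MeromorphicAt (fun q => F q - c) 0 := hF.fun_sub (MeromorphicAt.const c 0)
  have hpos : 0 < meromorphicOrderAt (fun q => F q - c) 0 :=
    (tendsto_zero_iff_meromorphicOrderAt_pos hFc).mp (by simpa using hc.sub_const c)
  have htop : meromorphicOrderAt (fun q => F q - c) 0 ≠ ⊤ := by
    intro h
    have h1 := (tendsto_qParam_atImInfty (h := N) (by exact_mod_cast hN)).eventually
      (meromorphicOrderAt_eq_top_iff.mp h)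
    obtain ⟨τ, ⟨h2, h3⟩, h4, h5⟩ := exists_of_codiscrete_of_atImInfty
      (hA.and (eventually_codiscrete_smul (ht.eventually_ne hN c) ModularGroup.S))
      (h1.and (eventually_atImInfty_lt_im A))
    rw [h2 h5] at h3
    exact h3 (sub_eq_zero.mp h4)
  refine ⟨_, ht.inv_sub hN c, fun q => (F q - c)⁻¹, hFc.fun_inv, ?_, A, ?_⟩
  · rw [fun_meromorphicOrderAt_inv]
    lift meromorphicOrderAt (fun q => F q - c) 0 to ℤ using htop with n
    have : 0 < n := by exact_mod_cast hpos
    have : -n < 0 := by omega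
    exact_mod_cast this
  · filter_upwards [hA] with τ h1 h2
    rw [h1 h2]

lemma tendsto_inv_of_cobounded {α : Type*} {l : Filter α} {s : α → ℂ}
    (h : Tendsto s l (Bornology.cobounded ℂ)) :
    Tendsto (fun a => (s a)⁻¹) l (𝓝 0) ∧ ∀ᶠ a in l, s a ≠ 0 :=
  ⟨tendsto_inv₀_cobounded.comp h, h.eventually (Bornology.eventually_ne_cobounded 0)⟩

lemma not_tendsto_of_tendsto_inv {α : Type*} {l : Filter α} [l.NeBot] {f : α → ℂ}
    (h : Tendsto (fun a => (f a)⁻¹) l (𝓝 0)) (h0 : ∀ᶠ a in l, f a ≠ 0) (c : ℂ) :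
    ¬ Tendsto f l (𝓝 c) := by
  intro h1
  have h2 : Tendsto (fun a => f a * (f a)⁻¹) l (𝓝 1) :=
    tendsto_const_nhds.congr' (by filter_upwards [h0] with a ha using (mul_inv_cancel₀ ha).symm)
  simpa using tendsto_nhds_unique h2 (h1.mul h)

section

variable {N : ℕ} {t : ℍ → ℂ}

/-- At the cusp `0` both `t` and `j` have poles, so `P/Q` has a pole at infinity. -/
lemma HasPoleAtZero.natDegree_lt (ht : HasPoleAtZero N t) (hN : 0 < N) {P Q : ℂ[X]} (hQ : Q ≠ 0)
    (hj : ∀ᶠ τ in codiscrete ℍ, jInv τ = P.eval (t τ) / Q.eval (t τ)) :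
    Q.natDegree < P.natDegree := by
  by_contra hle
  obtain ⟨F, hF, hneg, A, hA⟩ := ht
  have h1 : Tendsto (fun τ => t (ModularGroup.S • τ)) (codiscrete ℍ ⊓ atImInfty)
      (Bornology.cobounded ℂ) := by
    refine (((tendsto_cobounded_of_meromorphicOrderAt_neg hneg).comp (tendsto_qParam_atImInfty
      (h := N) (by exact_mod_cast hN))).mono_left inf_le_right).congr' ?_
    filter_upwards [(show codiscrete ℍ ⊓ atImInfty ≤ codiscrete ℍ from inf_le_left) hA,
      (show codiscrete ℍ ⊓ atImInfty ≤ atImInfty from inf_le_right)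
        (eventually_atImInfty_lt_im A)] with τ h2 h3 using (h2 h3).symm
  obtain ⟨h2, h3⟩ := tendsto_inv_of_cobounded h1
  have h4 := tendsto_eval_div_of_tendsto_inv h2 h3 hQ (not_lt.mp hle)
  refine not_tendsto_of_tendsto_inv (l := codiscrete ℍ ⊓ atImInfty)
    ((hasOrder_jInv.tendsto_inv (by norm_num)).mono_left inf_le_right)
    (hasOrder_jInv.eventually_ne.filter_mono inf_le_right) _ (h4.congr' ?_)
  filter_upwards [(show codiscrete ℍ ⊓ atImInfty ≤ codiscrete ℍ from inf_le_left)
    (eventually_codiscrete_smul hj ModularGroup.S)] with τ h5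
  rw [← h5, jInv_smul]

/-- Since `P/Q` has a pole at infinity, a pole of `t` in `ℍ` would be a pole of `j`, which is
holomorphic there. -/
lemma IsHauptmodul.meromorphicOrderAt_nonneg (ht : IsHauptmodul N t) (h0 : HasPoleAtZero N t)
    (hN : 0 < N) (τ : ℍ) : 0 ≤ meromorphicOrderAt (t ∘ ofComplex) τ := by
  by_contra hneg
  have h1 : Tendsto t (𝓝[≠] τ) (Bornology.cobounded ℂ) := by
    have := tendsto_cobounded_of_meromorphicOrderAt_neg (not_le.mp hneg)
    rw [← map_coe_nhdsNE, tendsto_map'_iff] at this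
    refine this.congr fun σ => ?_
    simp
  obtain ⟨h2, h3⟩ := tendsto_inv_of_cobounded h1
  obtain ⟨P, Q, hQ, hj⟩ := ht.generates jInv
    (isHolomorphicModularFunction_jInv_level hN).isModularFunction
  have h4 := tendsto_eval_div_inv_of_tendsto_inv h2 h3 (h0.natDegree_lt hN hQ hj)
  refine not_tendsto_of_tendsto_inv (l := 𝓝[≠] τ) (h4.congr' ?_)
    (eventually_codiscrete_iff.mp (jInv_ne_const 0) τ) _
    (mdifferentiable_jInv.continuous.continuousAt.tendsto.mono_left nhdsWithin_le_nhds)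
  filter_upwards [eventually_codiscrete_iff.mp hj τ] with σ hσ
  rw [hσ]

lemma IsHauptmodul.exists_holomorphic (ht : IsHauptmodul N t) (h0 : HasPoleAtZero N t)
    (hN : 0 < N) : ∃ s, IsHauptmodul N s ∧ IsHolomorphicModularFunction N s ∧
      ∃ a < 0, HasOrder (fun τ => s (ModularGroup.S • τ)) a := by
  have hm := ht.isModularFunction.meromorphic
  set g := toMeromorphicNFOn (t ∘ ofComplex) upperHalfPlaneSet with hg
  have hts : t =ᶠ[codiscrete ℍ] fun τ => g τ := by
    refine eventually_codiscrete_iff.mpr fun τ₀ => ?_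
    have h1 := hm.toMeromorphicNFOn_eq_self_on_nhdsNE τ₀.im_pos
    rw [← map_coe_nhdsNE, EventuallyEq, eventually_map] at h1
    filter_upwards [h1] with τ hτ
    rw [hg, hτ]
    simp
  have hmd : MDiff (fun τ : ℍ => g τ) := by
    rw [UpperHalfPlane.mdifferentiable_iff]
    have h1 : DifferentiableOn ℂ g {z | 0 < z.im} := by
      intro z hz
      have h2 := (meromorphicNFOn_toMeromorphicNFOn (t ∘ ofComplex) upperHalfPlaneSet) hz
      refine (h2.meromorphicOrderAt_nonneg_iff_analyticAt.mp ?_).differentiableAt.differentiableWithinAt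
      rw [meromorphicOrderAt_toMeromorphicNFOn hm hz]
      exact ht.meromorphicOrderAt_nonneg h0 hN ⟨z, hz⟩
    refine h1.congr fun z hz => ?_
    simp [ofComplex_apply_of_im_pos hz]
  have hs := ht.congr hts
  refine ⟨_, hs, .of_isModularFunction hN hs.isModularFunction hmd, ?_⟩
  obtain ⟨F, hF, hneg, A, hA⟩ := h0
  have h2 := eventually_eq_comp_qParam (A := A) (mdifferentiable_comp_smul hmd ModularGroup.S).continuous
    hF (h := N) (by exact_mod_cast hN) (by
      filter_upwards [hA, eventually_codiscrete_smul hts ModularGroup.S] with τ h3 h4 h5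
      rw [← h4, h3 h5])
  obtain ⟨n, hn⟩ := WithTop.ne_top_iff_exists.mp hneg.ne_top
  have hn0 : n < 0 := by rw [← hn] at hneg; exact_mod_cast hneg
  have hN' : (0 : ℝ) < N := by exact_mod_cast hN
  refine ⟨n / N, div_neg_of_neg_of_pos (by exact_mod_cast hn0) hN', ?_⟩
  exact (HasOrder.of_meromorphic hF hn.symm hN').congr (h2.mono fun τ hτ => hτ.symm)

/-! ### Expressing modular functions by a Hauptmodul in lowest terms -/

lemma IsHauptmodul.exists_isLowestTerms (ht : IsHauptmodul N t) (hmd : MDiff t) (hN : 0 < N)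
    {f : ℍ → ℂ} (hf : IsHolomorphicModularFunction N f) : ∃ P Q, IsLowestTerms f t P Q := by
  classical
  obtain ⟨P, Q, hQ, hPQ⟩ := ht.generates f hf.isModularFunction
  obtain ⟨P', hP'⟩ := EuclideanDomain.gcd_dvd_left P Q
  obtain ⟨Q', hQ'⟩ := EuclideanDomain.gcd_dvd_right P Q
  have hcop : IsCoprime P' Q' := by
    have hg : EuclideanDomain.gcd P Q ≠ 0 := fun h => hQ (by rw [hQ', h, zero_mul])
    have h1 := EuclideanDomain.gcd_eq_gcd_ab P Q
    refine ⟨EuclideanDomain.gcdA P Q, EuclideanDomain.gcdB P Q, mul_left_cancel₀ hg ?_⟩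
    rw [mul_one]
    linear_combination -EuclideanDomain.gcdA P Q * hP' - EuclideanDomain.gcdB P Q * hQ' - h1
  have hev : ∀ τ, f τ * Q'.eval (t τ) = P'.eval (t τ) := by
    refine congrFun (eq_of_eventuallyEq_codiscrete
      (hf.mdifferentiable.continuous.mul (Q'.continuous.comp hmd.continuous))
      (P'.continuous.comp hmd.continuous) ?_)
    filter_upwards [hPQ, ht.eventually_eval_ne_zero hN hQ] with τ h1 h2
    rw [h1]
    rw [hQ', eval_mul] at h2
    rw [congrArg (eval (t τ)) hP', congrArg (eval (t τ)) hQ', eval_mul, eval_mul]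
    have := left_ne_zero_of_mul h2
    have := right_ne_zero_of_mul h2
    field_simp
  have hne : ∀ τ, Q'.eval (t τ) ≠ 0 := by
    intro τ h0
    have h1 := hev τ
    rw [h0, mul_zero] at h1
    obtain ⟨u, v, huv⟩ := hcop
    have := congrArg (eval (t τ)) huv
    simp [h0, ← h1] at this
  exact ⟨P', Q', hcop, hne, fun τ => by rw [← hev τ, mul_div_cancel_right₀ _ (hne τ)]⟩

/-! ### Behaviour at the cusps -/

lemma IsHolomorphicModularFunction.exists_hasOrder_or_tendsto {f : ℍ → ℂ}
    (hf : IsHolomorphicModularFunction N f) (hN : 0 < N) (γ : SL(2, ℤ)) :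
    (∃ a < 0, HasOrder (fun τ => f (γ • τ)) a) ∨
      ∃ c, Tendsto (fun τ => f (γ • τ)) atImInfty (𝓝 c) := by
  obtain ⟨F, hF, h⟩ := hf.cusps γ
  have hN' : (0 : ℝ) < N := by exact_mod_cast hN
  by_cases hneg : meromorphicOrderAt F 0 < 0
  · left
    obtain ⟨n, hn⟩ := WithTop.ne_top_iff_exists.mp hneg.ne_top
    have hn0 : n < 0 := by rw [← hn] at hneg; exact_mod_cast hneg
    exact ⟨n / N, div_neg_of_neg_of_pos (by exact_mod_cast hn0) hN',
      (HasOrder.of_meromorphic hF hn.symm hN').congr (h.mono fun τ hτ => hτ.symm)⟩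
  · right
    obtain ⟨c, hc⟩ := tendsto_nhds_of_meromorphicOrderAt_nonneg hF (not_lt.mp hneg)
    exact ⟨c, (hc.comp (tendsto_qParam_atImInfty hN')).congr' (h.mono fun τ hτ => hτ.symm)⟩

lemma IsLowestTerms.ne_zero {f : ℍ → ℂ} {P Q : ℂ[X]} (h : IsLowestTerms f t P Q) : Q ≠ 0 := by
  rintro rfl
  exact h.denom_ne_zero I (by simp)

lemma IsLowestTerms.num_ne_zero {f : ℍ → ℂ} {P Q : ℂ[X]} (h : IsLowestTerms f t P Q) {τ : ℍ}
    (hf : f τ ≠ 0) : P ≠ 0 := by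
  rintro rfl
  exact hf (by rw [h.eq_div]; simp)

/-- A pole of `t` at the cusp `γ(i∞)`, for the covering map to `e τ`. -/
lemma IsLowestTerms.gcd_sq_eq {e : ℕ} (he : 0 < e) {P Q : ℂ[X]}
    (h : IsLowestTerms (fun τ => jInv (scale e τ)) t P Q) {γ : SL(2, ℤ)} {a : ℝ} (ha : a < 0)
    (hγ : HasOrder (fun τ => t (γ • τ)) a) :
    -(Int.gcd (γ 1 0) e : ℝ) ^ 2 / e = ((P.natDegree : ℝ) - Q.natDegree) * a := by
  have h1 := hasOrder_jInv_scale_smul he γ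
  obtain ⟨τ, hτ⟩ := h1.eventually_ne.exists
  exact hγ.eq_of_eval_div_of_neg ha (h.num_ne_zero hτ) h.ne_zero h1
    (.of_forall fun τ => h.eq_div (γ • τ))

/-- The cusp `0` is the only pole. -/
lemma IsHauptmodul.exists_tendsto (ht : IsHauptmodul N t)
    (hh : IsHolomorphicModularFunction N t) (hN : 0 < N) {a : ℝ} (ha : a < 0)
    (hS : HasOrder (fun τ => t (ModularGroup.S • τ)) a) {γ : SL(2, ℤ)}
    (hγ : ¬ IsCoprime (γ 1 0) (N : ℤ)) : ∃ c, Tendsto (fun τ => t (γ • τ)) atImInfty (𝓝 c) := by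
  refine (hh.exists_hasOrder_or_tendsto hN γ).resolve_left ?_
  rintro ⟨b, hb, hord⟩
  have hS10 : ModularGroup.S 1 0 = 1 := by simp [ModularGroup.S]
  -- Let `δ`, `δ'` be the degree differences for `j(τ)` and `j(Nτ)`. The cusp `0` gives `-1 = δa`
  -- and `-1/N = δ'a`; a pole at `γ(i∞)` gives `-1 = δb` and `-gcd²/N = δ'b`. So `b = a` and the gcd
  -- is 1.
  obtain ⟨P, Q, hPQ⟩ := ht.exists_isLowestTerms hh.mdifferentiable hN
    (isHolomorphicModularFunction_jInv_scale hN (one_dvd N))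
  obtain ⟨P', Q', hPQ'⟩ := ht.exists_isLowestTerms hh.mdifferentiable hN
    (isHolomorphicModularFunction_jInv_scale hN dvd_rfl)
  have h1 := hPQ.gcd_sq_eq one_pos ha hS
  have h2 := hPQ'.gcd_sq_eq hN ha hS
  have h3 := hPQ.gcd_sq_eq one_pos hb hord
  have h4 := hPQ'.gcd_sq_eq hN hb hord
  have hN' : (0 : ℝ) < N := by exact_mod_cast hN
  rw [hS10] at h1 h2
  simp only [Int.gcd_one, Int.one_gcd, Nat.cast_one, one_pow, div_one] at h1 h2 h3
  have hba : b = a := by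
    have : ((P.natDegree : ℝ) - Q.natDegree) * (a - b) = 0 := by linarith
    rcases mul_eq_zero.mp this with h | h
    · rw [h, zero_mul] at h1; norm_num at h1
    · linarith
  rw [hba, ← h2] at h4
  have h5 : ((Int.gcd (γ 1 0) N : ℕ) : ℝ) ^ 2 = 1 := by
    field_simp at h4
    linarith
  have h6 : Int.gcd (γ 1 0) N = 1 := by
    have : (Int.gcd (γ 1 0) N) ^ 2 = 1 := by exact_mod_cast h5
    exact (Nat.pow_eq_one.mp this).resolve_right (by norm_num)
  exact hγ (Int.isCoprime_iff_gcd_eq_one.mpr h6)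

end

end

section

open CongruenceSubgroup ModularForm Manifold

/-! ### Existence of the canonical Hauptmodul -/

lemma coe_fricke {N : ℕ} (hN : 0 < N) (τ : ℍ) : (fricke N τ : ℂ) = -1 / (N * τ) := by
  have h1 : (-1 / (N * τ) : ℂ) = ((ModularGroup.S • scale N τ : ℍ) : ℂ) := by
    rw [coe_S_smul, coe_scale hN]
  rw [fricke, h1, ofComplex_apply]

lemma fricke_eq {N : ℕ} (hN : 0 < N) (τ : ℍ) : fricke N τ = ModularGroup.S • scale N τ := by
  ext
  rw [coe_fricke hN, coe_S_smul, coe_scale hN]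

lemma scale_fricke {N : ℕ} (hN : 0 < N) (τ : ℍ) : scale N (fricke N τ) = ModularGroup.S • τ := by
  ext
  have h1 : (N : ℂ) ≠ 0 := by exact_mod_cast hN.ne'
  have h2 := ne_zero τ
  rw [coe_scale hN, coe_fricke hN, coe_S_smul]
  field_simp

lemma S_smul_eq_fricke {N : ℕ} (hN : 0 < N) (τ : ℍ) :
    ModularGroup.S • τ = fricke N (affine 1 0 N τ) := by
  ext
  have h1 : (N : ℂ) ≠ 0 := by exact_mod_cast hN.ne'
  have h2 := ne_zero τ
  rw [coe_fricke hN, coe_affine one_pos hN, coe_S_smul]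
  push_cast
  rw [one_mul, add_zero, mul_div_cancel₀ _ h1]

lemma qParam_scale {N : ℕ} (hN : 0 < N) (τ : ℍ) :
    Function.Periodic.qParam N (scale N τ) = Function.Periodic.qParam 1 τ := by
  have h1 : (N : ℂ) ≠ 0 := by exact_mod_cast hN.ne'
  rw [Function.Periodic.qParam, Function.Periodic.qParam, coe_scale hN]
  congr 1
  push_cast
  field_simp

lemma T_mem_Gamma0 (N : ℕ) : ModularGroup.T ∈ Gamma0 N := by
  rw [Gamma0_mem]; simp [ModularGroup.T]

lemma not_isCoprime_zero {N : ℕ} (hN : 2 ≤ N) :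
    ¬ IsCoprime ((1 : SL(2, ℤ)) 1 0) (N : ℤ) := by
  have : (1 : SL(2, ℤ)) 1 0 = 0 := rfl
  rw [this, isCoprime_zero_left, Int.isUnit_iff]
  omega

variable {N : ℕ} {t : ℍ → ℂ}

/-- The order at `i∞` of any nonzero rational function of `t` is a multiple of that of `t`, and `j`
has order `-1`. -/
lemma IsHauptmodul.simple_zero (ht : IsHauptmodul N t) (hh : IsHolomorphicModularFunction N t)
    (hN : 0 < N) (h0 : Tendsto t atImInfty (𝓝 0)) : ∃ F : ℂ → ℂ, AnalyticAt ℂ F 0 ∧ F 0 = 0 ∧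
      deriv F 0 ≠ 0 ∧ ∀ᶠ τ in atImInfty, t τ = F (Function.Periodic.qParam 1 τ) := by
  obtain ⟨F, hF, hF0, hFt⟩ := exists_eq_comp_qParam hh.mdifferentiable
    (hh.invariant _ (T_mem_Gamma0 N)) h0
  have htop : meromorphicOrderAt F 0 ≠ ⊤ := by
    intro h
    obtain ⟨τ, h2, h3⟩ := exists_of_codiscrete_of_atImInfty (ht.eventually_ne hN 0)
      ((tendsto_qParam_atImInfty one_pos).eventually (meromorphicOrderAt_eq_top_iff.mp h))
    exact h2 ((hFt τ).trans h3)
  have hpos : 0 < meromorphicOrderAt F 0 := by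
    have := hF.continuousAt.tendsto
    rw [hF0] at this
    exact (tendsto_zero_iff_meromorphicOrderAt_pos hF.meromorphicAt).mp
      (this.mono_left nhdsWithin_le_nhds)
  obtain ⟨n, hn⟩ := WithTop.ne_top_iff_exists.mp htop
  have hn0 : 0 < n := by rw [← hn] at hpos; exact_mod_cast hpos
  have hord := (HasOrder.of_meromorphic hF.meromorphicAt hn.symm one_pos).congr
    (.of_forall fun τ => (hFt τ).symm)
  rw [div_one] at hord
  obtain ⟨P, Q, hPQ⟩ := ht.exists_isLowestTerms hh.mdifferentiable hN
    (isHolomorphicModularFunction_jInv_level hN)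
  obtain ⟨τ, hτ⟩ := hasOrder_jInv.eventually_ne.exists
  have hn0' : (0 : ℝ) < n := by exact_mod_cast hn0
  have h1 := ((hord.eval_of_pos hn0' (hPQ.num_ne_zero hτ)).div
    (hord.eval_of_pos hn0' hPQ.ne_zero)).congr (.of_forall fun τ => (hPQ.eq_div τ).symm)
  have h2 := h1.unique hasOrder_jInv
  have h3 : ((P.rootMultiplicity 0 : ℤ) - Q.rootMultiplicity 0) * n = -1 := by
    have : (P.rootMultiplicity 0 - Q.rootMultiplicity 0 : ℝ) * n = -1 := by linarith
    exact_mod_cast this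
  have hn1 : n = 1 := by
    have : n ∣ 1 := ⟨-((P.rootMultiplicity 0 : ℤ) - Q.rootMultiplicity 0), by linarith⟩
    exact Int.eq_one_of_dvd_one hn0.le this
  rw [hn1] at hn
  obtain ⟨g, hg, hg0, hFg⟩ := (meromorphicOrderAt_eq_int_iff hF.meromorphicAt).mp hn.symm
  refine ⟨F, hF, hF0, ?_, .of_forall hFt⟩
  have h4 : F =ᶠ[𝓝 0] fun z => z * g z := by
    filter_upwards [eventually_nhdsWithin_iff.mp hFg] with z hz
    rcases eq_or_ne z 0 with rfl | h
    · simpa using hF0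
    · simpa using hz h
  rw [h4.deriv_eq, deriv_fun_mul differentiableAt_fun_id hg.differentiableAt]
  simpa using hg0

/-- The Fricke involution turns `j(Nτ)` into `j(τ)`, of order `-1` in `q`. This is a multiple of the
integral order of `t ∘ fricke`, which is negative and so equals `-1`. -/
lemma IsHauptmodul.simple_pole (ht : IsHauptmodul N t) (hh : IsHolomorphicModularFunction N t)
    (hN : 0 < N) {a : ℝ} (ha : a < 0) (hS : HasOrder (fun τ => t (ModularGroup.S • τ)) a) :
    ∃ (g : ℂ → ℂ), AnalyticAt ℂ g 0 ∧ g 0 ≠ 0 ∧ ∀ᶠ τ in atImInfty,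
      t (fricke N τ) = (Function.Periodic.qParam 1 τ)⁻¹ * g (Function.Periodic.qParam 1 τ) := by
  have hN' : (0 : ℝ) < N := by exact_mod_cast hN
  obtain ⟨F, hF, hFt⟩ := hh.cusps ModularGroup.S
  have hT := tendsto_scale hN
  have hw : ∀ᶠ τ in atImInfty, t (fricke N τ) = F (Function.Periodic.qParam 1 τ) := by
    filter_upwards [hT.eventually hFt] with τ hτ
    rw [fricke_eq hN, hτ, qParam_scale hN]
  have hord : HasOrder (fun τ => t (fricke N τ)) (N * a) := by
    simpa only [← fricke_eq hN] using hS.comp_scale hN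
  have hneg : N * a < 0 := mul_neg_of_pos_of_neg hN' ha
  have htop : meromorphicOrderAt F 0 ≠ ⊤ := by
    intro h
    obtain ⟨τ, h1, h2, h3⟩ := (hw.and (((tendsto_qParam_atImInfty one_pos).eventually
      (meromorphicOrderAt_eq_top_iff.mp h)).and hord.eventually_ne)).exists
    exact h3 (h1.trans h2)
  obtain ⟨n, hn⟩ := WithTop.ne_top_iff_exists.mp htop
  have hn' : (n : ℝ) = N * a := by
    have := (HasOrder.of_meromorphic hF hn.symm one_pos).congr (hw.mono fun τ hτ => hτ.symm)
    rw [div_one] at this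
    exact this.unique hord
  rw [← hn'] at hord hneg
  obtain ⟨P, Q, hPQ⟩ := ht.exists_isLowestTerms hh.mdifferentiable hN
    (isHolomorphicModularFunction_jInv_scale hN dvd_rfl)
  obtain ⟨τ, hτ⟩ := (hasOrder_jInv.comp_scale hN).eventually_ne.exists
  have h2 := hord.eq_of_eval_div_of_neg hneg (hPQ.num_ne_zero hτ) hPQ.ne_zero hasOrder_jInv
    (.of_forall fun τ => by rw [← hPQ.eq_div, scale_fricke hN, jInv_smul])
  have h3 : ((P.natDegree : ℤ) - Q.natDegree) * n = -1 := by exact_mod_cast h2.symm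
  have hn0 : n < 0 := by exact_mod_cast hneg
  have hn1 : n = -1 := by
    have : -n ∣ 1 := ⟨(P.natDegree : ℤ) - Q.natDegree, by linarith⟩
    have := Int.eq_one_of_dvd_one (by omega) this
    omega
  rw [hn1] at hn
  obtain ⟨g, hg, hg0, hFg⟩ := (meromorphicOrderAt_eq_int_iff hF).mp hn.symm
  refine ⟨g, hg, hg0, ?_⟩
  filter_upwards [hw, (tendsto_qParam_atImInfty one_pos).eventually hFg] with τ h4 h5
  rw [h4, h5]
  simp

lemma exists_isCanonicalHauptmodul (hN : 2 ≤ N) (h : GenusZero N) :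
    ∃ t, IsCanonicalHauptmodul N t := by
  have hN0 : 0 < N := by omega
  obtain ⟨t, ht, ht0⟩ := exists_isHauptmodul_hasPoleAtZero hN0 h
  obtain ⟨s, hs, hh, a, ha, hS⟩ := ht.exists_holomorphic ht0 hN0
  obtain ⟨c, hc⟩ := hs.exists_tendsto hh hN0 ha hS (not_isCoprime_zero hN)
  obtain ⟨g, hg, hg0, hgs⟩ := hs.simple_pole hh hN0 ha hS
  -- Here `c` is the value of `s` at `i∞`, and `g 0` is the coefficient of `q⁻¹` in its expansion at
  -- the cusp `0`.
  have hs' := hs.comp_mul_add (inv_ne_zero hg0) (-((g 0)⁻¹ * c))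
  have hmd : MDiff (fun τ => (g 0)⁻¹ * s τ + -((g 0)⁻¹ * c)) :=
    (mdifferentiable_const.mul hh.mdifferentiable).add mdifferentiable_const
  have hh' := IsHolomorphicModularFunction.of_isModularFunction hN0 hs'.isModularFunction hmd
  refine ⟨_, hs', differentiableOn_comp_ofComplex hmd, hs'.simple_zero hh' hN0 ?_,
    fun z => (g 0)⁻¹ * dslope g 0 z + -((g 0)⁻¹ * c), ?_, ?_⟩
  · simp only [one_smul] at hc
    simpa using (hc.const_mul (g 0)⁻¹).add_const (-((g 0)⁻¹ * c))
  · obtain ⟨p, hp⟩ := hg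
    have := hp.has_fpower_series_dslope_fslope.analyticAt
    fun_prop
  · filter_upwards [hgs] with τ hτ
    have hq := Function.Periodic.qParam_ne_zero (h := 1) (τ : ℂ)
    rw [hτ, dslope_of_ne _ hq, slope_def_field]
    field_simp
    ring

/-! ### Properties of the canonical Hauptmodul -/

lemma isCanonicalHauptmodul_hauptmodul (hN : 2 ≤ N) (h : GenusZero N) :
    IsCanonicalHauptmodul N (hauptmodul N) :=
  Classical.epsilon_spec (exists_isCanonicalHauptmodul hN h)

namespace IsCanonicalHauptmodul

lemma mdifferentiable (ht : IsCanonicalHauptmodul N t) : MDiff t :=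
  UpperHalfPlane.mdifferentiable_iff.mpr ht.holomorphic

lemma isHolomorphicModularFunction (ht : IsCanonicalHauptmodul N t) (hN : 0 < N) :
    IsHolomorphicModularFunction N t :=
  .of_isModularFunction hN ht.isHauptmodul.isModularFunction ht.mdifferentiable

lemma exists_isLowestTerms (ht : IsCanonicalHauptmodul N t) (hN : 0 < N) {f : ℍ → ℂ}
    (hf : IsHolomorphicModularFunction N f) : ∃ P Q, IsLowestTerms f t P Q :=
  ht.isHauptmodul.exists_isLowestTerms ht.mdifferentiable hN hf

lemma tendsto_zero (ht : IsCanonicalHauptmodul N t) : Tendsto t atImInfty (𝓝 0) := by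
  obtain ⟨F, hF, hF0, -, hFt⟩ := ht.simple_zero_at_infty
  have := (hF.continuousAt.tendsto.mono_left nhdsWithin_le_nhds).comp
    (tendsto_qParam_atImInfty one_pos)
  rw [hF0] at this
  exact this.congr' (hFt.mono fun τ hτ => hτ.symm)

lemma hasOrder_S (ht : IsCanonicalHauptmodul N t) (hN : 0 < N) :
    HasOrder (fun τ => t (ModularGroup.S • τ)) (-1 / N) := by
  obtain ⟨G, hG, h⟩ := ht.simple_pole_at_zero
  have hq := tendsto_qParam_atImInfty one_pos
  have h1 : Tendsto (fun τ : ℍ => 1 + Function.Periodic.qParam 1 τ *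
      G (Function.Periodic.qParam 1 τ)) atImInfty (𝓝 1) := by
    have := ((hq.mono_right nhdsWithin_le_nhds).mul (hG.continuousAt.tendsto.comp
      (hq.mono_right nhdsWithin_le_nhds))).const_add 1
    simpa using this
  have h2 : HasOrder (fun τ => t (fricke N τ)) (-1 + 0) := by
    refine (hasOrder_qParam.inv.mul (.of_tendsto h1 one_ne_zero)).congr ?_
    filter_upwards [h] with τ hτ
    rw [hτ]
    have := Function.Periodic.qParam_ne_zero (h := 1) (τ : ℂ)
    field_simp
  have h3 := h2.comp_affine one_pos hN 0
  simp only [← S_smul_eq_fricke hN] at h3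
  convert h3 using 1
  push_cast
  ring

lemma hasOrder_of_isCoprime (ht : IsCanonicalHauptmodul N t) (hN : 0 < N) {γ : SL(2, ℤ)}
    (hγ : IsCoprime (γ 1 0) (N : ℤ)) : HasOrder (fun τ => t (γ • τ)) (-1 / N) := by
  obtain ⟨g, hg, n, rfl⟩ := exists_eq_mul_S_mul_T hγ
  simp only [mul_smul, (ht.isHolomorphicModularFunction hN).invariant g hg]
  exact (ht.hasOrder_S hN).comp_T_zpow n

lemma exists_tendsto (ht : IsCanonicalHauptmodul N t) (hN : 0 < N) {γ : SL(2, ℤ)}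
    (hγ : ¬ IsCoprime (γ 1 0) (N : ℤ)) : ∃ c, Tendsto (fun τ => t (γ • τ)) atImInfty (𝓝 c) :=
  ht.isHauptmodul.exists_tendsto (ht.isHolomorphicModularFunction hN) hN
    (div_neg_of_neg_of_pos (by norm_num) (by exact_mod_cast hN)) (ht.hasOrder_S hN) hγ

/-- A property of the values of `t` near `i∞` holds on a punctured neighborhood of `0`. -/
lemma eventually_nhdsNE (ht : IsCanonicalHauptmodul N t) {p : ℂ → Prop}
    (h : ∀ᶠ τ in atImInfty, p (t τ)) : ∀ᶠ x in 𝓝[≠] (0 : ℂ), p x := by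
  obtain ⟨F, hF, hF0, hF1, hFt⟩ := ht.simple_zero_at_infty
  have h1 : ∀ᶠ q in 𝓝[≠] (0 : ℂ), p (F q) := by
    have h2 : ∀ᶠ τ : ℍ in atImInfty, p (F (Function.Periodic.qParam 1 τ)) := by
      filter_upwards [h, hFt] with τ h3 h4
      rwa [← h4]
    have h5 := (tendsto_comap_im_ofComplex.comp
      (Function.Periodic.invQParam_tendsto one_pos)).eventually h2
    have h6 : ∀ᶠ q : ℂ in 𝓝[≠] 0, 0 < (Function.Periodic.invQParam 1 q).im :=
      (Function.Periodic.invQParam_tendsto one_pos).eventually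
        (tendsto_comap.eventually_gt_atTop 0)
    filter_upwards [h5, h6, self_mem_nhdsWithin] with q h7 h8 h9
    rw [Function.comp_apply, ofComplex_apply_of_im_pos h8] at h7
    have h10 := Function.Periodic.qParam_right_inv one_ne_zero h9
    have h7' : p (F (Function.Periodic.qParam 1 (Function.Periodic.invQParam 1 q))) := h7
    rwa [h10] at h7'
  -- Because the zero of `t` is simple, `F` maps neighborhoods of `0` onto neighborhoods of `0`.
  have h2 := hF.hasStrictDerivAt.map_nhds_eq hF1
  have h3 : ∀ᶠ q in 𝓝 (0 : ℂ), F q ≠ 0 → p (F q) := by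
    filter_upwards [eventually_nhdsWithin_iff.mp h1] with q h4 h5
    exact h4 fun h6 => h5 (h6 ▸ hF0)
  have h4 : ∀ᶠ x in 𝓝 (F 0), x ≠ 0 → p x := by
    rw [← h2, eventually_map]; exact h3
  rw [hF0] at h4
  exact eventually_nhdsWithin_iff.mpr h4

end IsCanonicalHauptmodul

end

section

open CongruenceSubgroup ModularForm Manifold

/-! ### The quotient `Δ (e τ) / Δ (τ)` -/

/-- The function `Δ (e τ) / Δ (τ)`. -/
def discRatio (e : ℕ) (τ : ℍ) : ℂ := discriminant (scale e τ) / discriminant τ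

lemma discRatio_ne_zero (e : ℕ) (τ : ℍ) : discRatio e τ ≠ 0 :=
  div_ne_zero (discriminant_ne_zero _) (discriminant_ne_zero _)

lemma discRatio_mul_discriminant (e : ℕ) (τ : ℍ) :
    discRatio e τ * discriminant τ = discriminant (scale e τ) :=
  div_mul_cancel₀ _ (discriminant_ne_zero τ)

lemma mdifferentiable_discRatio {e : ℕ} (he : 0 < e) : MDiff (discRatio e) :=
  (mdifferentiable_comp_scale mdifferentiable_discriminant he).div mdifferentiable_discriminant
    discriminant_ne_zero

lemma discRatio_smul {e L : ℕ} (he : 0 < e) (hL : e ∣ L) {γ : SL(2, ℤ)} (hγ : γ ∈ Gamma0 L)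
    (τ : ℍ) : discRatio e (γ • τ) = discRatio e τ := by
  obtain ⟨γ', -, h1, h2⟩ := exists_scale_smul_of_mem_Gamma0 (M := 1) he (by simpa using hL) hγ
  rw [discRatio, discRatio, h1, discriminant_smul, discriminant_smul, ← h2]
  exact mul_div_mul_left _ _ (pow_ne_zero _ (autFactor_ne_zero γ τ))

/-- The automorphy factors of numerator and denominator cancel up to `d ^ 12`, leaving a multiple of
`Δ((aτ + b)/d) / Δ(τ)`. -/
lemma hasOrder_discRatio_smul {e : ℕ} (he : 0 < e) (γ : SL(2, ℤ)) :
    HasOrder (fun τ => discRatio e (γ • τ)) ((Int.gcd (γ 1 0) e : ℝ) ^ 2 / e - 1) := by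
  obtain ⟨γ', b, d, hd, hde, h1, h2⟩ := exists_scale_smul he γ
  have ha : 0 < Int.gcd (γ 1 0) e := Int.gcd_pos_of_ne_zero_right _ (by exact_mod_cast he.ne')
  generalize Int.gcd (γ 1 0) e = a at *
  have hd' : (d : ℂ) ≠ 0 := by exact_mod_cast hd.ne'
  have h3 := ((hasOrder_discriminant.comp_affine ha hd b).div hasOrder_discriminant).const_mul
    (inv_ne_zero (pow_ne_zero 12 hd'))
  have h4 : (a : ℝ) ^ 2 / e - 1 = a / d * 1 - 1 := by
    have h5 : (e : ℝ) = a * d := by exact_mod_cast hde.symm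
    have h6 : (a : ℝ) ≠ 0 := by exact_mod_cast ha.ne'
    have h7 : (d : ℝ) ≠ 0 := by exact_mod_cast hd.ne'
    rw [h5]; field_simp
  rw [h4]
  refine h3.congr (.of_forall fun τ => ?_)
  simp only
  rw [discRatio, h1, discriminant_smul, discriminant_smul, h2]
  have h8 := autFactor_ne_zero γ' (affine a b d τ)
  field_simp

/-! ### Numerators and denominators at the cusps -/

namespace IsLowestTerms

variable {f t : ℍ → ℂ} {P Q : ℂ[X]} {c : ℂ} {γ : SL(2, ℤ)}

lemma mul_eq (h : IsLowestTerms f t P Q) (τ : ℍ) : f τ * Q.eval (t τ) = P.eval (t τ) := by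
  rw [h.eq_div, div_mul_cancel₀ _ (h.denom_ne_zero τ)]

lemma eval_num_ne_zero (h : IsLowestTerms f t P Q) (hQ : Q.eval c = 0) : P.eval c ≠ 0 := by
  obtain ⟨u, v, huv⟩ := h.coprime
  intro hP
  have := congrArg (eval c) huv
  simp [hP, hQ] at this

lemma eval_denom_eq_zero (h : IsLowestTerms f t P Q)
    (ht : Tendsto (fun τ => t (γ • τ)) atImInfty (𝓝 c)) {x : ℝ} (hx : x < 0)
    (hf : HasOrder (fun τ => f (γ • τ)) x) : Q.eval c = 0 := by
  by_contra hQ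
  refine hf.not_tendsto hx (P.eval c / Q.eval c) ?_
  simp only [h.eq_div]
  exact (P.continuous.continuousAt.tendsto.comp ht).div (Q.continuous.continuousAt.tendsto.comp ht)
    hQ

/-- At a pole of `f` where `t` is finite, coprimality keeps `P(t)` away from zero, so `Q(t) =
P(t)/f` vanishes to the order of the pole. -/
lemma hasOrder_denom (h : IsLowestTerms f t P Q)
    (ht : Tendsto (fun τ => t (γ • τ)) atImInfty (𝓝 c)) {x : ℝ} (hx : x < 0)
    (hf : HasOrder (fun τ => f (γ • τ)) x) : HasOrder (fun τ => Q.eval (t (γ • τ))) (-x) := by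
  have hP := h.eval_num_ne_zero (h.eval_denom_eq_zero ht hx hf)
  have h1 := (HasOrder.eval_of_tendsto ht hP).div hf
  rw [zero_sub] at h1
  refine h1.congr (hf.eventually_ne.mono fun τ hτ => ?_)
  simp only
  rw [← h.mul_eq, mul_div_cancel_left₀ _ hτ]

lemma eval_denom_ne_zero (h : IsLowestTerms f t P Q)
    (ht : Tendsto (fun τ => t (γ • τ)) atImInfty (𝓝 c)) {c' : ℂ}
    (hf : Tendsto (fun τ => f (γ • τ)) atImInfty (𝓝 c')) : Q.eval c ≠ 0 := by
  intro hQ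
  refine h.eval_num_ne_zero hQ ?_
  have h1 := hf.mul (Q.continuous.continuousAt.tendsto.comp ht)
  simp only [Function.comp_def, h.mul_eq, hQ, mul_zero] at h1
  exact tendsto_nhds_unique (P.continuous.continuousAt.tendsto.comp ht) h1

end IsLowestTerms

lemma HasOrder.exists_sub_one {f : ℍ → ℂ} {x : ℝ} (h : HasOrder f x) :
    ∃ r, HasOrder f (r - 1) :=
  ⟨x + 1, by rwa [add_sub_cancel_right]⟩

/-! ### Forms of weight twelve attached to covering maps -/

lemma mdifferentiable_eval {t : ℍ → ℂ} (ht : MDiff t) (Q : ℂ[X]) : MDiff (fun τ => Q.eval (t τ)) := by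
  rw [UpperHalfPlane.mdifferentiable_iff] at ht ⊢
  exact Q.differentiable.comp_differentiableOn ht

namespace IsCanonicalHauptmodul

variable {M N e : ℕ} {t s : ℍ → ℂ} {P Q : ℂ[X]}

lemma eval_zero_denom_jInv (ht : IsCanonicalHauptmodul M t) (he : 0 < e)
    (h : IsLowestTerms (fun τ => jInv (scale e τ)) t P Q) : Q.eval 0 = 0 := by
  refine h.eval_denom_eq_zero (γ := 1) (by simpa using ht.tendsto_zero) (x := e * (-1)) ?_
    (by simpa using hasOrder_jInv.comp_scale he)
  have : (0 : ℝ) < e := by exact_mod_cast he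
  linarith

lemma eval_zero_num_jInv (ht : IsCanonicalHauptmodul M t) (he : 0 < e)
    (h : IsLowestTerms (fun τ => jInv (scale e τ)) t P Q) : P.eval 0 ≠ 0 :=
  h.eval_num_ne_zero (ht.eval_zero_denom_jInv he h)

/-- Numerator and denominator on the left both tend to zero at `i∞`; those on the right have nonzero
limits. -/
lemma discriminant_scale_div (h : IsLowestTerms (fun τ => jInv (scale e τ)) t P Q) (τ : ℍ)
    (hP : P.eval (t τ) ≠ 0) :
    discriminant (scale e τ) / Q.eval (t τ) = E₄ (scale e τ) ^ 3 / P.eval (t τ) := by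
  have h1 := h.mul_eq τ
  have h2 := discriminant_ne_zero (scale e τ)
  rw [jInv] at h1
  rw [div_eq_div_iff (h.denom_ne_zero τ) hP, ← h1]
  field_simp

/-- The covering maps `j (e τ) = P (t) / Q (t)`, `e ∣ M`. -/
lemma isFormWithZeroAtZero (ht : IsCanonicalHauptmodul M t) (hM : 2 ≤ M) (he : e ∣ M)
    (h : IsLowestTerms (fun τ => jInv (scale e τ)) t P Q) :
    ∃ r, IsFormWithZeroAtZero M r fun τ => P.eval 0 * discRatio e τ / Q.eval (t τ) := by
  have hM0 : 0 < M := by omega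
  have he0 : 0 < e := Nat.pos_of_dvd_of_pos he hM0
  have he' : (0 : ℝ) < e := by exact_mod_cast he0
  have hM' : (0 : ℝ) < M := by exact_mod_cast hM0
  have hP0 := ht.eval_zero_num_jInv he0 h
  obtain ⟨r, hS⟩ := (((hasOrder_discRatio_smul he0 ModularGroup.S).const_mul hP0).div
    ((ht.hasOrder_S hM0).eval_of_neg (div_neg_of_neg_of_pos (by norm_num) hM')
      h.ne_zero)).exists_sub_one
  refine ⟨r, ⟨?_, fun τ => ?_, fun γ hγ τ => ?_, fun γ hγ => ?_, hS, ?_⟩⟩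
  · exact (mdifferentiable_const.mul (mdifferentiable_discRatio he0)).div
      (mdifferentiable_eval ht.mdifferentiable Q) h.denom_ne_zero
  · exact div_ne_zero (mul_ne_zero hP0 (discRatio_ne_zero e τ)) (h.denom_ne_zero τ)
  · rw [discRatio_smul he0 he hγ, (ht.isHolomorphicModularFunction hM0).invariant γ hγ]
  · obtain ⟨c, hc⟩ := ht.exists_tendsto hM0 hγ
    have ha : 0 < Int.gcd (γ 1 0) e := Int.gcd_pos_of_ne_zero_right _ (by exact_mod_cast he0.ne')
    have ha' : (0 : ℝ) < Int.gcd (γ 1 0) e := by exact_mod_cast ha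
    -- `Q(t)` has order `gcd²/e`, and `discRatio e` has order `gcd²/e - 1`; the difference is `-1`.
    have h1 := h.hasOrder_denom hc (by rw [neg_div]; exact neg_neg_of_pos (by positivity))
      (hasOrder_jInv_scale_smul he0 γ)
    have h2 := ((hasOrder_discRatio_smul he0 γ).const_mul hP0).div h1
    convert h2 using 1
    ring
  · have h1 : Tendsto (fun τ => P.eval 0 * (E₄ (scale e τ) ^ 3 / P.eval (t τ))) atImInfty
        (𝓝 (P.eval 0 * (1 ^ 3 / P.eval 0))) := by
      have hT := tendsto_scale he0
      exact (((tendsto_E₄.comp hT).pow 3).div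
        (P.continuous.continuousAt.tendsto.comp ht.tendsto_zero) hP0).const_mul _
    rw [one_pow, mul_one_div_cancel hP0] at h1
    refine h1.congr' ?_
    filter_upwards [(P.continuous.continuousAt.tendsto.comp ht.tendsto_zero).eventually_ne hP0]
      with τ hτ
    rw [← discriminant_scale_div h τ hτ, ← discRatio_mul_discriminant e τ]
    ring

lemma eval_zero_denom (hs : IsCanonicalHauptmodul M s) {L : ℕ} (ht : IsCanonicalHauptmodul L t)
    (he : 0 < e) (h : IsLowestTerms (fun τ => s (scale e τ)) t P Q) :
    Q.eval 0 ≠ 0 ∧ P.eval 0 = 0 := by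
  have hT := tendsto_scale he
  have h1 := hs.tendsto_zero.comp hT
  refine ⟨h.eval_denom_ne_zero (γ := 1) (by simpa using ht.tendsto_zero) (c' := 0)
    (by simpa [Function.comp_def] using h1), ?_⟩
  have h2 := h1.mul (Q.continuous.continuousAt.tendsto.comp ht.tendsto_zero)
  simp only [Function.comp_def, h.mul_eq, zero_mul] at h2
  exact tendsto_nhds_unique (P.continuous.continuousAt.tendsto.comp ht.tendsto_zero) h2

/-- The covering maps `s (e τ) = P (t) / Q (t)`, for Hauptmoduln `s` and `t` of levels `M` and
`L`. -/
lemma isFormWithZeroAtZero_comp_scale (hs : IsCanonicalHauptmodul M s) {L : ℕ}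
    (ht : IsCanonicalHauptmodul L t) (hM : 2 ≤ M) (hL : 2 ≤ L) (he : 0 < e) (heL : e * M ∣ L)
    (h : IsLowestTerms (fun τ => s (scale e τ)) t P Q) {v : ℍ → ℂ} {r : ℝ}
    (hv : IsFormWithZeroAtZero M r v) {m : ℕ} (hm : (m : ℚ) = psi M) :
    ∃ r', IsFormWithZeroAtZero L r' fun τ =>
      v (scale e τ) * discRatio e τ / (Q.eval (t τ) / Q.eval 0) ^ m := by
  have hM0 : 0 < M := by omega
  have hL0 : 0 < L := by omega
  have hM' : (0 : ℝ) < M := by exact_mod_cast hM0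
  have hL' : (0 : ℝ) < L := by exact_mod_cast hL0
  have := NeZero.mk hM0.ne'
  have hrm : r * M = m := by
    rw [hv.order_mul_eq, ← hm]; push_cast; rfl
  obtain ⟨hQ0, -⟩ := hs.eval_zero_denom ht he h
  have hT := tendsto_scale he
  have hdiv : ∀ {γ : SL(2, ℤ)} {x : ℝ}, HasOrder (fun τ => Q.eval (t (γ • τ))) x →
      HasOrder (fun τ => (Q.eval (t (γ • τ)) / Q.eval 0) ^ m) (m * x) := by
    intro γ x hx
    simpa using (hx.div (.const hQ0)).pow m
  -- Two cases, by the image of the cusp in `X₀(M)`. Over the cusp `0` the product has order `r a/d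
  -- - 1`; there `s(eτ)` has a pole of order `a/(dM)`, so `Q(t) ^ m` has order `m a/(dM) = r a/d`,
  -- by `rM = m`. Over any other cusp the product has order `-1` and `Q(t)` has order zero.
  have key : ∀ γ : SL(2, ℤ), ∃ x, HasOrder (fun τ => v (scale e (γ • τ)) * discRatio e (γ • τ)) x ∧
      (¬ IsCoprime (γ 1 0) (L : ℤ) →
        HasOrder (fun τ => (Q.eval (t (γ • τ)) / Q.eval 0) ^ m) (x + 1)) := by
    intro γ
    obtain ⟨γ', b, d, hd, hde, h1, -⟩ := exists_scale_smul he γ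
    have hdisc := hasOrder_discRatio_smul he γ
    have ha : 0 < Int.gcd (γ 1 0) e := Int.gcd_pos_of_ne_zero_right _ (by exact_mod_cast he.ne')
    generalize Int.gcd (γ 1 0) e = a at *
    have ha' : (0 : ℝ) < a := by exact_mod_cast ha
    have hd' : (0 : ℝ) < d := by exact_mod_cast hd
    have hae : (a : ℝ) ^ 2 / e = a / d := by
      have h5 : (e : ℝ) = a * d := by exact_mod_cast hde.symm
      rw [h5]; field_simp
    rw [hae] at hdisc
    have hA := tendsto_affine ha hd b
    by_cases hγ' : IsCoprime (γ' 1 0) (M : ℤ)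
    · have h2 := ((hv.order_of_isCoprime hγ').comp_affine ha hd b)
      simp only [← h1] at h2
      refine ⟨_, h2.mul hdisc, fun hγ => ?_⟩
      obtain ⟨c, hc⟩ := ht.exists_tendsto hL0 hγ
      have h3 := (hs.hasOrder_of_isCoprime hM0 hγ').comp_affine ha hd b
      simp only [← h1] at h3
      have h4 := hdiv (h.hasOrder_denom hc (by
        rw [neg_div, mul_neg]; exact neg_neg_of_pos (by positivity)) h3)
      convert h4 using 1
      rw [← hrm]
      field_simp
      ring
    · have h2 := ((hv.order γ' hγ').comp_affine ha hd b)
      simp only [← h1] at h2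
      refine ⟨_, h2.mul hdisc, fun hγ => ?_⟩
      obtain ⟨c, hc⟩ := ht.exists_tendsto hL0 hγ
      obtain ⟨c', hc'⟩ := hs.exists_tendsto hM0 hγ'
      have h3 := hc'.comp hA
      simp only [Function.comp_def, ← h1] at h3
      have h4 := hdiv (HasOrder.eval_of_tendsto hc (h.eval_denom_ne_zero hc h3))
      convert h4 using 1
      ring
  obtain ⟨x, hx, -⟩ := key ModularGroup.S
  obtain ⟨r', hS⟩ := (hx.div (hdiv ((ht.hasOrder_S hL0).eval_of_neg
    (div_neg_of_neg_of_pos (by norm_num) hL') h.ne_zero))).exists_sub_one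
  have hne : ∀ τ, (Q.eval (t τ) / Q.eval 0) ^ m ≠ 0 := fun τ =>
    pow_ne_zero _ (div_ne_zero (h.denom_ne_zero τ) hQ0)
  refine ⟨r', ⟨?_, fun τ => ?_, fun γ hγ τ => ?_, fun γ hγ => ?_, hS, ?_⟩⟩
  · exact ((mdifferentiable_comp_scale hv.mdifferentiable he).mul
      (mdifferentiable_discRatio he)).div (((mdifferentiable_eval ht.mdifferentiable Q).div
        mdifferentiable_const fun _ => hQ0).pow m) hne
  · exact div_ne_zero (mul_ne_zero (hv.ne_zero _) (discRatio_ne_zero e τ)) (hne τ)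
  · obtain ⟨γ', hγ', h1, -⟩ := exists_scale_smul_of_mem_Gamma0 he heL hγ
    rw [discRatio_smul he ((dvd_mul_right e M).trans heL) hγ,
      (ht.isHolomorphicModularFunction hL0).invariant γ hγ, h1, hv.invariant γ' hγ']
  · obtain ⟨y, hy, hy'⟩ := key γ
    have h1 := hy.div (hy' hγ)
    convert h1 using 1
    ring
  · have h1 := ((hv.tendsto.comp hT).div ((((Q.continuous.continuousAt.tendsto.comp
      ht.tendsto_zero)).div_const (Q.eval 0)).pow m) (by simp [hQ0]))
    rw [div_self hQ0, one_pow, div_one] at h1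
    refine h1.congr fun τ => ?_
    simp only [Pi.div_apply, Function.comp_apply]
    rw [← discRatio_mul_discriminant e τ]
    ring

end IsCanonicalHauptmodul

end

section

open CongruenceSubgroup ModularForm Manifold

/-! ### Comparing functions near `0` -/

/-- The quotient tends to 1 and takes values in the finite set of `n`-th roots of unity. -/
lemma eventually_eq_of_pow_eq {f g : ℂ → ℂ} {n : ℕ} (hn : 0 < n) (hf : ContinuousAt f 0)
    (hg : ContinuousAt g 0) (hf0 : f 0 = 1) (hg0 : g 0 = 1)
    (h : ∀ᶠ x in 𝓝[≠] (0 : ℂ), f x ^ n = g x ^ n) : ∀ᶠ x in 𝓝 (0 : ℂ), f x = g x := by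
  have hfin : (((nthRoots n (1 : ℂ)).toFinset.erase 1 : Finset ℂ) : Set ℂ).Finite :=
    Finset.finite_toSet _
  have h1 : Tendsto (fun x => f x / g x) (𝓝 0) (𝓝 1) := by
    have := hf.tendsto.div hg.tendsto (by rw [hg0]; exact one_ne_zero)
    rwa [hf0, hg0, div_one] at this
  have h2 := h1.eventually (hfin.isClosed.isOpen_compl.mem_nhds (by simp))
  filter_upwards [h2, eventually_nhdsWithin_iff.mp h, hg.eventually_ne (by rw [hg0]; exact
    one_ne_zero)] with x h3 h4 h5
  rcases eq_or_ne x 0 with rfl | hx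
  · rw [hf0, hg0]
  · have h6 := h4 hx
    by_contra hne
    refine h3 ?_
    simp only [Finset.coe_erase, Set.mem_sdiff, Finset.mem_coe, Multiset.mem_toFinset,
      mem_nthRoots hn, Set.mem_singleton_iff]
    refine ⟨by rw [div_pow, h6, div_self (pow_ne_zero n h5)], fun h7 => hne ?_⟩
    rwa [div_eq_one_iff_eq h5] at h7

lemma continuousAt_eval_div_cpow {P : ℂ[X]} (hP : P.eval 0 ≠ 0) (a : ℂ) :
    ContinuousAt (fun x => (P.eval x / P.eval 0) ^ a) 0 := by
  refine ContinuousAt.cpow (P.continuous.continuousAt.div_const _) continuousAt_const ?_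
  rw [div_self hP]
  exact Complex.one_mem_slitPlane

lemma continuousAt_pullbackHHat {P Q : ℂ[X]} (hP : P.eval 0 ≠ 0) (hQ : Q.eval 0 = 0) :
    ContinuousAt (pullbackHHat P Q) 0 := by
  have h1 : ContinuousAt hHat 0 :=
    (hHat_differentiableOn.differentiableAt (Metric.ball_mem_nhds _ one_pos)).continuousAt
  have h2 : ContinuousAt (fun x => 12 ^ 3 * Q.eval x / P.eval x) 0 :=
    (continuousAt_const.mul Q.continuous.continuousAt).div P.continuous.continuousAt hP
  have h3 : (fun x => 12 ^ 3 * Q.eval x / P.eval x) 0 = 0 := by simp [hQ]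
  exact (continuousAt_eval_div_cpow hP _).mul (h1.comp_of_eq h2 h3)

lemma pullbackHHat_zero {P Q : ℂ[X]} (hP : P.eval 0 ≠ 0) (hQ : Q.eval 0 = 0) :
    pullbackHHat P Q 0 = 1 := by
  rw [pullbackHHat, hQ, mul_zero, zero_div, hHat_zero, div_self hP, Complex.one_cpow, mul_one]

lemma pullbackHHat_pow (P Q : ℂ[X]) (x : ℂ) : pullbackHHat P Q x ^ 12 =
    P.eval 0 / P.eval x * hHat (12 ^ 3 * Q.eval x / P.eval x) ^ 12 := by
  rw [pullbackHHat, mul_pow, ← Complex.cpow_nat_mul]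
  norm_num [Complex.cpow_neg_one]

/-! ### Twelfth powers of the pullbacks as modular forms. -/

namespace IsCanonicalHauptmodul

variable {M N e : ℕ} {t s : ℍ → ℂ} {P Q : ℂ[X]}

/-- The left side is `P(0) E₄(eτ)³ / P(t) = P(0) Δ(eτ) / Q(t)`, a form with its only zero at the
cusp `0`, so uniqueness applies. The right side does not involve `e`. -/
lemma eventually_pullbackHHat_pow (ht : IsCanonicalHauptmodul M t) (hM : 2 ≤ M) (he : e ∣ M)
    (h : IsLowestTerms (fun τ => jInv (scale e τ)) t P Q) {v : ℍ → ℂ} {r : ℝ}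
    (hv : IsFormWithZeroAtZero M r v) :
    ∀ᶠ τ in atImInfty, pullbackHHat P Q (t τ) ^ 12 = v τ * discriminant τ := by
  have hM0 : 0 < M := by omega
  have := NeZero.mk hM0.ne'
  have he0 : 0 < e := Nat.pos_of_dvd_of_pos he hM0
  obtain ⟨r', hr'⟩ := ht.isFormWithZeroAtZero hM he h
  have hP0 := ht.eval_zero_num_jInv he0 h
  filter_upwards [(tendsto_scale he0).eventually hHat_jHat_pow,
    (P.continuous.continuousAt.tendsto.comp ht.tendsto_zero).eventually_ne hP0] with τ h1 h2
  have h3 : 12 ^ 3 * Q.eval (t τ) / P.eval (t τ) = jHat (scale e τ) := by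
    rw [jHat, show jInv (scale e τ) = _ from h.eq_div τ, div_div_eq_mul_div]
  have h4 : ∀ x : ℂ, P.eval 0 * discRatio e τ / x * discriminant τ =
      P.eval 0 * (discRatio e τ * discriminant τ / x) := fun x => by ring
  rw [pullbackHHat_pow, h3, h1, hv.eq hr' τ, h4, discRatio_mul_discriminant,
    discriminant_scale_div h τ h2]
  ring

end IsCanonicalHauptmodul

/-! ### The transformation formulas for `h_M`. -/

section

variable {M : ℕ}

lemma exists_isLowestTerms_jInv (hM : 2 ≤ M) (h : GenusZero M) :
    ∃ P Q : ℂ[X], IsLowestTerms jInv (hauptmodul M) P Q :=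
  (isCanonicalHauptmodul_hauptmodul hM h).exists_isLowestTerms (by omega)
    (isHolomorphicModularFunction_jInv_level (by omega))

lemma isLowestTerms_coveringPair (hM : 2 ≤ M) (h : GenusZero M) :
    IsLowestTerms (fun τ => jInv (scale 1 τ)) (hauptmodul M) (coveringPair M).1
      (coveringPair M).2 := by
  obtain ⟨P, Q, hPQ⟩ := exists_isLowestTerms_jInv hM h
  simp only [scale_one]
  exact Classical.epsilon_spec (p := fun R : ℂ[X] × ℂ[X] =>
    IsLowestTerms jInv (hauptmodul M) R.1 R.2) ⟨(P, Q), hPQ⟩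

lemma continuousAt_hFun (hM : 2 ≤ M) (h : GenusZero M) : ContinuousAt (hFun M) 0 :=
  have ht := isCanonicalHauptmodul_hauptmodul hM h
  have hR := isLowestTerms_coveringPair hM h
  continuousAt_pullbackHHat (ht.eval_zero_num_jInv one_pos hR) (ht.eval_zero_denom_jInv one_pos hR)

lemma hFun_zero (hM : 2 ≤ M) (h : GenusZero M) : hFun M 0 = 1 :=
  have ht := isCanonicalHauptmodul_hauptmodul hM h
  have hR := isLowestTerms_coveringPair hM h
  pullbackHHat_zero (ht.eval_zero_num_jInv one_pos hR) (ht.eval_zero_denom_jInv one_pos hR)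

lemma eventually_hFun_pow (hM : 2 ≤ M) (h : GenusZero M) {v : ℍ → ℂ} {r : ℝ}
    (hv : IsFormWithZeroAtZero M r v) :
    ∀ᶠ τ in atImInfty, hFun M (hauptmodul M τ) ^ 12 = v τ * discriminant τ :=
  (isCanonicalHauptmodul_hauptmodul hM h).eventually_pullbackHHat_pow hM (one_dvd M)
    (isLowestTerms_coveringPair hM h) hv

lemma exists_isFormWithZeroAtZero (hM : 2 ≤ M) (h : GenusZero M) :
    ∃ r v, IsFormWithZeroAtZero M r v := by
  obtain ⟨r, hr⟩ := (isCanonicalHauptmodul_hauptmodul hM h).isFormWithZeroAtZero hM (one_dvd M)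
    (isLowestTerms_coveringPair hM h)
  exact ⟨r, _, hr⟩

lemma hFun_eq_pullbackHHat (hM : 2 ≤ M) (h : GenusZero M) {e : ℕ} (he : e ∣ M) {P Q : ℂ[X]}
    (hPQ : IsLowestTerms (fun τ => jInv (scale e τ)) (hauptmodul M) P Q) :
    ∀ᶠ x in 𝓝 (0 : ℂ), hFun M x = pullbackHHat P Q x := by
  have ht := isCanonicalHauptmodul_hauptmodul hM h
  have he0 : 0 < e := Nat.pos_of_dvd_of_pos he (by omega)
  have hP := ht.eval_zero_num_jInv he0 hPQ
  have hQ := ht.eval_zero_denom_jInv he0 hPQ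
  obtain ⟨r, v, hv⟩ := exists_isFormWithZeroAtZero hM h
  refine eventually_eq_of_pow_eq (n := 12) (by norm_num) (continuousAt_hFun hM h)
    (continuousAt_pullbackHHat hP hQ) (hFun_zero hM h) (pullbackHHat_zero hP hQ) ?_
  refine ht.eventually_nhdsNE ?_
  filter_upwards [eventually_hFun_pow hM h hv, ht.eventually_pullbackHHat_pow hM he hPQ hv]
    with τ h1 h2
  rw [h1, h2]

lemma hFun_eq_cpow_mul_hFun {L : ℕ} (hM : 2 ≤ M) (hL : 2 ≤ L) (h : GenusZero M) (h' : GenusZero L)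
    {e : ℕ} (he : 0 < e) (heL : e * M ∣ L) {P Q : ℂ[X]}
    (hPQ : IsLowestTerms (fun τ => hauptmodul M (scale e τ)) (hauptmodul L) P Q) :
    ∀ᶠ x in 𝓝 (0 : ℂ), hFun L x =
      (Q.eval x / Q.eval 0) ^ (-(psi M : ℂ) / 12) * hFun M (P.eval x / Q.eval x) := by
  have hs := isCanonicalHauptmodul_hauptmodul hM h
  have ht := isCanonicalHauptmodul_hauptmodul hL h'
  obtain ⟨hQ0, hP0⟩ := hs.eval_zero_denom ht he hPQ
  obtain ⟨r, v, hv⟩ := exists_isFormWithZeroAtZero hM h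
  have hm : ((Gamma0 M).index : ℚ) = psi M := index_Gamma0 (by omega)
  obtain ⟨r', hv'⟩ := hs.isFormWithZeroAtZero_comp_scale ht hM hL he heL hPQ hv hm
  have h0 : (fun x => P.eval x / Q.eval x) 0 = 0 := by simp [hP0]
  refine eventually_eq_of_pow_eq (n := 12) (by norm_num) (continuousAt_hFun hL h')
    ((continuousAt_eval_div_cpow hQ0 _).mul ((continuousAt_hFun hM h).comp_of_eq
      (P.continuous.continuousAt.div Q.continuous.continuousAt hQ0) h0)) (hFun_zero hL h') ?_ ?_
  · rw [hP0, zero_div, hFun_zero hM h, div_self hQ0, Complex.one_cpow, mul_one]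
  refine ht.eventually_nhdsNE ?_
  filter_upwards [eventually_hFun_pow hL h' hv',
    (tendsto_scale he).eventually (eventually_hFun_pow hM h hv)] with τ h1 h2
  -- As `ψ(M)` is the index, the twelfth power of the prefactor is an integral power, free of
  -- branches.
  have h3 : ((12 : ℕ) : ℂ) * (-(psi M : ℂ) / 12) = -((Gamma0 M).index : ℂ) := by
    rw [← hm]; push_cast; ring
  rw [h1, mul_pow, ← hPQ.eq_div, h2, ← Complex.cpow_nat_mul, h3, Complex.cpow_neg,
    Complex.cpow_natCast, ← discRatio_mul_discriminant e τ]
  ring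

end

end

end HeckeCurve

end

open HeckeCurve in
theorem mainTheorem1 :
    -- part 1
    (∀ M : ℕ, 2 ≤ M → GenusZero M →
      (∃ P Q : ℂ[X], IsLowestTerms jInv (hauptmodul M) P Q) ∧
      (∃ P' Q' : ℂ[X], IsLowestTerms (fun τ => jInv (scale M τ)) (hauptmodul M) P' Q') ∧
      ∀ P Q P' Q' : ℂ[X],
        IsLowestTerms jInv (hauptmodul M) P Q →
        IsLowestTerms (fun τ => jInv (scale M τ)) (hauptmodul M) P' Q' →
        ∀ᶠ x in 𝓝 (0 : ℂ),
          hFun M x =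
            (P.eval x / P.eval 0) ^ (-(1 / 12) : ℂ) * hHat (12 ^ 3 * Q.eval x / P.eval x) ∧
          hFun M x =
            (P'.eval x / P'.eval 0) ^ (-(1 / 12) : ℂ) * hHat (12 ^ 3 * Q'.eval x / P'.eval x)) ∧
    -- part 2
    (∀ M N : ℕ, 2 ≤ M → 1 ≤ N → GenusZero M → GenusZero (N * M) →
      (∃ P Q : ℂ[X], IsLowestTerms (hauptmodul M) (hauptmodul (N * M)) P Q) ∧
      (∃ P' Q' : ℂ[X],
        IsLowestTerms (fun τ => hauptmodul M (scale N τ)) (hauptmodul (N * M)) P' Q') ∧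
      ∀ P Q P' Q' : ℂ[X],
        IsLowestTerms (hauptmodul M) (hauptmodul (N * M)) P Q →
        IsLowestTerms (fun τ => hauptmodul M (scale N τ)) (hauptmodul (N * M)) P' Q' →
        ∀ᶠ x in 𝓝 (0 : ℂ),
          hFun (N * M) x =
            (Q.eval x / Q.eval 0) ^ (-(psi M : ℂ) / 12) * hFun M (P.eval x / Q.eval x) ∧
          hFun (N * M) x =
            (Q'.eval x / Q'.eval 0) ^ (-(psi M : ℂ) / 12) *
              hFun M (P'.eval x / Q'.eval x)) := by
  refine ⟨fun M hM h => ?_, fun M N hM hN h h' => ?_⟩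
  · have hM0 : 0 < M := by omega
    refine ⟨exists_isLowestTerms_jInv hM h,
      (isCanonicalHauptmodul_hauptmodul hM h).exists_isLowestTerms hM0
        (isHolomorphicModularFunction_jInv_scale hM0 dvd_rfl), fun P Q P' Q' hPQ hPQ' => ?_⟩
    exact (hFun_eq_pullbackHHat hM h (one_dvd M) (by simpa only [scale_one] using hPQ)).and
      (hFun_eq_pullbackHHat hM h dvd_rfl hPQ')
  · have hL : 2 ≤ N * M := hM.trans (Nat.le_mul_of_pos_left M hN)
    have hL0 : 0 < N * M := by omega
    have hs := (isCanonicalHauptmodul_hauptmodul hM h).isHolomorphicModularFunction (by omega)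
    have ht := isCanonicalHauptmodul_hauptmodul hL h'
    have h1 : 1 * M ∣ N * M := mul_dvd_mul_right (one_dvd N) M
    have hs₁ : IsHolomorphicModularFunction (N * M) (hauptmodul M) := by
      simpa only [scale_one] using hs.comp_scale one_pos hL0 h1
    refine ⟨ht.exists_isLowestTerms hL0 hs₁,
      ht.exists_isLowestTerms hL0 (hs.comp_scale hN hL0 dvd_rfl), fun P Q P' Q' hPQ hPQ' => ?_⟩
    -- The two formulas are the cases `e = 1` and `e = N`.
    exact (hFun_eq_cpow_mul_hFun hM hL h h' one_pos h1 (by simpa only [scale_one] using hPQ)).and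
      (hFun_eq_cpow_mul_hFun hM hL h h' hN dvd_rfl hPQ')
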